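/- **Setting.** Let $p(x)=x^4-\frac{4a}{3}x^3-2bx^2-4cx$ over $\mathbb{Q}[a,b,c]$. A *closed web* $\Gamma$ is a finite oriented graph without free ends, possibly with vertexless circles, whose vertices are trivalent sources ($+$) or trivalent sinks ($-$), with a cyclic order of the edges at each vertex (for a web in the plane: clockwise at sources, counterclockwise at sinks). Each edge and circle carries marks $x_i$ (at least one); $R=\mathbb{Q}[a,b,c][x_1,\dots,x_m]$. A *complete identification* $\sigma$ pairs each sink with a source. It gives the Koszul matrix factorization $\sigma(\hat\Gamma)$ over $R$, of potential $0$, with a row $\{\pi_{xy},\,x-y\}$, $\pi_{xy}=\frac{p(x)-p(y)}{x-y}$, for each arc from a mark $y$ to the next mark $x$, and rows $\{g_i,\ e_i-v_i\}$, $i=1,2,3$, for each pair, where $e_i$ and $v_i$ are the elementary symmetric polynomials of the marks next to the source and next to the sink, respectively, and $\sum_i g_i(e_i-v_i)=p_v(e)-p_v(v)$ with $p_v(e_1,e_2,e_3)=\sum p$, the $g_i$ being the successive divided differences of $p_v$ in $e_1,e_2,e_3$. *Normalization.* Replace the two vertices of each pair by three strands that join incoming to outgoing edges compatibly with the cyclic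 orders (three positions $\rho$ for each pair). This gives circles. A *representative* of $\hat\Gamma$ is $\sigma(\hat\Gamma)$ with a choice of $\rho$ and an ordered list of the circles, one shift $\langle 1\rangle$ being applied for each circle; for planar $\Gamma$ the homology is then in $\mathbb{Z}/2$-degree $0$. Transposing two circles of the list changes the sign. A surgery along an ordered pair $(x,y)$ of marks takes the list $(C_y,C_x,\dots)$ to $(C,\dots)$ if it merges the circles $C_x,C_y$ to $C$, and $(C,\dots)$ to $(C_x,C_y,\dots)$ if it splits $C$. *Canonical identifications* of representatives are the compositions of: a change of the list (acting by its sign); moving the strands of one pair by one step (the identity, with the sign of the surgeries along $(x_1,x_0),(x_1,x_2)$ at the incoming edges $x_0,x_1,x_2$ of the pair); and the interchange of two identified pairs, with incoming edges $x_0,x_1,x_2$ and $y_0,y_1,y_2$. The last one is, with the sign of the surgeries along $(x_0,y_0),(x_1,y_1),(x_2,y_2)$, a homomorphism $\sigma(\hat\Gamma)\to\sigma'(\hat\Gamma)\langle1\rangle$ which, after one variable at each of the two sinks is excluded by means of the entries $g_3=4(v_1-a)$, is the identity on the remaining rows (the first rows of the two pairs being the same rows, interchanged) tensored with $$\psi=\left(\begin{pmatrix}1&-\tfrac12\\-1&-\tfrac12\end{pmatrix},\begin{pmatrix}\tfrac12&-\tfrac12\\-1&-1\end{pmatrix}\right)$$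 on the two quadratic (second) rows. *The saddle map.* Let $s\colon x_3\to x_1$ and $t\colon x_2\to x_4$ be two distinct arcs of $\Gamma$, and let $\Gamma'$ be the web in which they are replaced by $x_2\to x_1$ and $x_3\to x_4$. For the labelling $(s,t)$, let $\eta_{(s,t)}\colon\sigma(\hat\Gamma)\to\sigma(\hat\Gamma')\langle1\rangle$ be the pair of matrices $$\eta_0=\begin{pmatrix}e_{123}+e_{124}&1\\-e_{134}-e_{234}&1\end{pmatrix},\qquad \eta_1=\begin{pmatrix}-1&1\\-e_{124}-e_{234}&-e_{134}-e_{123}\end{pmatrix},$$ $$e_{ijk}=\tfrac12(x_i^2+x_j^2+x_k^2+x_ix_j+x_ix_k+x_jx_k)-\tfrac{2a}{3}(x_i+x_j+x_k)-b,$$ on the rows of the two arcs, tensored with the identity on all other rows. The map $\hat\eta$ of representatives is $\eta_{(s,t)}$ with the sign of the surgery along $(x_3,x_2)$. The other labelling $(t,s)$ exchanges $x_1\leftrightarrow x_4$, $x_2\leftrightarrow x_3$. **Lemma.** The map $\hat\eta$ is well defined for closed webs, with no sign ambiguity. That is, let $\Gamma'$ be obtained from a closed web $\Gamma$ by one saddle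 at two distinct arcs. Then: 1. For each complete identification, both labellings give a homomorphism of matrix factorizations $\sigma(\hat\Gamma)\to\sigma(\hat\Gamma')\langle 1\rangle$; and every representative of $\hat\Gamma$ is, for either labelling, the source of a map $\hat\eta$ to a representative of $\hat\Gamma'$. 2. Any two representatives of $\hat\Gamma$, and any two of $\hat\Gamma'$, are canonically identified. 3. Let $F\colon P\to P'$ and $G\colon Q\to Q'$ be maps $\hat\eta$ for any choices of representatives and of labellings. Then for all canonical identifications $A\colon P\to Q$ and $B\colon P'\to Q'$ the maps $BF$ and $GA$ are homotopic, with sign $+$. 4. $\hat\eta$ is independent of the marks: contracting an arc between two distinct marks other than the two arcs of the saddle, i.e. excluding a variable by means of the row of that arc, takes each map $\hat\eta$ to the map $\hat\eta$ (for the same labelling, positions and list of circles) of the web with one mark less. -/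

import Mathlib

open MvPolynomial

noncomputable section

namespace Sl3

/-! ### Rings -/

/-- The ground ring `ℚ[a, b, c]`. -/
abbrev Ground := MvPolynomial (Fin 3) ℚ

/-- The ring `ℚ[a, b, c][x₁, …, xₘ]` with one variable for each of `m` marks. -/
abbrev MarkRing (m : ℕ) := MvPolynomial (Fin m) Ground

/-- The parameters `a`, `b`, `c`. -/
def pa (m : ℕ) : MarkRing m := C (X 0)
def pb (m : ℕ) : MarkRing m := C (X 1)
def pc (m : ℕ) : MarkRing m := C (X 2)

/-- A rational number as a scalar. -/
def rat (m : ℕ) (q : ℚ) : MarkRing m := C (C q)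

/-- `π_{xy} = (p(x) - p(y)) / (x - y)` for `p(x) = x⁴ - (4a/3) x³ - 2b x² - 4c x`. -/
def piPoly {m : ℕ} (x y : MarkRing m) : MarkRing m :=
  (x ^ 3 + x ^ 2 * y + x * y ^ 2 + y ^ 3) - rat m (4 / 3) * pa m * (x ^ 2 + x * y + y ^ 2)
    - 2 * pb m * (x + y) - 4 * pc m

/-- The polynomial `e_{ijk}` of the saddle map, in its explicit form. -/
def ePoly {m : ℕ} (x y z : MarkRing m) : MarkRing m :=
  rat m (1 / 2) * (x ^ 2 + y ^ 2 + z ^ 2 + x * y + x * z + y * z)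
    - rat m (2 / 3) * pa m * (x + y + z) - pb m

/-- The elementary symmetric polynomials `e₁, e₂, e₃` of three elements. -/
def elemSym {m : ℕ} (x : Fin 3 → MarkRing m) : Fin 3 → MarkRing m :=
  ![x 0 + x 1 + x 2, x 0 * x 1 + x 0 * x 2 + x 1 * x 2, x 0 * x 1 * x 2]

/-- The polynomials `g₁, g₂, g₃` of a trivalent vertex, with
`p_v(e) - p_v(v) = ∑ gᵢ (eᵢ - vᵢ)` where `p_v(e₁, e₂, e₃) = p(x) + p(y) + p(z)`. -/
def gPoly {m : ℕ} (e v : Fin 3 → MarkRing m) : Fin 3 → MarkRing m :=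
  ![(e 0 ^ 3 + e 0 ^ 2 * v 0 + e 0 * v 0 ^ 2 + v 0 ^ 3) - 4 * e 1 * (e 0 + v 0) + 4 * e 2
      - rat m (4 / 3) * pa m * (e 0 ^ 2 + e 0 * v 0 + v 0 ^ 2 - 3 * e 1)
      - 2 * pb m * (e 0 + v 0) - 4 * pc m,
    2 * (e 1 + v 1) - 4 * v 0 ^ 2 + 4 * pa m * v 0 + 4 * pb m,
    4 * (v 0 - pa m)]

/-! ### Koszul matrix factorizations -/

/-- The rows of a Koszul matrix: one for each of `n` arcs, three for each of `k` pairs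
of identified vertices. -/
abbrev Row (n k : ℕ) := Fin n ⊕ (Fin k × Fin 3)

/-- The order in which the rows are written. -/
def rowRank {n k : ℕ} : Row n k → ℕ
  | Sum.inl e => e
  | Sum.inr (j, i) => n + 3 * j + i

/-- The free module underlying the tensor product of the elementary Koszul factorizations
`R → R → R` of all rows; the basis vector of a set `S` of rows is the tensor product of the
odd generators of the rows in `S` and the even generators of the other rows. -/
abbrev KMod (R : Type) (n k : ℕ) := Finset (Row n k) → R

abbrev KEnd (R : Type) [CommRing R] (n k : ℕ) := Module.End R (KMod R n k)

/-- The Koszul sign of moving past the rows of `S` that precede row `i`. -/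
def ksign {n k : ℕ} (i : Row n k) (S : Finset (Row n k)) : ℤ :=
  (-1) ^ (S.filter fun j => rowRank j < rowRank i).card

/-- The operator which takes the even generator of row `i` to its odd generator, and the
odd one to `0` (exterior multiplication by `θᵢ`, with the Koszul sign). -/
def raise {R : Type} [CommRing R] {n k : ℕ} (i : Row n k) : KEnd R n k :=
  LinearMap.pi fun S => if i ∈ S then ksign i S • LinearMap.proj (S.erase i) else 0

/-- The operator which takes the odd generator of row `i` to its even generator, and the
even one to `0` (contraction with `θᵢ`, with the Koszul sign). -/
def lower {R : Type} [CommRing R] {n k : ℕ} (i : Row n k) : KEnd R n k :=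
  LinearMap.pi fun S => if i ∈ S then 0 else ksign i S • LinearMap.proj (insert i S)

/-- The differential of the Koszul factorization `⨂ {αᵢ, βᵢ}`; its square is `∑ αᵢ βᵢ`. -/
def koszulDiff {R : Type} [CommRing R] {n k : ℕ} (α β : Row n k → R) : KEnd R n k :=
  ∑ i, (α i • raise i + β i • lower i)

/-- The `ℤ/2`-grading: `1` on `M₀` and `-1` on `M₁`. -/
def parityOp (R : Type) [CommRing R] (n k : ℕ) : KEnd R n k :=
  LinearMap.pi fun S => ((-1 : ℤ) ^ S.card) • LinearMap.proj S

/-- `F` is a homomorphism of matrix factorizations of `ℤ/2`-degree `p`. For `p` odd this is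
a homomorphism to the shift by `⟨1⟩` of the target, whose differential is `-d'`. -/
structure IsHom {R : Type} [CommRing R] {n k : ℕ} (d d' : KEnd R n k) (p : ℕ) (F : KEnd R n k) : Prop where
  parity : F * parityOp R n k = ((-1 : ℤ) ^ p) • (parityOp R n k * F)
  comm : d' * F = ((-1 : ℤ) ^ p) • (F * d)

/-- Homotopy of homomorphisms of `ℤ/2`-degree `p`. -/
def Homotopic {R : Type} [CommRing R] {n k : ℕ} (d d' : KEnd R n k) (p : ℕ) (F G : KEnd R n k) : Prop :=
  ∃ h : KEnd R n k, h * parityOp R n k = ((-1 : ℤ) ^ (p + 1)) • (parityOp R n k * h) ∧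
    F - G = d' * h + ((-1 : ℤ) ^ p) • (h * d)

/-- The map given by a pair of `2 × 2` matrices on the tensor product of two rows, tensored
with the identity of all other rows. The source bases are `(1, θ₂θ₁)` and `(θ₁, θ₂)`; the
matrix `M₀` takes `(1, θ₂θ₁)` to `(φ₁, φ₂)` and `M₁` takes `(θ₁, θ₂)` to `(1, φ₂φ₁)`.
In these bases `{α₁, β₁} ⊗ {α₂, β₂}` has the differentials
`(α₁, β₂; α₂, -β₁)` and `(β₁, β₂; α₂, -α₁)`. -/
def blockMap {R : Type} [CommRing R] {n k : ℕ} (θ₁ θ₂ φ₁ φ₂ : Row n k) (M₀ M₁ : Matrix (Fin 2) (Fin 2) R) :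
    KEnd R n k :=
  (M₀ 0 0 • raise φ₁ + M₀ 1 0 • raise φ₂) * (lower θ₁ * raise θ₁ * lower θ₂ * raise θ₂)
  + (M₀ 0 1 • raise φ₁ + M₀ 1 1 • raise φ₂) *
      (lower θ₁ * raise θ₁ * lower θ₂ * raise θ₂) * lower θ₁ * lower θ₂
  + (M₁ 0 0 • 1 + M₁ 1 0 • (raise φ₂ * raise φ₁)) *
      (lower θ₁ * raise θ₁ * lower θ₂ * raise θ₂) * lower θ₁
  + (M₁ 0 1 • 1 + M₁ 1 1 • (raise φ₂ * raise φ₁)) *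
      (lower θ₁ * raise θ₁ * lower θ₂ * raise θ₂) * lower θ₂

/-- The map which renames the rows `r` and `r'` into each other (`θ_r ↔ θ_{r'}`). -/
def renameRows {R : Type} [CommRing R] {n k : ℕ} (r r' : Row n k) : KEnd R n k :=
  1 - (raise r - raise r') * (lower r - lower r')

/-! ### Closed webs -/

/-- A closed web with `m` marks, `n` arcs between marks, `k` vertices of `(+)`-type (all three
edges leave) and `k` vertices of `(-)`-type (all three edges enter); every edge and every circle
carries at least one mark. The marks cut the web into oriented segments. Each mark is the
initial point of exactly one segment: an arc `e`, or the last segment of the `i`-th edge into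
the `(-)`-vertex `j`; it is `leave (inl e)`, `leave (inr (j, i))` respectively. Each mark is the
end point of exactly one segment: an arc `e`, or the first segment of the `i`-th edge out of the
`(+)`-vertex `j`; it is `enter (inl e)`, `enter (inr (j, i))` respectively.
The edges at a vertex are numbered by `Fin 3` in their cyclic order in the plane: clockwise at
`(+)`-vertices, counterclockwise at `(-)`-vertices. Planarity itself is not required. -/
structure ClosedWeb (m n k : ℕ) where
  leave : Row n k ≃ Fin m
  enter : Row n k ≃ Fin m

/-- Signs of the shifts, one for each circle: `Turn π l w l' ε`. Here `π` is a permutation of the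
marks, whose cycles are circles, and `l` lists these circles (by one mark on each). Surgery along a pair
`(x, y)` changes `π` to `π * swap x y`; it merges two circles or splits one. If `w` is a sequence
of surgeries, then `ε = ±1` is the sign with which it takes the ordered list `l` to the ordered
list `l'`: transposing two circles in a list gives `-1`, a merger takes the ordered circles
`C_y, C_x, …` to `C, …`, and a splitting takes `C, …` to `C_x, C_y, …`. -/
inductive Turn {m : ℕ} :
    Equiv.Perm (Fin m) → List (Fin m) → List (Fin m × Fin m) → List (Fin m) → ℤ → Prop
  | nil (π : Equiv.Perm (Fin m)) (l : List (Fin m)) : Turn π l [] l 1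
  | rep {π l l₁ w l' ε} : List.Forall₂ π.SameCycle l l₁ → Turn π l₁ w l' ε → Turn π l w l' ε
  | exch {π u x y v w l' ε} : Turn π (u ++ y :: x :: v) w l' ε →
      Turn π (u ++ x :: y :: v) w l' (-ε)
  | merge {π x y r w l' ε} : ¬ π.SameCycle x y →
      Turn (π * Equiv.swap x y) (x :: r) w l' ε → Turn π (y :: x :: r) ((x, y) :: w) l' ε
  | split {π x y r w l' ε} : x ≠ y → π.SameCycle x y →
      Turn (π * Equiv.swap x y) (x :: y :: r) w l' ε → Turn π (x :: r) ((x, y) :: w) l' ε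

namespace ClosedWeb

variable {m n k : ℕ} (W : ClosedWeb m n k)

/-- The variables of the three edges entering a `(-)`-vertex. -/
def inVar (j : Fin k) (i : Fin 3) : MarkRing m := X (W.leave (Sum.inr (j, i)))

/-- The variables of the three edges leaving a `(+)`-vertex. -/
def outVar (j : Fin k) (i : Fin 3) : MarkRing m := X (W.enter (Sum.inr (j, i)))

/-- First column of the Koszul matrix of the web in which the `(-)`-vertex `j` is identified
with the `(+)`-vertex `σ j`. An arc from `y` to `x` contributes `{π_{xy}, x - y}`; a pair of
identified vertices contributes the rows `{gᵢ, eᵢ(outgoing) - eᵢ(incoming)}` which are left of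
the two vertex factorizations after the common vertex variables are excluded. -/
def colA (σ : Equiv.Perm (Fin k)) : Row n k → MarkRing m
  | Sum.inl e => piPoly (X (W.enter (Sum.inl e))) (X (W.leave (Sum.inl e)))
  | Sum.inr (j, i) => gPoly (elemSym (W.outVar (σ j))) (elemSym (W.inVar j)) i

/-- Second column of the Koszul matrix. -/
def colB (σ : Equiv.Perm (Fin k)) : Row n k → MarkRing m
  | Sum.inl e => X (W.enter (Sum.inl e)) - X (W.leave (Sum.inl e))
  | Sum.inr (j, i) => elemSym (W.outVar (σ j)) i - elemSym (W.inVar j) i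

/-- The differential of the matrix factorization of the web with the complete identification
`σ` of its vertices. -/
def d (σ : Equiv.Perm (Fin k)) : KEnd (MarkRing m) n k := koszulDiff (W.colA σ) (W.colB σ)

/-- How the incoming edges at the `(-)`-vertices continue as outgoing edges at the
`(+)`-vertices: the edge `i` at `j` as the edge `i + ρ j` at `σ j`. -/
def glue (σ : Equiv.Perm (Fin k)) (ρ : Fin k → Fin 3) : Row n k ≃ Row n k :=
  Equiv.sumCongr (Equiv.refl _)
    { toFun := fun q => (σ q.1, q.2 + ρ q.1)
      invFun := fun q => (σ.symm q.1, q.2 - ρ (σ.symm q.1))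
      left_inv := fun q => by simp
      right_inv := fun q => by simp }

/-- The successor permutation of the marks on the circles which are obtained when the two vertices
of each identified pair are replaced by three strands, in accordance with the cyclic orders. -/
def circ (σ : Equiv.Perm (Fin k)) (ρ : Fin k → Fin 3) : Equiv.Perm (Fin m) :=
  W.leave.symm.trans ((glue σ ρ).trans W.enter)

/-- The data which determine a representative of the class of the web: a complete identification
`σ` of the vertices, rotations `ρ` (the position of the three strands at each identified pair),
and a list of the resulting circles, by one mark on each. The matrix factorization of the
representative is that of `σ`, with one shift `⟨1⟩` for each of the circles, in the order of the
list; for a planar web its homology then is in degree zero. -/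
structure Rep where
  σ : Equiv.Perm (Fin k)
  ρ : Fin k → Fin 3
  circles : List (Fin m)
  distinct : circles.Pairwise fun x y => ¬ (W.circ σ ρ).SameCycle x y
  complete : ∀ x, ∃ y ∈ circles, (W.circ σ ρ).SameCycle x y

/-- The matrices of the isomorphism `ψ` which switches two virtual edges. -/
def psi₀ (m : ℕ) : Matrix (Fin 2) (Fin 2) (MarkRing m) :=
  !![1, -rat m (1 / 2); -1, -rat m (1 / 2)]
def psi₁ (m : ℕ) : Matrix (Fin 2) (Fin 2) (MarkRing m) :=
  !![rat m (1 / 2), -rat m (1 / 2); -1, -1]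

/-- The `(+)`-vertices identified with the `(-)`-vertices `j` and `j'` are interchanged. -/
def exchange (σ : Equiv.Perm (Fin k)) (j j' : Fin k) : Equiv.Perm (Fin k) :=
  (Equiv.swap j j').trans σ

/-- The coefficient of the odd generators of the third rows of the pairs `j` and `j'`. -/
def thirdRows (m n : ℕ) {k : ℕ} (j j' : Fin k) : KEnd (MarkRing m) n k :=
  lower (Sum.inr (j', 2)) * lower (Sum.inr (j, 2))

/-- The map `ψ` on the second rows of the pairs `j` and `j'`, while their first rows
trade places and all other rows are left alone. -/
def quadPsi (m n : ℕ) {k : ℕ} (j j' : Fin k) : KEnd (MarkRing m) n k :=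
  renameRows (Sum.inr (j, 0)) (Sum.inr (j', 0)) *
    blockMap (Sum.inr (j, 1)) (Sum.inr (j', 1)) (Sum.inr (j, 1)) (Sum.inr (j', 1))
      (psi₀ m) (psi₁ m)

/-- `F` is the isomorphism from the factorization of `σ` to the shift by `⟨1⟩` of that of
`exchange σ j j'`. The third rows of the pairs `j` and `j'` have the linear
entries `4 (e₁(incoming) - a)`, by which one variable at `j` and one at `j'` are excluded:
the factorization is projected to the coefficient of the odd generators of these two rows, modulo
the two linear entries. What remains has the same linear rows for both identifications
(the first rows of `j` and `j'` trade places), and `F` induces there the map `ψ` on the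
two quadratic (second) rows, tensored with the identity of all others. -/
structure IsExchangeIso (σ : Equiv.Perm (Fin k)) (j j' : Fin k) (F : KEnd (MarkRing m) n k) :
    Prop where
  isHom : IsHom (W.d σ) (W.d (exchange σ j j')) 1 F
  induces : ∀ (z : KMod (MarkRing m) n k) (S : Finset (Row n k)),
    thirdRows m n j j' (F z) S - quadPsi m n j j' (thirdRows m n j j' z) S ∈
      Ideal.span {elemSym (W.inVar j) 0 - pa m, elemSym (W.inVar j') 0 - pa m}

/-- The canonical isomorphisms between representatives of the class of a closed web: a
change of the list of circles acts by its sign; moving the three strands of an identified pair one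
step is the identity of the Koszul factorization (its third power is the identity);
interchanging two identified pairs is the isomorphism `F` above. All come with the sign with
which they transport the list of circles. -/
inductive Ident : W.Rep → W.Rep → KEnd (MarkRing m) n k → Prop
  | relist {P Q : W.Rep} {ε : ℤ} : Q.σ = P.σ → Q.ρ = P.ρ →
      Turn (W.circ P.σ P.ρ) P.circles [] Q.circles ε → Ident P Q (ε • 1)
  | rotate {P Q : W.Rep} {ε : ℤ} (j : Fin k) : Q.σ = P.σ →
      Q.ρ = Function.update P.ρ j (P.ρ j + 1) →
      Turn (W.circ P.σ P.ρ) P.circles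
        [(W.leave (Sum.inr (j, 1)), W.leave (Sum.inr (j, 0))),
         (W.leave (Sum.inr (j, 1)), W.leave (Sum.inr (j, 2)))] Q.circles ε →
      Ident P Q (ε • 1)
  | exchange {P Q : W.Rep} {ε : ℤ} {F : KEnd (MarkRing m) n k} (j j' : Fin k) : j ≠ j' →
      W.IsExchangeIso P.σ j j' F →
      Q.σ = exchange P.σ j j' → Q.ρ = P.ρ ∘ Equiv.swap j j' →
      Turn (W.circ P.σ P.ρ) P.circles
        [(W.leave (Sum.inr (j, 0)), W.leave (Sum.inr (j', 0))),
         (W.leave (Sum.inr (j, 1)), W.leave (Sum.inr (j', 1))),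
         (W.leave (Sum.inr (j, 2)), W.leave (Sum.inr (j', 2)))] Q.circles ε →
      Ident P Q (ε • F)
  | comp {P Q T : W.Rep} {F G : KEnd (MarkRing m) n k} : Ident P Q F → Ident Q T G → Ident P T (G * F)

/-- The web obtained by a saddle at the arcs `s : x₃ → x₁` and `t : x₂ → x₄`, which become
`s : x₃ → x₄` and `t : x₂ → x₁`. -/
def saddle (s t : Fin n) : ClosedWeb m n k where
  leave := W.leave
  enter := (Equiv.swap (Sum.inl s) (Sum.inl t)).trans W.enter

/-- The saddle homomorphism `η`, for the labelling of the four ends by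
`s : x₃ → x₁`, `t : x₂ → x₄`. The source rows are `(s, t)`, the target rows are the
arcs `t : x₂ → x₁` and `s : x₃ → x₄`, in this order. -/
def eta (s t : Fin n) : KEnd (MarkRing m) n k :=
  let x₁ : MarkRing m := X (W.enter (Sum.inl s))
  let x₂ : MarkRing m := X (W.leave (Sum.inl t))
  let x₃ : MarkRing m := X (W.leave (Sum.inl s))
  let x₄ : MarkRing m := X (W.enter (Sum.inl t))
  blockMap (Sum.inl s) (Sum.inl t) (Sum.inl t) (Sum.inl s)
    !![ePoly x₁ x₂ x₃ + ePoly x₁ x₂ x₄, 1; -ePoly x₁ x₃ x₄ - ePoly x₂ x₃ x₄, 1]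
    !![-1, 1; -ePoly x₁ x₂ x₄ - ePoly x₂ x₃ x₄, -ePoly x₁ x₃ x₄ - ePoly x₁ x₂ x₃]

/-- `F` is the homomorphism which the labelling `(s, t)` of the saddle assigns to
the representatives `P` of the web and `P'` of the web `W'` after the saddle (with the same
identifications at the vertices). -/
def IsSaddleMap (W' : ClosedWeb m n k) (s t : Fin n) (P : W.Rep) (P' : W'.Rep)
    (F : KEnd (MarkRing m) n k) : Prop :=
  P'.σ = P.σ ∧ P'.ρ = P.ρ ∧ ∃ ε : ℤ,
    Turn (W.circ P.σ P.ρ) P.circles [(W.leave (Sum.inl s), W.leave (Sum.inl t))] P'.circles ε ∧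
    F = ε • W.eta s t

end ClosedWeb

/-! ### Removing a mark -/

/-- The arcs and vertices that are kept when the arc `u` is contracted. -/
def keepRow {n k : ℕ} (u : Fin (n + 1)) : Row n k → Row (n + 1) k :=
  Sum.map u.succAbove id

/-- `W₀` arises from `W` by contracting the arc `u` between two distinct marks: these become
one mark, the other marks stay distinct, and `f` is the map of marks. -/
structure RemovesMark {m n k : ℕ} (W : ClosedWeb (m + 1) (n + 1) k) (u : Fin (n + 1))
    (f : Fin (m + 1) → Fin m) (W₀ : ClosedWeb m n k) : Prop where
  ne : W.leave (Sum.inl u) ≠ W.enter (Sum.inl u)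
  glue : f (W.leave (Sum.inl u)) = f (W.enter (Sum.inl u))
  inj : ∀ x y, f x = f y → x = y ∨
    ((x = W.leave (Sum.inl u) ∨ x = W.enter (Sum.inl u)) ∧
     (y = W.leave (Sum.inl u) ∨ y = W.enter (Sum.inl u)))
  leave : ∀ r, W₀.leave r = f (W.leave (keepRow u r))
  enter : ∀ r, W₀.enter r = f (W.enter (keepRow u r))

/-- The homotopy equivalence which excludes a variable by means of the row `{π_{xy}, x - y}`
of the arc `u`: it kills the odd generator of that row and puts `x = y`. -/
def excludeVar {m n k : ℕ} (u : Fin (n + 1)) (f : Fin (m + 1) → Fin m)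
    (z : KMod (MarkRing (m + 1)) (n + 1) k) : KMod (MarkRing m) n k :=
  fun S => rename f (z (S.image (keepRow u)))

end Sl3

end

/-!
# The saddle map of a closed web has no sign ambiguity

All operators on Koszul factorizations are written in terms of the creation operators `raise i` and
the annihilation operators `lower i`, which satisfy the canonical anticommutation relations. In this
form the saddle homomorphism `η` is an explicit odd element (`ClosedWeb.eta_eq`), which is a
homomorphism by five polynomial identities (`saddle_comm`) and is antisymmetric in the labelling
(`ClosedWeb.eta_swap`). The map `ψ` is a difference of Clifford vectors `θ + ½ ∂` (`quadPsi_eq`), so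
that the maps `quadPsi a b` satisfy the relations of transpositions up to signs: they square to `1`,
change sign under `a ↔ b`, and conjugate one another with the sign `-1`. The interchange of two
pairs is realized by conjugating `ψ` with unipotent row operations (`exchangeMap`).

*Signs of the lists of circles.* They are computed by operators, too. For every mark `x` there is a
Clifford vector `surgVec x` over `ℚ`, and a surgery along `(x, y)` acts by `surgVec x - surgVec y`.
Every permutation of the marks has states `f`, singled out by the linear conditions `IsState`, and
an ordered list of the circles is read off from a state as the top coefficient of the product of the
list with `f`. Surgeries take states to states, and the sign which `Turn` assigns to a sequence of
surgeries is the ratio of the top coefficients (`Turn.transport`). The products of these operators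
for the moves of strands and for the interchanges satisfy the same kind of relations as the maps
`ψ`.

*Coherence.* Pair the operator on states with the map of factorizations obtained after the exclusion
of one variable at each sink. For a chain of interchanges and moves of strands the product of these
pairs is, up to one common sign, determined by the endpoints of the chain (`MoveLift.unique`): signs
in the two components can only change simultaneously. The same pairing makes the saddle commute or
anticommute with the chain simultaneously in both components. Hence the two composites `B F` and `G
A` agree, with the correct sign, after the exclusion of the variables
(`ClosedWeb.saddle_coherence`).

*Homotopy.* A homomorphism that vanishes after the exclusion of variables is null-homotopic
(`exists_homotopy_of_vanishes`): the linear forms at the sinks form a regular sequence in any order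
(`ClosedWeb.linearForm_regular`), and the homotopy is obtained by dividing by one of them after the
other.

The existence of the maps follows from the behaviour of cycles under multiplication with a
transposition (`ListsCycles.exists_turn`), and the independence of the marks from the fact that the
contraction of an arc changes neither the circles nor the rows in which `η` acts
(`RemovesMark.exists_isSaddleMap`).
-/

open MvPolynomial

noncomputable section

namespace Sl3

/-! ### Creation and annihilation operators -/

section CAR

variable {R : Type} [CommRing R] {n k : ℕ}

/-- The ring structure of the endomorphisms. Together with the next instance this is a shortcut:
the instances found otherwise for products and for negation agree only after unfolding. -/
instance koszulEndRing : Ring (KEnd R n k) := inferInstance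

instance koszulEndNeg : Neg (KEnd R n k) := koszulEndRing.toNeg

theorem rowRank_injective : Function.Injective (rowRank : Row n k → ℕ) := by
  rintro (a | ⟨a, i⟩) (b | ⟨b, j⟩) h <;> simp only [rowRank] at h
  · exact congrArg _ (Fin.ext h)
  · have := a.2; omega
  · have := b.2; omega
  · have := i.2; have := j.2
    exact congrArg _ (Prod.ext (Fin.ext (by simp only; omega)) (Fin.ext (by simp only; omega)))

theorem neg_kEnd_apply (F : KEnd R n k) (z : KMod R n k) (S : Finset (Row n k)) :
    (-F) z S = -(F z S) := rfl

theorem raise_apply (i : Row n k) (z : KMod R n k) (S : Finset (Row n k)) :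
    raise i z S = if i ∈ S then (ksign i S : R) * z (S.erase i) else 0 := by
  simp only [raise, LinearMap.pi_apply]
  split_ifs <;> simp

theorem lower_apply (i : Row n k) (z : KMod R n k) (S : Finset (Row n k)) :
    lower i z S = if i ∈ S then 0 else (ksign i S : R) * z (insert i S) := by
  simp only [lower, LinearMap.pi_apply]
  split_ifs <;> simp

theorem parityOp_apply (z : KMod R n k) (S : Finset (Row n k)) :
    parityOp R n k z S = (-1) ^ S.card * z S := by
  simp [parityOp]

theorem ksign_mul_self (i : Row n k) (S : Finset (Row n k)) : ksign i S * ksign i S = 1 := by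
  rw [ksign, ← mul_pow]; simp

theorem ksign_erase_self (i : Row n k) (S : Finset (Row n k)) :
    ksign i (S.erase i) = ksign i S := by
  rw [ksign, ksign, Finset.filter_erase, Finset.erase_eq_of_notMem (by simp)]

theorem ksign_insert_self (i : Row n k) (S : Finset (Row n k)) :
    ksign i (insert i S) = ksign i S := by
  rw [ksign, ksign, Finset.filter_insert, if_neg (lt_irrefl _)]

theorem ksign_insert {i j : Row n k} {S : Finset (Row n k)} (hj : j ∉ S) :
    ksign i (insert j S) = (if rowRank j < rowRank i then -1 else 1) * ksign i S := by
  rw [ksign, ksign, Finset.filter_insert]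
  split_ifs
  · rw [Finset.card_insert_of_notMem (by simp [hj]), pow_succ]; ring
  · simp

theorem ksign_erase {i j : Row n k} {S : Finset (Row n k)} (hj : j ∈ S) :
    ksign i (S.erase j) = (if rowRank j < rowRank i then -1 else 1) * ksign i S := by
  conv_rhs => rw [← Finset.insert_erase hj, ksign_insert (Finset.notMem_erase j S), ← mul_assoc]
  split_ifs <;> simp

theorem ite_rowRank_antisymm {i j : Row n k} (h : i ≠ j) :
    (if rowRank j < rowRank i then (-1 : ℤ) else 1) =
      -(if rowRank i < rowRank j then (-1 : ℤ) else 1) := by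
  have := rowRank_injective.ne h
  split_ifs <;> first | rfl | omega

theorem raise_raise (i j : Row n k) : (raise i * raise j : KEnd R n k) = -(raise j * raise i) := by
  refine LinearMap.ext fun z => funext fun S => ?_
  simp only [Module.End.mul_apply, neg_kEnd_apply, raise_apply, Finset.mem_erase]
  by_cases h : i = j
  · subst h; simp
  have h' : j ≠ i := Ne.symm h
  by_cases hi : i ∈ S <;> by_cases hj : j ∈ S <;> simp only [hi, hj, h, h', ne_eq, not_false_eq_true,
    and_self, and_false, if_true, if_false, mul_zero, neg_zero]
  rw [ksign_erase hi, ksign_erase hj, Finset.erase_right_comm, ite_rowRank_antisymm h]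
  push_cast; ring

theorem lower_lower (i j : Row n k) : (lower i * lower j : KEnd R n k) = -(lower j * lower i) := by
  refine LinearMap.ext fun z => funext fun S => ?_
  simp only [Module.End.mul_apply, neg_kEnd_apply, lower_apply, Finset.mem_insert]
  by_cases h : i = j
  · subst h; simp
  have h' : j ≠ i := Ne.symm h
  by_cases hi : i ∈ S <;> by_cases hj : j ∈ S <;> simp only [hi, hj, h, h', or_self, or_true,
    if_true, if_false, mul_zero, neg_zero]
  rw [ksign_insert hi, ksign_insert hj, Finset.insert_comm, ite_rowRank_antisymm h]
  push_cast; ring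

theorem lower_raise_self (i : Row n k) :
    (lower i * raise i : KEnd R n k) = 1 - raise i * lower i := by
  have hs (S : Finset (Row n k)) : (ksign i S : R) * ksign i S = 1 := by
    exact_mod_cast congrArg (Int.cast : ℤ → R) (ksign_mul_self i S)
  refine LinearMap.ext fun z => funext fun S => ?_
  simp only [Module.End.mul_apply, LinearMap.sub_apply, Module.End.one_apply, Pi.sub_apply,
    lower_apply, raise_apply, Finset.mem_insert_self, Finset.notMem_erase, if_true, if_false]
  by_cases hi : i ∈ S <;> simp only [hi, if_true, if_false]
  · rw [Finset.insert_erase hi, ksign_erase_self, ← mul_assoc, hs]; ring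
  · rw [Finset.erase_insert hi, ksign_insert_self, ← mul_assoc, hs]; ring

theorem lower_raise {i j : Row n k} (h : i ≠ j) :
    (lower i * raise j : KEnd R n k) = -(raise j * lower i) := by
  have h' : j ≠ i := Ne.symm h
  refine LinearMap.ext fun z => funext fun S => ?_
  simp only [Module.End.mul_apply, neg_kEnd_apply, lower_apply, raise_apply,
    Finset.mem_insert, Finset.mem_erase]
  by_cases hi : i ∈ S <;> by_cases hj : j ∈ S <;> simp only [hi, hj, h, h', or_self, or_true,
    ne_eq, not_false_eq_true, and_self, and_false, if_true, if_false, mul_zero, neg_zero]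
  rw [ksign_insert hi, ksign_erase hj, Finset.erase_insert_of_ne h, ite_rowRank_antisymm h]
  push_cast; ring

theorem raise_sq (i : Row n k) : (raise i * raise i : KEnd R n k) = 0 := by
  refine LinearMap.ext fun z => funext fun S => ?_
  simp [raise_apply]

theorem lower_sq (i : Row n k) : (lower i * lower i : KEnd R n k) = 0 := by
  refine LinearMap.ext fun z => funext fun S => ?_
  simp [lower_apply]

theorem parityOp_sq : (parityOp R n k * parityOp R n k : KEnd R n k) = 1 := by
  refine LinearMap.ext fun z => funext fun S => ?_
  simp only [Module.End.mul_apply, parityOp_apply, Module.End.one_apply, ← mul_assoc, ← mul_pow]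
  simp

theorem parityOp_raise (i : Row n k) :
    (parityOp R n k * raise i : KEnd R n k) = -(raise i * parityOp R n k) := by
  refine LinearMap.ext fun z => funext fun S => ?_
  simp only [Module.End.mul_apply, parityOp_apply, raise_apply, neg_kEnd_apply]
  split_ifs with h
  · rw [← Finset.card_erase_add_one h, pow_succ]; ring
  · simp

theorem parityOp_lower (i : Row n k) :
    (parityOp R n k * lower i : KEnd R n k) = -(lower i * parityOp R n k) := by
  refine LinearMap.ext fun z => funext fun S => ?_
  simp only [Module.End.mul_apply, parityOp_apply, lower_apply, neg_kEnd_apply]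
  split_ifs with h
  · simp
  · rw [Finset.card_insert_of_notMem h, pow_succ]; ring

end CAR

/-! ### The saddle and exchange matrices as elements of the Clifford algebra -/

section Block

variable {R : Type} [CommRing R] {n k : ℕ}

/-- Normal ordering for two distinct rows `i` and `j`, as a rewriting system: creation operators
go to the left, and `i` goes before `j`. -/
theorem normalOrder {i j : Row n k} (h : i ≠ j) (x : KEnd R n k) :
    (raise i * (raise i * x) = 0 ∧ raise j * (raise j * x) = 0 ∧
      lower i * (lower i * x) = 0 ∧ lower j * (lower j * x) = 0) ∧
    (raise j * (raise i * x) = -(raise i * (raise j * x)) ∧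
      lower j * (lower i * x) = -(lower i * (lower j * x))) ∧
    (lower i * (raise j * x) = -(raise j * (lower i * x)) ∧
      lower j * (raise i * x) = -(raise i * (lower j * x))) ∧
    (lower i * (raise i * x) = x - raise i * (lower i * x) ∧
      lower j * (raise j * x) = x - raise j * (lower j * x)) := by
  simp only [← mul_assoc, raise_sq, lower_sq, zero_mul, raise_raise j i, lower_lower j i,
    lower_raise h, lower_raise h.symm, lower_raise_self, sub_mul, one_mul, neg_mul, and_self]

/-- Matrices of the shape that occurs in the saddle map, in normal order. -/
theorem blockMap_eta {i j : Row n k} (h : i ≠ j) {a b c d κ : R} (hc : c = κ - a) (hd : d = b - κ) :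
    blockMap i j j i !![a, 1; b, 1] !![-1, 1; c, d] =
      a • raise j + b • raise i - lower i + lower j
        + κ • (raise i * (raise j * lower i)) - κ • (raise i * (raise j * lower j)) := by
  have N := fun x => normalOrder (R := R) h x
  simp only [forall_and] at N
  subst hc hd
  simp only [blockMap, Matrix.cons_val', Matrix.cons_val_zero, Matrix.of_apply,
    Matrix.cons_val_fin_one, Matrix.cons_val_one, one_smul, add_mul, sub_mul, mul_sub,
    one_mul, mul_one, smul_mul_assoc, neg_smul, neg_mul, mul_neg, mul_assoc,
    N, lower_sq, lower_lower j i, lower_raise_self,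
    mul_zero, smul_zero, sub_zero, zero_add, add_zero, neg_neg, neg_zero]
  module

/-- Matrices of the shape of `ψ` give a difference of two Clifford vectors. -/
theorem blockMap_psi {i j : Row n k} (h : i ≠ j) (q : R) :
    blockMap i j i j !![1, -q; -1, -q] !![q, -q; -1, -1] =
      raise i - raise j + q • (lower i - lower j) := by
  have N := fun x => normalOrder (R := R) h x
  simp only [forall_and] at N
  simp only [blockMap, Matrix.cons_val', Matrix.cons_val_zero, Matrix.of_apply,
    Matrix.cons_val_fin_one, Matrix.cons_val_one, one_smul, add_mul, sub_mul, mul_sub,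
    one_mul, mul_one, smul_mul_assoc, neg_smul, neg_mul, mul_neg, mul_assoc,
    N, lower_sq, raise_raise j i, lower_lower j i, lower_raise_self,
    mul_zero, smul_zero, sub_zero, zero_add, add_zero, neg_neg, neg_zero]
  module

end Block

/-! ### Koszul differentials -/

section Koszul

variable {R : Type} [CommRing R] {n k : ℕ}

theorem koszulDiff_mul_raise (α β : Row n k → R) (i : Row n k) :
    koszulDiff α β * raise i = β i • 1 - raise i * koszulDiff α β := by
  rw [eq_sub_iff_add_eq, koszulDiff, Finset.sum_mul, Finset.mul_sum, ← Finset.sum_add_distrib,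
    Finset.sum_eq_single i]
  · simp only [add_mul, mul_add, smul_mul_assoc, mul_smul_comm, raise_sq, lower_raise_self]
    module
  · intro j _ hj
    simp only [add_mul, mul_add, smul_mul_assoc, mul_smul_comm, raise_raise j i, lower_raise hj]
    module
  · simp

theorem koszulDiff_mul_lower (α β : Row n k → R) (i : Row n k) :
    koszulDiff α β * lower i = α i • 1 - lower i * koszulDiff α β := by
  rw [eq_sub_iff_add_eq, koszulDiff, Finset.sum_mul, Finset.mul_sum, ← Finset.sum_add_distrib,
    Finset.sum_eq_single i]
  · simp only [add_mul, mul_add, smul_mul_assoc, mul_smul_comm, lower_sq, lower_raise_self]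
    module
  · intro j _ hj
    simp only [add_mul, mul_add, smul_mul_assoc, mul_smul_comm, lower_lower j i, lower_raise hj.symm]
    module
  · simp

theorem two_smul_koszulDiff_sq (α β : Row n k → R) :
    (2 : R) • (koszulDiff α β * koszulDiff α β) = (2 * ∑ i, α i * β i) • (1 : KEnd R n k) := by
  have h : koszulDiff α β * koszulDiff α β = ∑ i, ((α i * β i) • (1 : KEnd R n k) +
      (β i * α i) • (1 : KEnd R n k) - (α i • raise i + β i • lower i) * koszulDiff α β) := by
    conv_lhs => rw [koszulDiff.eq_def α β, Finset.mul_sum]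
    refine Finset.sum_congr rfl fun i _ => ?_
    rw [← koszulDiff, mul_add, mul_smul_comm, mul_smul_comm, koszulDiff_mul_raise,
      koszulDiff_mul_lower, add_mul, smul_mul_assoc, smul_mul_assoc]
    module
  rw [Finset.sum_sub_distrib, ← Finset.sum_mul, ← koszulDiff, eq_sub_iff_add_eq] at h
  rw [two_smul, h, Finset.mul_sum, Finset.sum_smul]
  refine Finset.sum_congr rfl fun i _ => ?_
  module

theorem koszulDiff_add (α β α' β' : Row n k → R) :
    koszulDiff (α + α') (β + β') = koszulDiff α β + koszulDiff α' β' := by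
  rw [koszulDiff, koszulDiff, koszulDiff, ← Finset.sum_add_distrib]
  refine Finset.sum_congr rfl fun i _ => ?_
  simp only [Pi.add_apply]
  module

theorem koszulDiff_eq_pair {α β : Row n k → R} {i j : Row n k} (h : i ≠ j)
    (h0 : ∀ r, r ≠ i → r ≠ j → α r = 0 ∧ β r = 0) :
    koszulDiff α β = α i • raise i + β i • lower i + (α j • raise j + β j • lower j) := by
  rw [koszulDiff, Finset.sum_eq_add i j h]
  · intro r _ hr
    simp [h0 r hr.1 hr.2]
  · simp
  · simp

/-- The elementary computation behind the saddle map: if two Koszul factorizations differ in the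
rows `i` and `j` only, five polynomial identities make the operator of `blockMap_eta`
a homomorphism of odd degree. -/
theorem saddle_comm {α β α' β' : Row n k → R} {i j : Row n k} (h : i ≠ j)
    (h0 : ∀ r, r ≠ i → r ≠ j → α' r = α r ∧ β' r = β r) {a b κ : R}
    (e1 : a * β' j + b * β' i - α i + α j = 0)
    (e2 : κ * (α i - α j) + (α' i - α i) * a - (α' j - α j) * b = 0)
    (e3 : κ * β' i - (α' j - α j) - a * (β' i - β i) = 0)
    (e4 : κ * β' j + (α' i - α i) - b * (β' j - β j) = 0)
    (e5 : β' i - β i + (β' j - β j) = 0) :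
    koszulDiff α' β' * (a • raise j + b • raise i - lower i + lower j
        + κ • (raise i * (raise j * lower i)) - κ • (raise i * (raise j * lower j))) =
      -((a • raise j + b • raise i - lower i + lower j
        + κ • (raise i * (raise j * lower i)) - κ • (raise i * (raise j * lower j))) *
          koszulDiff α β) := by
  have N := fun x => normalOrder (R := R) h x
  simp only [forall_and] at N
  have hd : koszulDiff α' β' = koszulDiff α β + ((α' i - α i) • raise i + (β' i - β i) • lower i +
      ((α' j - α j) • raise j + (β' j - β j) • lower j)) := by
    have := koszulDiff_eq_pair (α := α' - α) (β := β' - β) h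
      (fun r hi hj => by simp [h0 r hi hj])
    simp only [Pi.sub_apply] at this
    rw [← this, ← koszulDiff_add]
    simp
  have D1 : ∀ i x, koszulDiff α β * (raise i * x) = β i • x - raise i * (koszulDiff α β * x) := by
    intro i x
    rw [← mul_assoc, koszulDiff_mul_raise, sub_mul, smul_mul_assoc, one_mul, mul_assoc]
  have D2 : ∀ i x, koszulDiff α β * (lower i * x) = α i • x - lower i * (koszulDiff α β * x) := by
    intro i x
    rw [← mul_assoc, koszulDiff_mul_lower, sub_mul, smul_mul_assoc, one_mul, mul_assoc]
  rw [hd]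
  simp only [add_mul, mul_add, sub_mul, mul_sub, smul_mul_assoc, mul_smul_comm, mul_neg,
    mul_assoc, D1, koszulDiff_mul_raise, koszulDiff_mul_lower, mul_one,
    N, raise_sq, lower_sq, raise_raise j i, lower_lower j i, lower_raise_self, lower_raise h,
    lower_raise h.symm, mul_zero, smul_zero, sub_zero, zero_add, add_zero, neg_zero]
  linear_combination (norm := module) e1 • (1 : KEnd R n k) + e2 • (raise i * raise j)
    + e3 • (raise j * lower i) - e3 • (raise j * lower j) - a • e5 • (raise j * lower j)
    - e4 • (raise i * lower i) + e4 • (raise i * lower j) - b • e5 • (raise i * lower i)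
    + e5 • (lower i * lower j) - κ • e5 • (raise i * (raise j * (lower i * lower j)))

end Koszul

/-! ### The saddle homomorphism -/

section Eta

theorem rat_mul_rat (m : ℕ) (p q : ℚ) : rat m p * rat m q = rat m (p * q) := by
  simp [rat]

theorem rat_natCast (m : ℕ) (q : ℕ) : rat m q = q := by
  simp [rat]

theorem two_mul_rat_half (m : ℕ) : 2 * rat m (1 / 2) = 1 := by
  have := rat_mul_rat m (2 : ℕ) (1 / 2)
  rw [rat_natCast] at this
  norm_num at this ⊢
  rw [this]
  simp [rat]

theorem two_mul_rat_two_thirds (m : ℕ) : 2 * rat m (2 / 3) = rat m (4 / 3) := by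
  have := rat_mul_rat m (2 : ℕ) (2 / 3)
  rw [rat_natCast] at this
  norm_num at this ⊢
  exact this

theorem two_mul_ePoly {m : ℕ} (x y z : MarkRing m) :
    2 * ePoly x y z = x ^ 2 + y ^ 2 + z ^ 2 + x * y + x * z + y * z
      - rat m (4 / 3) * pa m * (x + y + z) - 2 * pb m := by
  rw [ePoly, ← two_mul_rat_two_thirds]
  linear_combination (x ^ 2 + y ^ 2 + z ^ 2 + x * y + x * z + y * z) * two_mul_rat_half m

variable {R : Type} [CommRing R] {n k m : ℕ}

theorem isHom_odd_iff {d d' F : KEnd R n k} :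
    IsHom d d' 1 F ↔ parityOp R n k * F = -(F * parityOp R n k) ∧ d' * F = -(F * d) := by
  constructor
  · rintro ⟨h1, h2⟩
    rw [pow_one, neg_one_smul] at h1 h2
    exact ⟨by rw [h1, neg_neg], h2⟩
  · rintro ⟨h1, h2⟩
    refine ⟨?_, ?_⟩
    · rw [pow_one, neg_one_smul, h1, neg_neg]
    · rw [pow_one, neg_one_smul, h2]

theorem ClosedWeb.eta_eq (W : ClosedWeb m n k) {s t : Fin n} (h : s ≠ t) :
    W.eta s t =
      (ePoly (X (W.enter (.inl s))) (X (W.leave (.inl t))) (X (W.leave (.inl s)))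
        + ePoly (X (W.enter (.inl s))) (X (W.leave (.inl t))) (X (W.enter (.inl t))))
          • raise (.inl t)
      + (-ePoly (X (W.enter (.inl s))) (X (W.leave (.inl s))) (X (W.enter (.inl t)))
        - ePoly (X (W.leave (.inl t))) (X (W.leave (.inl s))) (X (W.enter (.inl t))))
          • raise (.inl s)
      - lower (.inl s) + lower (.inl t)
      + (ePoly (X (W.enter (.inl s))) (X (W.leave (.inl t))) (X (W.leave (.inl s)))
        - ePoly (X (W.leave (.inl t))) (X (W.leave (.inl s))) (X (W.enter (.inl t))))
          • (raise (.inl s) * (raise (.inl t) * lower (.inl s)))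
      - (ePoly (X (W.enter (.inl s))) (X (W.leave (.inl t))) (X (W.leave (.inl s)))
        - ePoly (X (W.leave (.inl t))) (X (W.leave (.inl s))) (X (W.enter (.inl t))))
          • (raise (.inl s) * (raise (.inl t) * lower (.inl t))) := by
  have h' : (Sum.inl s : Row n k) ≠ Sum.inl t := fun e => h (Sum.inl_injective e)
  exact blockMap_eta h' (by ring) (by ring)

/-- The two labellings of a saddle give opposite homomorphisms. -/
theorem ClosedWeb.eta_swap (W : ClosedWeb m n k) {s t : Fin n} (h : s ≠ t) :
    W.eta t s = -W.eta s t := by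
  rw [W.eta_eq h, W.eta_eq h.symm, ← mul_assoc (raise (.inl t)), ← mul_assoc (raise (.inl t)),
    raise_raise (.inl t), neg_mul, neg_mul]
  simp only [mul_assoc, ePoly]
  module

theorem ClosedWeb.parityOp_mul_eta (W : ClosedWeb m n k) {s t : Fin n} (h : s ≠ t) :
    parityOp (MarkRing m) n k * W.eta s t = -(W.eta s t * parityOp (MarkRing m) n k) := by
  have P1 : ∀ (i : Row n k) (x : KEnd (MarkRing m) n k), parityOp (MarkRing m) n k * (raise i * x)
      = -(raise i * (parityOp (MarkRing m) n k * x)) := by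
    intro i x
    rw [← mul_assoc, parityOp_raise, neg_mul, mul_assoc]
  rw [W.eta_eq h]
  simp only [mul_add, mul_sub, add_mul, sub_mul, mul_smul_comm, smul_mul_assoc, P1, parityOp_raise,
    parityOp_lower, mul_assoc, mul_neg, neg_neg]
  module

theorem ClosedWeb.isHom_eta (W : ClosedWeb m n k) {s t : Fin n} (h : s ≠ t)
    (σ : Equiv.Perm (Fin k)) : IsHom (W.d σ) ((W.saddle s t).d σ) 1 (W.eta s t) := by
  refine isHom_odd_iff.2 ⟨W.parityOp_mul_eta h, ?_⟩
  have h' : (Sum.inl s : Row n k) ≠ Sum.inl t := fun e => h (Sum.inl_injective e)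
  have two : (2 : MarkRing m) ≠ 0 := two_ne_zero
  rw [W.eta_eq h]
  unfold ClosedWeb.d
  have hs : (W.saddle s t).enter (.inl s) = W.enter (.inl t) := by
    simp [ClosedWeb.saddle]
  have ht : (W.saddle s t).enter (.inl t) = W.enter (.inl s) := by
    simp [ClosedWeb.saddle]
  have hr (r : Row n k) (h1 : r ≠ .inl s) (h2 : r ≠ .inl t) :
      (W.saddle s t).enter r = W.enter r := by
    simp [ClosedWeb.saddle, Equiv.swap_apply_of_ne_of_ne h1 h2]
  have hl : (W.saddle s t).leave = W.leave := rfl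
  refine saddle_comm h' ?_ ?_ ?_ ?_ ?_ ?_
  · rintro (e | ⟨j, i⟩) h1 h2
    · simp [ClosedWeb.colA, ClosedWeb.colB, hr _ h1 h2, hl]
    · have ho (j : Fin k) : (W.saddle s t).outVar j = W.outVar j := by
        funext i
        simp [ClosedWeb.outVar, hr]
      have hi (j : Fin k) : (W.saddle s t).inVar j = W.inVar j := rfl
      simp [ClosedWeb.colA, ClosedWeb.colB, ho, hi]
  all_goals
    simp only [ClosedWeb.colA, ClosedWeb.colB, hs, ht, hl]
    generalize (X (W.enter (.inl s)) : MarkRing m) = x₁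
    generalize (X (W.leave (.inl t)) : MarkRing m) = x₂
    generalize (X (W.leave (.inl s)) : MarkRing m) = x₃
    generalize (X (W.enter (.inl t)) : MarkRing m) = x₄
    have T₁₂₃ := two_mul_ePoly x₁ x₂ x₃
    have T₁₂₄ := two_mul_ePoly x₁ x₂ x₄
    have T₁₃₄ := two_mul_ePoly x₁ x₃ x₄
    have T₂₃₄ := two_mul_ePoly x₂ x₃ x₄
    refine mul_left_cancel₀ two ?_
  · simp only [piPoly]
    linear_combination (x₁ - x₂) * (T₁₂₃ + T₁₂₄) - (x₄ - x₃) * (T₁₃₄ + T₂₃₄)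
  · linear_combination (norm := (simp only [piPoly]; ring)) (piPoly x₁ x₃ - piPoly x₄ x₂) * (T₁₂₃ - T₂₃₄)
      + (piPoly x₄ x₃ - piPoly x₁ x₃) * (T₁₂₃ + T₁₂₄)
      + (piPoly x₁ x₂ - piPoly x₄ x₂) * (T₁₃₄ + T₂₃₄)
  · simp only [piPoly]
    linear_combination (x₄ - x₃) * (T₁₂₃ - T₂₃₄) - (x₄ - x₁) * (T₁₂₃ + T₁₂₄)
  · simp only [piPoly]
    linear_combination (x₁ - x₂) * (T₁₂₃ - T₂₃₄) + (x₁ - x₄) * (T₁₃₄ + T₂₃₄)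
  · ring

end Eta

/-! ### The potential of a closed web -/

section Potential

variable {n k m : ℕ}

/-- The polynomial `p(x) = x⁴ - (4a/3) x³ - 2b x² - 4c x`. -/
def potential {m : ℕ} (x : MarkRing m) : MarkRing m :=
  x ^ 4 - rat m (4 / 3) * pa m * x ^ 3 - 2 * pb m * x ^ 2 - 4 * pc m * x

theorem piPoly_mul_sub {m : ℕ} (x y : MarkRing m) :
    piPoly x y * (x - y) = potential x - potential y := by
  simp only [piPoly, potential]; ring

theorem three_mul_rat_four_thirds (m : ℕ) : 3 * rat m (4 / 3) = 4 := by
  have := rat_mul_rat m (3 : ℕ) (4 / 3)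
  rw [rat_natCast] at this
  rw [show ((3 : ℕ) : ℚ) * (4 / 3) = (4 : ℕ) by norm_num, rat_natCast] at this
  exact_mod_cast this

theorem sum_gPoly_mul_sub {m : ℕ} (x y : Fin 3 → MarkRing m) :
    ∑ i, gPoly (elemSym x) (elemSym y) i * (elemSym x i - elemSym y i) =
      ∑ i, potential (x i) - ∑ i, potential (y i) := by
  simp only [Fin.sum_univ_three, gPoly, elemSym, potential, Matrix.cons_val_zero,
    Matrix.cons_val_one, Matrix.cons_val]
  linear_combination pa m * (x 0 * x 1 * x 2 - y 0 * y 1 * y 2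
    - (x 0 * x 1 + x 0 * x 2 + x 1 * x 2 - y 0 * y 1 - y 0 * y 2 - y 1 * y 2) * (y 0 + y 1 + y 2))
      * three_mul_rat_four_thirds m

theorem ClosedWeb.sum_colA_mul_colB (W : ClosedWeb m n k) (σ : Equiv.Perm (Fin k)) :
    ∑ r, W.colA σ r * W.colB σ r = 0 := by
  have key : ∀ f : Row n k ≃ Fin m, ∑ r, potential (X (f r) : MarkRing m) =
      ∑ x, potential (X x : MarkRing m) := fun f =>
    Equiv.sum_comp f fun x => potential (X x : MarkRing m)
  have h := (key W.enter).trans (key W.leave).symm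
  rw [Fintype.sum_sum_type, Fintype.sum_sum_type, Fintype.sum_prod_type, Fintype.sum_prod_type] at h
  rw [Fintype.sum_sum_type, Fintype.sum_prod_type]
  simp only [ClosedWeb.colA, ClosedWeb.colB, piPoly_mul_sub, sum_gPoly_mul_sub,
    Finset.sum_sub_distrib]
  rw [Equiv.sum_comp σ fun j => ∑ i, potential (W.outVar j i)]
  simp only [ClosedWeb.outVar, ClosedWeb.inVar]
  linear_combination h

theorem ClosedWeb.d_sq (W : ClosedWeb m n k) (σ : Equiv.Perm (Fin k)) : W.d σ * W.d σ = 0 := by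
  have h := two_smul_koszulDiff_sq (W.colA σ) (W.colB σ)
  rw [W.sum_colA_mul_colB, mul_zero, zero_smul] at h
  have h' := congrArg (fun x => rat m (1 / 2) • x) h
  simp only [smul_smul, mul_comm _ (2 : MarkRing m), two_mul_rat_half, one_smul, smul_zero] at h'
  exact h'

end Potential

/-! ### Clifford vectors and renaming of rows -/

section Clifford

variable {R : Type} [CommRing R] {n k : ℕ}

/-- The Clifford vector `θᵢ + q ∂ᵢ`, whose square is `q`. -/
def cliff (q : R) (i : Row n k) : KEnd R n k := raise i + q • lower i

theorem cliff_mul_cliff_of_ne (q : R) {i j : Row n k} (h : i ≠ j) :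
    cliff q i * cliff q j = -(cliff q j * cliff q i) := by
  simp only [cliff, add_mul, mul_add, smul_mul_assoc, mul_smul_comm, raise_raise i j,
    lower_lower i j, lower_raise h, lower_raise h.symm]
  module

theorem cliff_sq (q : R) (i : Row n k) : cliff q i * cliff q i = q • (1 : KEnd R n k) := by
  simp only [cliff, add_mul, mul_add, smul_mul_assoc, mul_smul_comm, raise_sq, lower_sq,
    lower_raise_self]
  module

theorem parityOp_cliff (q : R) (i : Row n k) :
    parityOp R n k * cliff q i = -(cliff q i * parityOp R n k) := by
  simp only [cliff, mul_add, add_mul, mul_smul_comm, smul_mul_assoc, parityOp_raise, parityOp_lower]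
  module

theorem lower_cliff (q : R) {i j : Row n k} (h : i ≠ j) :
    lower i * cliff q j = -(cliff q j * lower i) := by
  simp only [cliff, mul_add, add_mul, mul_smul_comm, smul_mul_assoc, lower_lower i j, lower_raise h]
  module

theorem koszulDiff_mul_cliff (α β : Row n k → R) (q : R) (i : Row n k) :
    koszulDiff α β * cliff q i = (β i + q * α i) • 1 - cliff q i * koszulDiff α β := by
  simp only [cliff, mul_add, add_mul, mul_smul_comm, smul_mul_assoc, koszulDiff_mul_raise,
    koszulDiff_mul_lower]
  module

theorem renameRows_comm (r r' : Row n k) : (renameRows r' r : KEnd R n k) = renameRows r r' := by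
  simp only [renameRows, sub_mul, mul_sub]; module

theorem renameRows_raise_left {r r' : Row n k} (h : r ≠ r') :
    (renameRows r r' * raise r : KEnd R n k) = raise r' * renameRows r r' := by
  have N := fun x => normalOrder (R := R) h x
  simp only [forall_and] at N
  simp only [renameRows, sub_mul, mul_sub, mul_assoc, one_mul, mul_one, N,
    lower_raise_self, lower_raise h.symm, mul_neg, neg_neg]
  module

theorem renameRows_lower_left {r r' : Row n k} (h : r ≠ r') :
    (renameRows r r' * lower r : KEnd R n k) = lower r' * renameRows r r' := by
  have N := fun x => normalOrder (R := R) h x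
  simp only [forall_and] at N
  simp only [renameRows, sub_mul, mul_sub, mul_assoc, one_mul, mul_one, N, lower_sq,
    lower_lower r' r, mul_neg, neg_neg, mul_zero]
  module

theorem renameRows_raise {r r' : Row n k} (h : r ≠ r') (i : Row n k) :
    (renameRows r r' * raise i : KEnd R n k) = raise (Equiv.swap r r' i) * renameRows r r' := by
  by_cases h1 : i = r
  · rw [h1, Equiv.swap_apply_left, renameRows_raise_left h]
  by_cases h2 : i = r'
  · rw [h2, Equiv.swap_apply_right, ← renameRows_comm, renameRows_raise_left h.symm]
  have e1 : ∀ x : KEnd R n k, raise i * (raise r * x) = -(raise r * (raise i * x)) := fun x => by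
    rw [← mul_assoc, raise_raise i, neg_mul, mul_assoc]
  have e2 : ∀ x : KEnd R n k, raise i * (raise r' * x) = -(raise r' * (raise i * x)) := fun x => by
    rw [← mul_assoc, raise_raise i, neg_mul, mul_assoc]
  rw [Equiv.swap_apply_of_ne_of_ne h1 h2, renameRows]
  simp only [sub_mul, mul_sub, one_mul, mul_one, mul_assoc, e1, e2, lower_raise (Ne.symm h1),
    lower_raise (Ne.symm h2), mul_neg]

theorem renameRows_lower {r r' : Row n k} (h : r ≠ r') (i : Row n k) :
    (renameRows r r' * lower i : KEnd R n k) = lower (Equiv.swap r r' i) * renameRows r r' := by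
  by_cases h1 : i = r
  · rw [h1, Equiv.swap_apply_left, renameRows_lower_left h]
  by_cases h2 : i = r'
  · rw [h2, Equiv.swap_apply_right, ← renameRows_comm, renameRows_lower_left h.symm]
  have e1 : ∀ x : KEnd R n k, lower i * (raise r * x) = -(raise r * (lower i * x)) := fun x => by
    rw [← mul_assoc, lower_raise h1, neg_mul, mul_assoc]
  have e2 : ∀ x : KEnd R n k, lower i * (raise r' * x) = -(raise r' * (lower i * x)) := fun x => by
    rw [← mul_assoc, lower_raise h2, neg_mul, mul_assoc]
  rw [Equiv.swap_apply_of_ne_of_ne h1 h2, renameRows]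
  simp only [sub_mul, mul_sub, one_mul, mul_one, mul_assoc, e1, e2, lower_lower r i, lower_lower r' i,
    mul_neg]

theorem renameRows_sq {r r' : Row n k} (h : r ≠ r') :
    (renameRows r r' * renameRows r r' : KEnd R n k) = 1 := by
  have N := fun x => normalOrder (R := R) h x
  simp only [forall_and] at N
  simp only [renameRows, sub_mul, mul_sub, mul_assoc, one_mul, mul_one, N, lower_sq,
    lower_lower r' r, mul_neg, neg_neg, mul_zero]
  module

theorem renameRows_cliff {r r' : Row n k} (h : r ≠ r') (q : R) (i : Row n k) :
    renameRows r r' * cliff q i = cliff q (Equiv.swap r r' i) * renameRows r r' := by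
  simp only [cliff, mul_add, add_mul, mul_smul_comm, smul_mul_assoc, renameRows_raise h,
    renameRows_lower h]

theorem parityOp_renameRows (r r' : Row n k) :
    parityOp R n k * renameRows r r' = renameRows r r' * parityOp R n k := by
  have P1 : ∀ (i : Row n k) (x : KEnd R n k), parityOp R n k * (raise i * x)
      = -(raise i * (parityOp R n k * x)) := by
    intro i x
    rw [← mul_assoc, parityOp_raise, neg_mul, mul_assoc]
  simp only [renameRows, sub_mul, mul_sub, one_mul, mul_one, mul_assoc, P1, parityOp_lower, mul_neg,
    neg_neg]

theorem renameRows_koszulDiff {r r' : Row n k} (h : r ≠ r') (α β : Row n k → R) :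
    renameRows r r' * koszulDiff α β =
      koszulDiff (fun i => α (Equiv.swap r r' i)) (fun i => β (Equiv.swap r r' i))
        * renameRows r r' := by
  simp only [koszulDiff, Finset.mul_sum, Finset.sum_mul]
  rw [← Equiv.sum_comp (Equiv.swap r r')]
  refine Finset.sum_congr rfl fun i _ => ?_
  rw [mul_add, mul_smul_comm, mul_smul_comm, renameRows_raise h, renameRows_lower h,
    Equiv.swap_apply_self, add_mul, smul_mul_assoc, smul_mul_assoc]

end Clifford

/-! ### Existence of the exchange isomorphisms -/

section Shear

variable {R : Type} [CommRing R] {n k : ℕ}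

/-- The nilpotent operator `(c₁ θ₀ + c₂ θ₁ + c₃ ∂₀) ∂₂` for three rows. Conjugation by `1 + shear`
changes the entries of the rows `r₀` and `r₁` by multiples of the first entry of `r₂`. -/
def shear (r₀ r₁ r₂ : Row n k) (c₁ c₂ c₃ : R) : KEnd R n k :=
  (c₁ • raise r₀ + c₂ • raise r₁ + c₃ • lower r₀) * lower r₂

theorem koszulDiff_add_single_left (α β : Row n k → R) (i : Row n k) (c : R) :
    koszulDiff (α + Pi.single i c) β = koszulDiff α β + c • raise i := by
  have h := koszulDiff_add α β (Pi.single i c) 0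
  rw [add_zero] at h
  rw [h, koszulDiff.eq_def (Pi.single i c), Finset.sum_eq_single i]
  · simp
  · intro j _ hj; simp [hj]
  · simp

theorem koszulDiff_add_single_right (α β : Row n k → R) (i : Row n k) (c : R) :
    koszulDiff α (β + Pi.single i c) = koszulDiff α β + c • lower i := by
  have h := koszulDiff_add α β 0 (Pi.single i c)
  rw [add_zero] at h
  rw [h, koszulDiff.eq_def 0, Finset.sum_eq_single i]
  · simp
  · intro j _ hj; simp [hj]
  · simp

theorem koszulDiff_sub_single_right (α β : Row n k → R) (i : Row n k) (c : R) :
    koszulDiff α (β - Pi.single i c) = koszulDiff α β - c • lower i := by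
  rw [sub_eq_add_neg, ← Pi.single_neg, koszulDiff_add_single_right, neg_smul, ← sub_eq_add_neg]

variable {r₀ r₁ r₂ : Row n k} (h01 : r₀ ≠ r₁) (h02 : r₀ ≠ r₂) (h12 : r₁ ≠ r₂) (c₁ c₂ c₃ : R)
include h02 h12

theorem lower_mul_shear_self : lower r₂ * shear r₀ r₁ r₂ c₁ c₂ c₃ = 0 := by
  simp only [shear, ← mul_assoc, mul_add, mul_smul_comm, lower_raise h02.symm, lower_raise h12.symm,
    lower_lower r₂ r₀]
  simp only [add_mul, smul_mul_assoc, neg_mul, mul_assoc, lower_sq, mul_zero, neg_zero, smul_zero,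
    add_zero]

theorem shear_sq : shear r₀ r₁ r₂ c₁ c₂ c₃ * shear r₀ r₁ r₂ c₁ c₂ c₃ = 0 := by
  nth_rw 1 [shear]
  rw [mul_assoc, lower_mul_shear_self h02 h12, mul_zero]

include h01

/-- Conjugation by `1 + shear` is a row operation on the Koszul matrix. -/
theorem one_add_shear_mul_koszulDiff (α β : Row n k → R) :
    (1 + shear r₀ r₁ r₂ c₁ c₂ c₃) * koszulDiff α β =
      koszulDiff (α + Pi.single r₀ (α r₂ * c₁) + Pi.single r₁ (α r₂ * c₂))
        (β + Pi.single r₀ (α r₂ * c₃) -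
          Pi.single r₂ (c₁ * β r₀ + c₂ * β r₁ + c₃ * α r₀ + α r₂ * (c₁ * c₃)))
        * (1 + shear r₀ r₁ r₂ c₁ c₂ c₃) := by
  set ν : KEnd R n k := c₁ • raise r₀ + c₂ • raise r₁ + c₃ • lower r₀ with hν
  have hD : koszulDiff α β * ν =
      (c₁ * β r₀ + c₂ * β r₁ + c₃ * α r₀) • 1 - ν * koszulDiff α β := by
    simp only [hν, mul_add, add_mul, mul_smul_comm, smul_mul_assoc, koszulDiff_mul_raise,
      koszulDiff_mul_lower]
    module
  have hνν : ν * ν = (c₁ * c₃) • 1 := by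
    simp only [hν, mul_add, add_mul, mul_smul_comm, smul_mul_assoc, raise_sq, lower_sq,
      raise_raise r₁ r₀, lower_raise_self, lower_raise h01]
    module
  have hs : shear r₀ r₁ r₂ c₁ c₂ c₃ = ν * lower r₂ := rfl
  have hl : lower r₂ * (ν * lower r₂) = 0 := by rw [← hs]; exact lower_mul_shear_self h02 h12 _ _ _
  have e1 : koszulDiff α β * (ν * lower r₂) = (c₁ * β r₀ + c₂ * β r₁ + c₃ * α r₀) • lower r₂
      - α r₂ • ν + ν * (lower r₂ * koszulDiff α β) := by
    rw [← mul_assoc, hD, sub_mul, smul_mul_assoc, one_mul, mul_assoc, koszulDiff_mul_lower, mul_sub,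
      mul_smul_comm, mul_one]
    module
  have e2 : ν * (ν * lower r₂) = (c₁ * c₃) • lower r₂ := by
    rw [← mul_assoc, hνν, smul_mul_assoc, one_mul]
  rw [koszulDiff_sub_single_right, koszulDiff_add_single_right, koszulDiff_add_single_left,
    koszulDiff_add_single_left, hs]
  have e3 : koszulDiff α β + (α r₂ * c₁) • raise r₀ + (α r₂ * c₂) • raise r₁
      + (α r₂ * c₃) • lower r₀ = koszulDiff α β + α r₂ • ν := by
    rw [hν]; module
  rw [e3]
  simp only [add_mul, mul_add, sub_mul, one_mul, mul_one, smul_mul_assoc, mul_assoc, e1, e2, hl,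
    smul_zero]
  module

theorem koszulDiff_mul_one_sub_shear (α β : Row n k → R) :
    koszulDiff α β * (1 - shear r₀ r₁ r₂ c₁ c₂ c₃) =
      (1 - shear r₀ r₁ r₂ c₁ c₂ c₃) *
      koszulDiff (α + Pi.single r₀ (α r₂ * c₁) + Pi.single r₁ (α r₂ * c₂))
        (β + Pi.single r₀ (α r₂ * c₃) -
          Pi.single r₂ (c₁ * β r₀ + c₂ * β r₁ + c₃ * α r₀ + α r₂ * (c₁ * c₃))) := by
  have h := one_add_shear_mul_koszulDiff h01 h02 h12 c₁ c₂ c₃ α β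
  have hs := shear_sq h02 h12 c₁ c₂ c₃
  set N := shear r₀ r₁ r₂ c₁ c₂ c₃
  have e1 : (1 - N) * (1 + N) = 1 := by
    simp only [sub_mul, mul_add, one_mul, mul_one, hs]; module
  have e2 : (1 + N) * (1 - N) = 1 := by
    simp only [add_mul, mul_sub, one_mul, mul_one, hs]; module
  calc koszulDiff α β * (1 - N) = (1 - N) * ((1 + N) * koszulDiff α β) * (1 - N) := by
        rw [← mul_assoc, e1, one_mul]
    _ = _ := by rw [h, mul_assoc, mul_assoc, e2, mul_one]

end Shear

section Quad

variable {R : Type} [CommRing R] {n k : ℕ}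

theorem cliff_sub_sq {q : R} (hq : 2 * q = 1) {i j : Row n k} (h : i ≠ j) :
    (cliff q i - cliff q j) * (cliff q i - cliff q j) = 1 := by
  rw [sub_mul, mul_sub, mul_sub, cliff_sq, cliff_sq, cliff_mul_cliff_of_ne q h]
  linear_combination (norm := module) hq • (1 : KEnd R n k)

/-- A difference of two Clifford vectors of square `½` intertwines Koszul differentials whose rows
`i` and `j` differ by the amount `t` by which the two rows are out of balance. -/
theorem cliff_sub_mul_koszulDiff {q : R} (hq : 2 * q = 1) {i j : Row n k} (h : i ≠ j)
    (α β : Row n k → R) {t : R} (ht : t = β i + q * α i - (β j + q * α j)) :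
    (cliff q i - cliff q j) * koszulDiff α β =
      -(koszulDiff (α + Pi.single i (-t) + Pi.single j t)
          (β + Pi.single i (-(q * t)) + Pi.single j (q * t)) * (cliff q i - cliff q j)) := by
  have e : koszulDiff (α + Pi.single i (-t) + Pi.single j t)
          (β + Pi.single i (-(q * t)) + Pi.single j (q * t)) =
      koszulDiff α β - t • (cliff q i - cliff q j) := by
    rw [koszulDiff_add_single_right, koszulDiff_add_single_right, koszulDiff_add_single_left,
      koszulDiff_add_single_left, cliff, cliff]
    module
  rw [e, sub_mul _ (t • (cliff q i - cliff q j)), smul_mul_assoc, cliff_sub_sq hq h, mul_sub,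
    koszulDiff_mul_cliff, koszulDiff_mul_cliff, ht, sub_mul]
  module

end Quad

section Exchange

variable {m n k : ℕ}

theorem quadPsi_eq {j j' : Fin k} (h : j ≠ j') :
    ClosedWeb.quadPsi m n j j' = renameRows (.inr (j, 0)) (.inr (j', 0)) *
      (cliff (rat m (1 / 2)) (.inr (j, 1)) - cliff (rat m (1 / 2)) (.inr (j', 1))) := by
  have h' : (Sum.inr (j, 1) : Row n k) ≠ Sum.inr (j', 1) := by simpa using h
  rw [ClosedWeb.quadPsi, ClosedWeb.psi₀, ClosedWeb.psi₁, blockMap_psi h', cliff, cliff]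
  congr 1
  module

/-- The coefficient by which the third row `4 (v₁ - a)` of a pair is used to replace `g₁(e, v)`
by `g₁(e, a)`. -/
def shearCoeff {m : ℕ} (e v : Fin 3 → MarkRing m) : MarkRing m :=
  -rat m (1 / 4) * (elemSym e 0 ^ 2 + elemSym e 0 * (elemSym v 0 + pa m) + elemSym v 0 ^ 2
    + elemSym v 0 * pa m + pa m ^ 2 - 4 * elemSym e 1
    - rat m (4 / 3) * pa m * (elemSym e 0 + elemSym v 0 + pa m) - 2 * pb m)

/-- The row operation which brings the rows of the pair `j` into a form in which the variables `v`
at the sink and the variables `e` at the source separate. -/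
def pairShear (m n : ℕ) {k : ℕ} (j : Fin k) (e v : Fin 3 → MarkRing m) : KEnd (MarkRing m) n k :=
  shear (.inr (j, 0)) (.inr (j, 1)) (.inr (j, 2)) (shearCoeff e v) (elemSym v 0) (rat m (1 / 4))

theorem four_mul_rat_quarter (m : ℕ) : 4 * rat m (1 / 4) = 1 := by
  have := rat_mul_rat m (4 : ℕ) (1 / 4)
  rw [rat_natCast, show ((4 : ℕ) : ℚ) * (1 / 4) = (1 : ℕ) by norm_num, rat_natCast] at this
  exact_mod_cast this

section ShearEntries

variable (x y : Fin 3 → MarkRing m)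

theorem gPoly_zero_add_shear :
    gPoly (elemSym x) (elemSym y) 0 + gPoly (elemSym x) (elemSym y) 2 * shearCoeff x y =
      elemSym x 0 ^ 3 + elemSym x 0 ^ 2 * pa m + elemSym x 0 * pa m ^ 2 + pa m ^ 3
        - 4 * elemSym x 1 * (elemSym x 0 + pa m) + 4 * elemSym x 2
        - rat m (4 / 3) * pa m * (elemSym x 0 ^ 2 + elemSym x 0 * pa m + pa m ^ 2 - 3 * elemSym x 1)
        - 2 * pb m * (elemSym x 0 + pa m) - 4 * pc m := by
  simp only [gPoly, shearCoeff, Matrix.cons_val_zero, Matrix.cons_val]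
  linear_combination -(elemSym y 0 - pa m) * (elemSym x 0 ^ 2 + elemSym x 0 * (elemSym y 0 + pa m)
    + elemSym y 0 ^ 2 + elemSym y 0 * pa m + pa m ^ 2 - 4 * elemSym x 1
    - rat m (4 / 3) * pa m * (elemSym x 0 + elemSym y 0 + pa m) - 2 * pb m) * four_mul_rat_quarter m

theorem gPoly_one_add_shear :
    gPoly (elemSym x) (elemSym y) 1 + gPoly (elemSym x) (elemSym y) 2 * elemSym y 0 =
      2 * (elemSym x 1 + elemSym y 1) + 4 * pb m := by
  simp only [gPoly, Matrix.cons_val_one, Matrix.cons_val_zero, Matrix.cons_val]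
  ring

theorem elemSym_zero_add_shear :
    elemSym x 0 - elemSym y 0 + gPoly (elemSym x) (elemSym y) 2 * rat m (1 / 4) =
      elemSym x 0 - pa m := by
  simp only [gPoly, Matrix.cons_val]
  linear_combination (elemSym y 0 - pa m) * four_mul_rat_quarter m

/-- After the row operations the second entry of the third row depends on the sink only. -/
theorem elemSym_two_sub_shear :
    elemSym x 2 - elemSym y 2 - (shearCoeff x y * (elemSym x 0 - elemSym y 0)
        + elemSym y 0 * (elemSym x 1 - elemSym y 1)
        + rat m (1 / 4) * gPoly (elemSym x) (elemSym y) 0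
        + gPoly (elemSym x) (elemSym y) 2 * (shearCoeff x y * rat m (1 / 4))) =
      elemSym y 0 * elemSym y 1 - elemSym y 2
        - rat m (1 / 4) * ((elemSym y 0 ^ 2 + elemSym y 0 * pa m + pa m ^ 2
            - rat m (4 / 3) * pa m * (elemSym y 0 + pa m) - 2 * pb m) * pa m
          + elemSym y 0 ^ 3 - rat m (4 / 3) * pa m * elemSym y 0 ^ 2 - 2 * pb m * elemSym y 0
          - 4 * pc m) := by
  have e : gPoly (elemSym x) (elemSym y) 2 * rat m (1 / 4) = elemSym y 0 - pa m := by
    simp only [gPoly, Matrix.cons_val]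
    linear_combination (elemSym y 0 - pa m) * four_mul_rat_quarter m
  rw [mul_left_comm, e]
  simp only [gPoly, shearCoeff, Matrix.cons_val_zero]
  linear_combination (-(elemSym x 2 - elemSym y 0 * elemSym x 1)) * four_mul_rat_quarter m
    - rat m (1 / 4) * pa m * elemSym x 1 * three_mul_rat_four_thirds m

end ShearEntries

/-- The interchange of two identified pairs. On both sides row operations separate the variables at
the sources from those at the sinks; after that the first rows of the two pairs can trade places,
and the Clifford vector of `ψ` corrects the second rows. -/
def exchangeMap (W : ClosedWeb m n k) (σ : Equiv.Perm (Fin k)) (j j' : Fin k) :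
    KEnd (MarkRing m) n k :=
  (1 - pairShear m n j (W.outVar (σ j')) (W.inVar j)) *
    ((1 - pairShear m n j' (W.outVar (σ j)) (W.inVar j')) *
      (ClosedWeb.quadPsi m n j j' *
        ((1 + pairShear m n j' (W.outVar (σ j')) (W.inVar j')) *
          (1 + pairShear m n j (W.outVar (σ j)) (W.inVar j)))))

theorem exchangeMap_comm (W : ClosedWeb m n k) (σ : Equiv.Perm (Fin k)) {j j' : Fin k}
    (h : j ≠ j') : W.d (ClosedWeb.exchange σ j j') * exchangeMap W σ j j' =
      -(exchangeMap W σ j j' * W.d σ) := by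
  have r01 (i : Fin k) : (Sum.inr (i, 0) : Row n k) ≠ .inr (i, 1) := by simp
  have r02 (i : Fin k) : (Sum.inr (i, 0) : Row n k) ≠ .inr (i, 2) := by simp
  have r12 (i : Fin k) : (Sum.inr (i, 1) : Row n k) ≠ .inr (i, 2) := by simp
  have h00 : (Sum.inr (j, 0) : Row n k) ≠ .inr (j', 0) := by simpa using h
  have h11 : (Sum.inr (j, 1) : Row n k) ≠ .inr (j', 1) := by simpa using h
  have h' : j' ≠ j := h.symm
  have q := two_mul_rat_half m
  have q4 := four_mul_rat_quarter m
  have hx : ClosedWeb.exchange σ j j' j = σ j' := by simp [ClosedWeb.exchange]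
  have hx' : ClosedWeb.exchange σ j j' j' = σ j := by simp [ClosedWeb.exchange]
  have hx0 (i : Fin k) (h1 : i ≠ j) (h2 : i ≠ j') : ClosedWeb.exchange σ j j' i = σ i := by
    simp [ClosedWeb.exchange, Equiv.swap_apply_of_ne_of_ne h1 h2]
  -- The row operations on the source (`α₂`, `β₂`) and on the target (`α₂'`, `β₂'`).
  have a1 := one_add_shear_mul_koszulDiff (r01 j) (r02 j) (r12 j)
    (shearCoeff (W.outVar (σ j)) (W.inVar j)) (elemSym (W.inVar j) 0) (rat m (1 / 4))
    (W.colA σ) (W.colB σ)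
  have b1 := koszulDiff_mul_one_sub_shear (r01 j) (r02 j) (r12 j)
    (shearCoeff (W.outVar (σ j')) (W.inVar j)) (elemSym (W.inVar j) 0) (rat m (1 / 4))
    (W.colA (ClosedWeb.exchange σ j j')) (W.colB (ClosedWeb.exchange σ j j'))
  set α₁ := W.colA σ + _ + _ with hα₁
  set β₁ := W.colB σ + _ - _ with hβ₁
  set α₁' := W.colA (ClosedWeb.exchange σ j j') + _ + _ with hα₁'
  set β₁' := W.colB (ClosedWeb.exchange σ j j') + _ - _ with hβ₁'
  have a2 := one_add_shear_mul_koszulDiff (r01 j') (r02 j') (r12 j')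
    (shearCoeff (W.outVar (σ j')) (W.inVar j')) (elemSym (W.inVar j') 0) (rat m (1 / 4)) α₁ β₁
  have b2 := koszulDiff_mul_one_sub_shear (r01 j') (r02 j') (r12 j')
    (shearCoeff (W.outVar (σ j)) (W.inVar j')) (elemSym (W.inVar j') 0) (rat m (1 / 4)) α₁' β₁'
  set α₂ := α₁ + _ + _ with hα₂
  set β₂ := β₁ + _ - _ with hβ₂
  set α₂' := α₁' + _ + _ with hα₂'
  set β₂' := β₁' + _ - _ with hβ₂'
  -- The second rows of the source, corrected by `t`, are the second rows of the target.
  have e1 := cliff_sub_mul_koszulDiff q h11 α₂ β₂ rfl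
  set t := β₂ (Sum.inr (j, 1)) + rat m (1 / 2) * α₂ (Sum.inr (j, 1)) -
    (β₂ (Sum.inr (j', 1)) + rat m (1 / 2) * α₂ (Sum.inr (j', 1))) with ht
  have ht' : t = 2 * (elemSym (W.outVar (σ j)) 1 - elemSym (W.outVar (σ j')) 1) := by
    have g1 := gPoly_one_add_shear (W.outVar (σ j)) (W.inVar j)
    have g2 := gPoly_one_add_shear (W.outVar (σ j')) (W.inVar j')
    simp [ht, hα₂, hα₁, hβ₂, hβ₁, -one_div, h, h', ClosedWeb.colA, ClosedWeb.colB]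
    rw [g1, g2]
    linear_combination (elemSym (W.outVar (σ j)) 1 + elemSym (W.inVar j) 1
      - elemSym (W.outVar (σ j')) 1 - elemSym (W.inVar j') 1) * q
  have e2 := renameRows_koszulDiff h00
    (α₂ + Pi.single (Sum.inr (j, 1)) (-t) + Pi.single (Sum.inr (j', 1)) t)
    (β₂ + Pi.single (Sum.inr (j, 1)) (-(rat m (1 / 2) * t)) +
      Pi.single (Sum.inr (j', 1)) (rat m (1 / 2) * t))
  have eα : (fun i => (α₂ + Pi.single (Sum.inr (j, 1)) (-t) + Pi.single (Sum.inr (j', 1)) t :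
      Row n k → MarkRing m)
      (Equiv.swap (Sum.inr (j, 0)) (Sum.inr (j', 0)) i)) = α₂' := by
    funext r
    rcases r with e | ⟨i, c⟩
    · simp [hα₂, hα₁, hα₂', hα₁', -one_div, ClosedWeb.colA, Equiv.swap_apply_def]
    by_cases h1 : i = j
    · subst h1
      fin_cases c <;>
      simp [hα₂, hα₁, hα₂', hα₁', -one_div, ClosedWeb.colA, Equiv.swap_apply_def, h, h', hx, hx']
      · rw [gPoly_zero_add_shear, gPoly_zero_add_shear]
      · rw [gPoly_one_add_shear, gPoly_one_add_shear, ht']; ring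
      · simp [gPoly]
    by_cases h2 : i = j'
    · subst h2
      fin_cases c <;>
      simp [hα₂, hα₁, hα₂', hα₁', -one_div, ClosedWeb.colA, Equiv.swap_apply_def, h, h', hx, hx']
      · rw [gPoly_zero_add_shear, gPoly_zero_add_shear]
      · rw [gPoly_one_add_shear, gPoly_one_add_shear, ht']; ring
      · simp [gPoly]
    · simp [hα₂, hα₁, hα₂', hα₁', -one_div, ClosedWeb.colA, Equiv.swap_apply_def, h1, h2, hx0]
  have eβ : (fun i => (β₂ + Pi.single (Sum.inr (j, 1)) (-(rat m (1 / 2) * t)) +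
      Pi.single (Sum.inr (j', 1)) (rat m (1 / 2) * t) : Row n k → MarkRing m)
      (Equiv.swap (Sum.inr (j, 0)) (Sum.inr (j', 0)) i)) = β₂' := by
    funext r
    rcases r with e | ⟨i, c⟩
    · simp [hβ₂, hβ₁, hβ₂', hβ₁', -one_div, Pi.single_apply, ClosedWeb.colB, Equiv.swap_apply_def]
    by_cases h1 : i = j
    · subst h1
      fin_cases c <;>
      simp [hβ₂, hβ₁, hα₁, hβ₂', hβ₁', hα₁', -one_div, ClosedWeb.colA, ClosedWeb.colB,
        Equiv.swap_apply_def, h, h', hx, hx']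
      · rw [elemSym_zero_add_shear, elemSym_zero_add_shear]
      · rw [ht']
        linear_combination (-(elemSym (W.outVar (σ i)) 1 - elemSym (W.outVar (σ j')) 1)) * q
      · rw [elemSym_two_sub_shear, elemSym_two_sub_shear]
    by_cases h2 : i = j'
    · subst h2
      fin_cases c <;>
      simp [hβ₂, hβ₁, hα₁, hβ₂', hβ₁', hα₁', -one_div, ClosedWeb.colA, ClosedWeb.colB,
        Equiv.swap_apply_def, h, h', hx, hx']
      · rw [elemSym_zero_add_shear, elemSym_zero_add_shear]
      · rw [ht']
        linear_combination ((elemSym (W.outVar (σ j)) 1 - elemSym (W.outVar (σ i)) 1)) * q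
      · rw [elemSym_two_sub_shear, elemSym_two_sub_shear]
    · simp [hβ₂, hβ₁, hβ₂', hβ₁', -one_div, Pi.single_apply, ClosedWeb.colB,
        Equiv.swap_apply_def, h1, h2, hx0]
  rw [eα, eβ] at e2
  have e3 : koszulDiff α₂' β₂' * ClosedWeb.quadPsi m n j j' =
      -(ClosedWeb.quadPsi m n j j' * koszulDiff α₂ β₂) := by
    rw [quadPsi_eq h, ← mul_assoc, ← e2, mul_assoc, mul_assoc, e1, mul_neg, neg_neg]
  simp only [exchangeMap, pairShear, ClosedWeb.d] at *
  rw [← mul_assoc, b1, mul_assoc, ← mul_assoc (koszulDiff α₁' β₁'), b2, mul_assoc,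
    ← mul_assoc (koszulDiff α₂' β₂'), e3]
  simp only [mul_assoc]
  rw [a1, ← mul_assoc (1 + shear _ _ _ _ _ _) (koszulDiff α₁ β₁), a2]
  simp only [mul_assoc, neg_mul, mul_neg]

end Exchange

section ExchangeIso

variable {R : Type} [CommRing R] {m n k : ℕ}

theorem parityOp_shear (r₀ r₁ r₂ : Row n k) (c₁ c₂ c₃ : R) :
    parityOp R n k * shear r₀ r₁ r₂ c₁ c₂ c₃ = shear r₀ r₁ r₂ c₁ c₂ c₃ * parityOp R n k := by
  have P1 : ∀ (i : Row n k) (x : KEnd R n k), parityOp R n k * (raise i * x)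
      = -(raise i * (parityOp R n k * x)) := fun i x => by
    rw [← mul_assoc, parityOp_raise, neg_mul, mul_assoc]
  have P2 : ∀ (i : Row n k) (x : KEnd R n k), parityOp R n k * (lower i * x)
      = -(lower i * (parityOp R n k * x)) := fun i x => by
    rw [← mul_assoc, parityOp_lower, neg_mul, mul_assoc]
  simp only [shear, add_mul, mul_add, smul_mul_assoc, mul_smul_comm, mul_assoc, P1, P2, parityOp_lower,
    mul_neg, neg_neg]

theorem parityOp_quadPsi {j j' : Fin k} (h : j ≠ j') :
    parityOp (MarkRing m) n k * ClosedWeb.quadPsi m n j j' =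
      -(ClosedWeb.quadPsi m n j j' * parityOp (MarkRing m) n k) := by
  rw [quadPsi_eq h, ← mul_assoc, parityOp_renameRows, mul_assoc, mul_sub, parityOp_cliff,
    parityOp_cliff, mul_assoc, sub_mul, ← neg_sub', mul_neg]

theorem lower_quadPsi {j j' : Fin k} (h : j ≠ j') {r : Row n k} (h0 : ∀ i, r ≠ .inr (i, 0))
    (h1 : ∀ i, r ≠ .inr (i, 1)) :
    lower r * ClosedWeb.quadPsi m n j j' = -(ClosedWeb.quadPsi m n j j' * lower r) := by
  have h00 : (Sum.inr (j, 0) : Row n k) ≠ .inr (j', 0) := by simpa using h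
  have e := renameRows_lower (R := MarkRing m) h00 r
  rw [Equiv.swap_apply_of_ne_of_ne (h0 j) (h0 j')] at e
  rw [quadPsi_eq h, ← mul_assoc, ← e, mul_assoc, mul_sub, lower_cliff _ (h1 j), lower_cliff _ (h1 j'),
    mul_assoc, sub_mul, ← neg_sub', mul_neg]

theorem thirdRows_mul_exchangeMap (W : ClosedWeb m n k) (σ : Equiv.Perm (Fin k)) {j j' : Fin k}
    (h : j ≠ j') : ClosedWeb.thirdRows m n j j' * exchangeMap W σ j j' =
      ClosedWeb.quadPsi m n j j' * ClosedWeb.thirdRows m n j j' := by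
  have a1 (e v) : ClosedWeb.thirdRows m n j j' * pairShear m n j e v = 0 := by
    rw [ClosedWeb.thirdRows, mul_assoc, pairShear, lower_mul_shear_self (by simp) (by simp), mul_zero]
  have a2 (e v) : ClosedWeb.thirdRows m n j j' * pairShear m n j' e v = 0 := by
    rw [ClosedWeb.thirdRows, lower_lower, neg_mul, mul_assoc, pairShear,
      lower_mul_shear_self (by simp) (by simp), mul_zero, neg_zero]
  have a3 : ClosedWeb.thirdRows m n j j' * ClosedWeb.quadPsi m n j j' =
      ClosedWeb.quadPsi m n j j' * ClosedWeb.thirdRows m n j j' := by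
    rw [ClosedWeb.thirdRows, mul_assoc, lower_quadPsi h (by simp) (by simp), mul_neg, ← mul_assoc,
      lower_quadPsi h (by simp) (by simp), neg_mul, neg_neg, mul_assoc]
  have b1 (e v) : ClosedWeb.thirdRows m n j j' * (1 + pairShear m n j e v) =
      ClosedWeb.thirdRows m n j j' := by rw [mul_add, mul_one, a1, add_zero]
  have b2 (e v) : ClosedWeb.thirdRows m n j j' * (1 + pairShear m n j' e v) =
      ClosedWeb.thirdRows m n j j' := by rw [mul_add, mul_one, a2, add_zero]
  rw [exchangeMap, ← mul_assoc, mul_sub, mul_one, a1, sub_zero, ← mul_assoc, mul_sub, mul_one, a2,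
    sub_zero, ← mul_assoc, a3, mul_assoc, ← mul_assoc (ClosedWeb.thirdRows m n j j'), b2, b1]

theorem ClosedWeb.isExchangeIso_exchangeMap (W : ClosedWeb m n k) (σ : Equiv.Perm (Fin k))
    {j j' : Fin k} (h : j ≠ j') : W.IsExchangeIso σ j j' (exchangeMap W σ j j') where
  isHom := by
    refine isHom_odd_iff.2 ⟨?_, exchangeMap_comm W σ h⟩
    have c1 (i : Fin k) (e v) : Commute (parityOp (MarkRing m) n k) (1 - pairShear m n i e v) :=
      (Commute.one_right _).sub_right (parityOp_shear _ _ _ _ _ _)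
    have c2 (i : Fin k) (e v) : Commute (parityOp (MarkRing m) n k) (1 + pairShear m n i e v) :=
      (Commute.one_right _).add_right (parityOp_shear _ _ _ _ _ _)
    rw [exchangeMap, ← mul_assoc, (c1 _ _ _).eq, mul_assoc, ← mul_assoc (parityOp _ _ _),
      (c1 _ _ _).eq, mul_assoc, ← mul_assoc (parityOp _ _ _), parityOp_quadPsi h, neg_mul, mul_assoc,
      ← mul_assoc (parityOp _ _ _), (c2 _ _ _).eq, mul_assoc, (c2 _ _ _).eq]
    simp only [mul_assoc, mul_neg]
  induces z S := by
    have e := congrArg (fun x : KEnd (MarkRing m) n k => x z S) (thirdRows_mul_exchangeMap W σ h)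
    simp only [Module.End.mul_apply] at e
    rw [e, sub_self]
    exact zero_mem _

end ExchangeIso

/-! ### Lifts of permutations up to a common sign -/

section Lift

variable {H : Type*} [Ring H] {ι : Type*} [DecidableEq ι]

/-- `IsLift Y s g y`: up to sign, `y` is a product of the elements `Y a b` with `a, b ∈ s`, and `g`
is the product of the corresponding transpositions, in the opposite order. -/
inductive IsLift (Y : ι → ι → H) (s : Finset ι) : Equiv.Perm ι → H → Prop
  | one : IsLift Y s 1 1
  | neg {g y} : IsLift Y s g y → IsLift Y s g (-y)
  | step {a b g y} : a ∈ s → b ∈ s → a ≠ b → IsLift Y s g y →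
      IsLift Y s (g * Equiv.swap a b) (Y a b * y)

theorem IsLift.apply_of_notMem {Y : ι → ι → H} {s : Finset ι} {g : Equiv.Perm ι} {y : H}
    (h : IsLift Y s g y) {x : ι} (hx : x ∉ s) : g x = x := by
  induction h with
  | one => rfl
  | neg _ ih => exact ih
  | step ha hb _ _ ih =>
    rw [Equiv.Perm.mul_apply, Equiv.swap_apply_of_ne_of_ne (ne_of_mem_of_not_mem ha hx).symm
      (ne_of_mem_of_not_mem hb hx).symm, ih]

theorem IsLift.apply_mem {Y : ι → ι → H} {s : Finset ι} {g : Equiv.Perm ι} {y : H}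
    (h : IsLift Y s g y) {x : ι} (hx : x ∈ s) : g x ∈ s := by
  by_contra hc
  have := h.apply_of_notMem hc
  exact hc (by rwa [g.injective this])

section

variable {Y : ι → ι → H} (hsq : ∀ a b, a ≠ b → Y a b * Y a b = 1)
  (hsymm : ∀ a b, a ≠ b → Y b a = -Y a b)
  (hconj : ∀ a b c d, a ≠ b → c ≠ d →
    Y a b * Y c d = -(Y (Equiv.swap a b c) (Equiv.swap a b d) * Y a b))
include hsq hsymm hconj

/-- Every product of transpositions of `insert x s` can be rewritten, with the same sign on both
sides, so that `x` occurs at most once, namely in the last factor. -/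
theorem IsLift.normalForm {s : Finset ι} {x : ι} (hx : x ∉ s) {g : Equiv.Perm ι} {y : H}
    (h : IsLift Y (insert x s) g y) :
    IsLift Y s g y ∨ ∃ b ∈ s, ∃ g₀ y₀, IsLift Y s g₀ y₀ ∧ g = g₀ * Equiv.swap x b ∧
      y = Y x b * y₀ := by
  have neg : ∀ {g y}, (IsLift Y s g y ∨ ∃ b ∈ s, ∃ g₀ y₀, IsLift Y s g₀ y₀ ∧
      g = g₀ * Equiv.swap x b ∧ y = Y x b * y₀) → (IsLift Y s g (-y) ∨ ∃ b ∈ s, ∃ g₀ y₀,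
      IsLift Y s g₀ y₀ ∧ g = g₀ * Equiv.swap x b ∧ -y = Y x b * y₀) := by
    rintro g y (h | ⟨b, hb, g₀, y₀, h, rfl, rfl⟩)
    · exact .inl h.neg
    · exact .inr ⟨b, hb, g₀, -y₀, h.neg, rfl, by rw [mul_neg]⟩
  have hne {b : ι} (hb : b ∈ s) : x ≠ b := fun e => hx (e ▸ hb)
  have first : ∀ {g y d}, d ∈ s → (IsLift Y s g y ∨ ∃ b ∈ s, ∃ g₀ y₀, IsLift Y s g₀ y₀ ∧
      g = g₀ * Equiv.swap x b ∧ y = Y x b * y₀) → (IsLift Y s (g * Equiv.swap x d) (Y x d * y) ∨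
      ∃ b ∈ s, ∃ g₀ y₀, IsLift Y s g₀ y₀ ∧ g * Equiv.swap x d = g₀ * Equiv.swap x b ∧
      Y x d * y = Y x b * y₀) := by
    rintro g y d hd (h | ⟨b, hb, g₀, y₀, h, rfl, rfl⟩)
    · exact .inr ⟨d, hd, g, y, h, rfl, rfl⟩
    by_cases e : d = b
    · subst e
      left
      rwa [mul_assoc, Equiv.swap_mul_self, mul_one, ← mul_assoc, hsq _ _ (hne hd), one_mul]
    · right
      refine ⟨b, hb, g₀ * Equiv.swap b d, -(Y b d * y₀), (h.step hb hd (Ne.symm e)).neg, ?_, ?_⟩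
      · rw [mul_assoc, mul_assoc, Equiv.mul_swap_eq_swap_mul, Equiv.swap_apply_left,
          Equiv.swap_apply_of_ne_of_ne (hne hd).symm e]
      · have := hconj x b b d (hne hb) (Ne.symm e)
        rw [Equiv.swap_apply_right, Equiv.swap_apply_of_ne_of_ne (hne hd).symm e] at this
        rw [mul_neg, ← mul_assoc, ← mul_assoc, this, neg_mul, neg_neg]
  induction h with
  | one => exact .inl .one
  | neg _ ih => exact neg ih
  | @step c d g y hc hd hcd _ ih =>
    rcases Finset.mem_insert.1 hc with rfl | hc'
    · exact first ((Finset.mem_insert.1 hd).resolve_left (Ne.symm hcd)) ih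
    rcases Finset.mem_insert.1 hd with rfl | hd'
    · rw [hsymm _ _ hcd.symm, neg_mul, Equiv.swap_comm]
      exact neg (first hc' ih)
    rcases ih with h | ⟨b, hb, g₀, y₀, h, rfl, rfl⟩
    · exact .inl (h.step hc' hd' hcd)
    · right
      have hs : Equiv.swap c d b ∈ s := by
        rw [Equiv.swap_apply_def]; split_ifs <;> assumption
      have hsx : Equiv.swap c d x = x := Equiv.swap_apply_of_ne_of_ne (hne hc') (hne hd')
      refine ⟨Equiv.swap c d b, hs, g₀ * Equiv.swap c d, -(Y c d * y₀), (h.step hc' hd' hcd).neg, ?_, ?_⟩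
      · rw [mul_assoc, mul_assoc, Equiv.mul_swap_eq_swap_mul (Equiv.swap c d), hsx,
          Equiv.swap_apply_self]
      · rw [← mul_assoc, hconj c d x b hcd (hne hb), hsx, neg_mul, mul_neg, mul_assoc]

/-- Transpositions satisfy no relations but those that follow from the conjugation relations; hence
a lift is determined up to sign by the permutation. -/
theorem IsLift.unique (s : Finset ι) {g : Equiv.Perm ι} {y y' : H} (h : IsLift Y s g y)
    (h' : IsLift Y s g y') : y = y' ∨ y = -y' := by
  induction s using Finset.induction_on generalizing g y y' with
  | empty =>
    have key : ∀ {g y}, IsLift Y (∅ : Finset ι) g y → y = 1 ∨ y = -1 := by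
      intro g y h
      induction h with
      | one => exact .inl rfl
      | neg _ ih =>
        rcases ih with rfl | rfl
        · exact .inr rfl
        · exact .inl (neg_neg 1)
      | step ha => exact absurd ha (Finset.notMem_empty _)
    rcases key h with rfl | rfl <;> rcases key h' with rfl | rfl <;> simp
  | insert x s hx ih =>
    have mixed : ∀ {g y g₀ y₀ b}, IsLift Y s g y → IsLift Y s g₀ y₀ → b ∈ s →
        g ≠ g₀ * Equiv.swap x b := by
      rintro g y g₀ y₀ b h h₀ hb rfl
      have := h.apply_of_notMem hx
      rw [Equiv.Perm.mul_apply, Equiv.swap_apply_left] at this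
      exact hx (this ▸ h₀.apply_mem hb)
    rcases h.normalForm hsq hsymm hconj hx with l | ⟨b, hb, g₀, y₀, l, rfl, rfl⟩ <;>
      rcases h'.normalForm hsq hsymm hconj hx with l' | ⟨b', hb', g₀', y₀', l', e, rfl⟩
    · exact ih l l'
    · exact absurd e (mixed l l' hb')
    · exact absurd rfl (mixed l' l hb)
    · have key : ∀ {g₀ : Equiv.Perm ι} {y₀ : H} {b}, IsLift Y s g₀ y₀ →
          (g₀ * Equiv.swap x b).symm x = b := by
        intro g₀ y₀ b h
        rw [Equiv.symm_apply_eq, Equiv.Perm.mul_apply, Equiv.swap_apply_right, h.apply_of_notMem hx]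
      have hbb : b = b' := (key l).symm.trans (e ▸ key l')
      subst hbb
      rw [← mul_right_cancel e] at l'
      rcases ih l l' with rfl | rfl
      · exact .inl rfl
      · exact .inr (mul_neg _ _)

end

end Lift

/-! ### Chains of exchanges and rotations -/

section Moves

variable {H : Type*} [Ring H] {k : ℕ}

/-- `MoveLift Y R σ ρ σ' ρ' h`: a chain of exchanges and rotations takes `(σ, ρ)` to `(σ', ρ')`, and
`h` is the product of the elements `Y a b` and `R j` assigned to them. -/
inductive MoveLift (Y : Fin k → Fin k → H) (R : Fin k → H) (σ : Equiv.Perm (Fin k))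
    (ρ : Fin k → Fin 3) : Equiv.Perm (Fin k) → (Fin k → Fin 3) → H → Prop
  | refl : MoveLift Y R σ ρ σ ρ 1
  | rotate {σ' ρ' h} (j : Fin k) : MoveLift Y R σ ρ σ' ρ' h →
      MoveLift Y R σ ρ σ' (Function.update ρ' j (ρ' j + 1)) (R j * h)
  | exchange {σ' ρ' h} (a b : Fin k) : a ≠ b → MoveLift Y R σ ρ σ' ρ' h →
      MoveLift Y R σ ρ (ClosedWeb.exchange σ' a b) (ρ' ∘ Equiv.swap a b) (Y a b * h)

theorem MoveLift.trans {Y : Fin k → Fin k → H} {R : Fin k → H} {σ σ' σ'' : Equiv.Perm (Fin k)}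
    {ρ ρ' ρ'' : Fin k → Fin 3} {h h' : H} (h₁ : MoveLift Y R σ ρ σ' ρ' h)
    (h₂ : MoveLift Y R σ' ρ' σ'' ρ'' h') : MoveLift Y R σ ρ σ'' ρ'' (h' * h) := by
  induction h₂ with
  | refl => rwa [one_mul]
  | rotate j _ ih => rw [mul_assoc]; exact ih.rotate j
  | exchange a b hab _ ih => rw [mul_assoc]; exact ih.exchange a b hab

/-- `IsRot R v r`: `r` is the product of the elements `R j`, with exponents `v j` modulo `3`. -/
inductive IsRot (R : Fin k → H) : (Fin k → Fin 3) → H → Prop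
  | zero : IsRot R 0 1
  | step {v r} (j : Fin k) : IsRot R v r → IsRot R (Function.update v j (v j + 1)) (R j * r)

theorem IsRot.unique {R : Fin k → H} (hcomm : ∀ i j, R i * R j = R j * R i)
    (hcube : ∀ j, R j * (R j * R j) = 1) {v : Fin k → Fin 3} {r r' : H} (h : IsRot R v r)
    (h' : IsRot R v r') : r = r' := by
  have comm (v : Fin k → Fin 3) (s : Set (Fin k)) :
      s.Pairwise (Function.onFun Commute fun j => R j ^ (v j : ℕ)) :=
    fun i _ j _ _ => (Commute.pow_pow (hcomm i j) _ _)
  have key : ∀ {v r}, IsRot R v r →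
      r = Finset.univ.noncommProd (fun j => R j ^ (v j : ℕ)) (comm v _) := by
    intro v r h
    induction h with
    | zero => rw [Finset.noncommProd_eq_pow_card _ _ _ 1 (by simp), one_pow]
    | @step v r j _ ih =>
      have split (w : Fin k → Fin 3) : Finset.univ.noncommProd (fun j => R j ^ (w j : ℕ)) (comm w _) =
          R j ^ (w j : ℕ) * (Finset.univ.erase j).noncommProd (fun j => R j ^ (w j : ℕ))
            (comm w _) := by
        rw [← Finset.noncommProd_insert_of_notMem _ _ _ (comm w _) (Finset.notMem_erase j _)]
        exact Finset.noncommProd_congr (by simp) (fun _ _ => rfl) _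
      rw [ih, split, split, ← mul_assoc, Function.update_self]
      congr 1
      · generalize v j = c
        fin_cases c
        · simp
        · simp [pow_two]
        · simpa [pow_two] using hcube j
      · refine Finset.noncommProd_congr rfl (fun i hi => ?_) _
        rw [Function.update_of_ne (Finset.ne_of_mem_erase hi)]
  rw [key h, key h']

section

variable {Y : Fin k → Fin k → H} {R : Fin k → H}
  (hYR : ∀ a b j, a ≠ b → Y a b * R j = R (Equiv.swap a b j) * Y a b)
include hYR

theorem IsRot.conj {v : Fin k → Fin 3} {r : H} (h : IsRot R v r) {a b : Fin k} (hab : a ≠ b) :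
    ∃ r', IsRot R (v ∘ Equiv.swap a b) r' ∧ Y a b * r = r' * Y a b := by
  induction h with
  | zero => exact ⟨1, .zero, by simp⟩
  | @step v r j _ ih =>
    obtain ⟨r', h', e⟩ := ih
    refine ⟨R (Equiv.swap a b j) * r', ?_, ?_⟩
    · have := h'.step (Equiv.swap a b j)
      convert this using 1
      rw [Function.update_comp_equiv, Equiv.symm_swap]
      simp
    · rw [← mul_assoc, hYR a b j hab, mul_assoc, e, mul_assoc]

theorem MoveLift.factor {σ σ' : Equiv.Perm (Fin k)} {ρ ρ' : Fin k → Fin 3} {h : H}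
    (H₁ : MoveLift Y R σ ρ σ' ρ' h) : ∃ g v r y, IsLift Y Finset.univ g y ∧ IsRot R v r ∧
      h = r * y ∧ σ' = σ * g ∧ ρ' = v + ρ ∘ g := by
  induction H₁ with
  | refl => exact ⟨1, 0, 1, 1, .one, .zero, by simp, by simp, by simp⟩
  | rotate j _ ih =>
    obtain ⟨g, v, r, y, hy, hr, rfl, rfl, rfl⟩ := ih
    refine ⟨g, _, _, y, hy, hr.step j, by rw [mul_assoc], rfl, ?_⟩
    funext i
    by_cases hi : i = j
    · subst hi; simp [add_right_comm]
    · simp [hi]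
  | exchange a b hab _ ih =>
    obtain ⟨g, v, r, y, hy, hr, rfl, rfl, rfl⟩ := ih
    obtain ⟨r', hr', e⟩ := hr.conj hYR hab
    exact ⟨_, _, r', _, hy.step (Finset.mem_univ _) (Finset.mem_univ _) hab, hr',
      by rw [← mul_assoc, e, mul_assoc], rfl, rfl⟩

/-- The element assigned to a chain of moves depends, up to sign, on the endpoints only. -/
theorem MoveLift.unique (hsq : ∀ a b, a ≠ b → Y a b * Y a b = 1)
    (hsymm : ∀ a b, a ≠ b → Y b a = -Y a b)
    (hconj : ∀ a b c d, a ≠ b → c ≠ d →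
      Y a b * Y c d = -(Y (Equiv.swap a b c) (Equiv.swap a b d) * Y a b))
    (hcomm : ∀ i j, R i * R j = R j * R i) (hcube : ∀ j, R j * (R j * R j) = 1)
    {σ σ' : Equiv.Perm (Fin k)} {ρ ρ' : Fin k → Fin 3} {h h' : H}
    (H₁ : MoveLift Y R σ ρ σ' ρ' h) (H₂ : MoveLift Y R σ ρ σ' ρ' h') : h = h' ∨ h = -h' := by
  obtain ⟨g, v, r, y, hy, hr, rfl, rfl, rfl⟩ := H₁.factor hYR
  obtain ⟨g', v', r', y', hy', hr', rfl, e1, e2⟩ := H₂.factor hYR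
  obtain rfl : g = g' := mul_left_cancel e1
  obtain rfl : v = v' := add_right_cancel e2
  obtain rfl := hr.unique hcomm hcube hr'
  rcases hy.unique hsq hsymm hconj _ hy' with rfl | rfl
  · exact .inl rfl
  · exact .inr (mul_neg _ _)

end

end Moves

/-! ### Products of Clifford vectors assigned to surgeries, rotations and exchanges -/

section Vectors

variable {A : Type*} [Ring A] {ι : Type*} {W : ι → A}
  (hanti : ∀ x y, x ≠ y → W x * W y = -(W y * W x))
include hanti

theorem sub_mul_sub_self (hsum : ∀ x y, W x * W x + W y * W y = -1) {a b : ι} (h : a ≠ b) :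
    (W a - W b) * (W a - W b) = -1 := by
  rw [← hsum a b, sub_mul, mul_sub, mul_sub, hanti a b h]
  abel

variable [DecidableEq ι] (hsq : ∀ x y, W x * W x = W y * W y)
include hsq

/-- The difference of two Clifford vectors acts on all Clifford vectors, up to sign, by the
transposition. -/
theorem sub_mul_vector {a b : ι} (h : a ≠ b) (c : ι) :
    (W a - W b) * W c = -(W (Equiv.swap a b c) * (W a - W b)) := by
  by_cases h1 : c = a
  · subst h1
    rw [Equiv.swap_apply_left, sub_mul, mul_sub, hsq c b]
    abel
  by_cases h2 : c = b
  · subst h2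
    rw [Equiv.swap_apply_right, sub_mul, mul_sub, hsq c a]
    abel
  · rw [Equiv.swap_apply_of_ne_of_ne h1 h2, sub_mul, mul_sub, hanti a c (Ne.symm h1),
      hanti b c (Ne.symm h2)]
    abel

theorem sub_mul_sub {a b : ι} (h : a ≠ b) (c d : ι) :
    (W a - W b) * (W c - W d) = -((W (Equiv.swap a b c) - W (Equiv.swap a b d)) * (W a - W b)) := by
  rw [mul_sub, sub_mul_vector hanti hsq h, sub_mul_vector hanti hsq h, sub_mul, neg_sub, neg_sub_neg]

theorem sub_mul_sub_of_ne {a b c d : ι} (h : a ≠ b) (h1 : c ≠ a) (h2 : c ≠ b) (h3 : d ≠ a)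
    (h4 : d ≠ b) : (W a - W b) * (W c - W d) = -((W c - W d) * (W a - W b)) := by
  rw [sub_mul_sub hanti hsq h, Equiv.swap_apply_of_ne_of_ne h1 h2, Equiv.swap_apply_of_ne_of_ne h3 h4]

end Vectors

section Triple

variable {A : Type*} [Ring A] {ι : Type*} {k : ℕ}

/-- The product assigned to the interchange of the pairs `a` and `b` with incoming marks
`p a i` and `p b i`. -/
def tripleProd (W : ι → A) (p : Fin k → Fin 3 → ι) (a b : Fin k) : A :=
  (W (p a 2) - W (p b 2)) * ((W (p a 1) - W (p b 1)) * (W (p a 0) - W (p b 0)))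

/-- The product assigned to moving the strands of the pair `j` by one step. -/
def rotProd (W : ι → A) (p : Fin k → Fin 3 → ι) (j : Fin k) : A :=
  (W (p j 1) - W (p j 2)) * (W (p j 1) - W (p j 0))

variable {W : ι → A} {p : Fin k → Fin 3 → ι} (hp : ∀ a i b j, p a i = p b j → a = b ∧ i = j)

theorem tripleProd_symm (a b : Fin k) : tripleProd W p b a = -tripleProd W p a b := by
  simp only [tripleProd]
  rw [← neg_sub (W (p a 2)), ← neg_sub (W (p a 1)), ← neg_sub (W (p a 0))]
  simp only [neg_mul, mul_neg, neg_neg]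

include hp in
theorem p_ne_of_left {a b : Fin k} (h : a ≠ b) (i j : Fin 3) : p a i ≠ p b j :=
  fun e => h (hp _ _ _ _ e).1

include hp in
theorem p_ne_of_right (a b : Fin k) {i j : Fin 3} (h : i ≠ j) : p a i ≠ p b j :=
  fun e => h (hp _ _ _ _ e).2

variable [DecidableEq ι] (hanti : ∀ x y, x ≠ y → W x * W y = -(W y * W x))
  (hsq : ∀ x y, W x * W x = W y * W y)
include hp hanti hsq

theorem sub_mul_vector_mark {a b : Fin k} (h : a ≠ b) (i : Fin 3) (c : Fin k) (l : Fin 3) :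
    (W (p a i) - W (p b i)) * W (p c l) =
      -(W (p (if i = l then Equiv.swap a b c else c) l) * (W (p a i) - W (p b i))) := by
  rw [sub_mul_vector hanti hsq (p_ne_of_left hp h i i)]
  congr 4
  split_ifs with e
  · subst e
    by_cases h1 : c = a
    · subst h1; simp
    by_cases h2 : c = b
    · subst h2; simp
    rw [Equiv.swap_apply_of_ne_of_ne h1 h2, Equiv.swap_apply_of_ne_of_ne (p_ne_of_left hp h1 _ _)
      (p_ne_of_left hp h2 _ _)]
  · exact Equiv.swap_apply_of_ne_of_ne (p_ne_of_right hp _ _ (Ne.symm e))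
      (p_ne_of_right hp _ _ (Ne.symm e))

theorem tripleProd_mul_vector {a b : Fin k} (h : a ≠ b) (c : Fin k) (l : Fin 3) :
    tripleProd W p a b * W (p c l) = -(W (p (Equiv.swap a b c) l) * tripleProd W p a b) := by
  have e := sub_mul_vector_mark hp hanti hsq h
  have e' (i : Fin 3) (c : Fin k) (l : Fin 3) (x : A) : (W (p a i) - W (p b i)) * (W (p c l) * x) =
      -(W (p (if i = l then Equiv.swap a b c else c) l) * ((W (p a i) - W (p b i)) * x)) := by
    rw [← mul_assoc, e, neg_mul, mul_assoc]
  simp only [tripleProd, mul_assoc]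
  rw [e 0, mul_neg, e' 1, neg_neg, e' 2]
  congr 4
  fin_cases l <;> simp

theorem tripleProd_mul_sub {a b : Fin k} (h : a ≠ b) (c d : Fin k) (l l' : Fin 3) :
    tripleProd W p a b * (W (p c l) - W (p d l')) =
      -((W (p (Equiv.swap a b c) l) - W (p (Equiv.swap a b d) l')) * tripleProd W p a b) := by
  rw [mul_sub, tripleProd_mul_vector hp hanti hsq h, tripleProd_mul_vector hp hanti hsq h, sub_mul,
    neg_sub, neg_sub_neg]

theorem tripleProd_conj {a b c d : Fin k} (h : a ≠ b) :
    tripleProd W p a b * tripleProd W p c d =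
      -(tripleProd W p (Equiv.swap a b c) (Equiv.swap a b d) * tripleProd W p a b) := by
  have e := tripleProd_mul_sub hp hanti hsq h
  nth_rw 2 [tripleProd]
  rw [← mul_assoc, e, neg_mul, mul_assoc, ← mul_assoc (tripleProd W p a b), e, neg_mul, mul_neg,
    neg_neg, mul_assoc, e, tripleProd.eq_def W p (Equiv.swap a b c)]
  simp only [mul_neg, mul_assoc]

theorem tripleProd_mul_rotProd {a b : Fin k} (h : a ≠ b) (j : Fin k) :
    tripleProd W p a b * rotProd W p j = rotProd W p (Equiv.swap a b j) * tripleProd W p a b := by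
  have e := tripleProd_mul_sub hp hanti hsq h
  rw [rotProd, ← mul_assoc, e, neg_mul, mul_assoc, e, mul_neg, neg_neg, rotProd, mul_assoc]

theorem tripleProd_mul_sub_other {a b : Fin k} (h : a ≠ b) {x y : ι} (hx : ∀ c i, x ≠ p c i)
    (hy : ∀ c i, y ≠ p c i) :
    tripleProd W p a b * (W x - W y) = -((W x - W y) * tripleProd W p a b) := by
  have e (i : Fin 3) := sub_mul_sub_of_ne hanti hsq (p_ne_of_left hp h i i) (hx a i) (hx b i) (hy a i)
    (hy b i)
  have e' (i : Fin 3) (z : A) : (W (p a i) - W (p b i)) * ((W x - W y) * z) =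
      -((W x - W y) * ((W (p a i) - W (p b i)) * z)) := by
    rw [← mul_assoc, e, neg_mul, mul_assoc]
  simp only [tripleProd, mul_assoc]
  rw [e 0, mul_neg, e' 1, neg_neg, e' 2]

theorem rotProd_mul_sub_other (j : Fin k) {x y : ι} (hx : ∀ c i, x ≠ p c i)
    (hy : ∀ c i, y ≠ p c i) : rotProd W p j * (W x - W y) = (W x - W y) * rotProd W p j := by
  have e1 := sub_mul_sub_of_ne hanti hsq (p_ne_of_right hp j j (show (1 : Fin 3) ≠ 0 by decide))
    (hx j 1) (hx j 0) (hy j 1) (hy j 0)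
  have e2 := sub_mul_sub_of_ne hanti hsq (p_ne_of_right hp j j (show (1 : Fin 3) ≠ 2 by decide))
    (hx j 1) (hx j 2) (hy j 1) (hy j 2)
  rw [rotProd, mul_assoc, e1, mul_neg, ← mul_assoc, e2, neg_mul, neg_neg, mul_assoc]

theorem rotProd_comm (i j : Fin k) : rotProd W p i * rotProd W p j = rotProd W p j * rotProd W p i := by
  by_cases h : i = j
  · rw [h]
  have e (u v u' v' : Fin 3) (huv : u ≠ v) := sub_mul_sub_of_ne hanti hsq (p_ne_of_right hp i i huv)
    (p_ne_of_left hp (Ne.symm h) u' u) (p_ne_of_left hp (Ne.symm h) u' v)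
    (p_ne_of_left hp (Ne.symm h) v' u) (p_ne_of_left hp (Ne.symm h) v' v)
  have e10 := e 1 0
  have e12 := e 1 2
  have f (u' v') : rotProd W p i * (W (p j u') - W (p j v')) =
      (W (p j u') - W (p j v')) * rotProd W p i := by
    rw [rotProd, mul_assoc, e10 _ _ (by decide), mul_neg, ← mul_assoc, e12 _ _ (by decide), neg_mul,
      neg_neg, mul_assoc]
  nth_rw 2 [rotProd]
  rw [← mul_assoc, f, mul_assoc, f, ← mul_assoc, ← rotProd]

variable (hsum : ∀ x y, W x * W x + W y * W y = -1)
include hsum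

theorem tripleProd_sq {a b : Fin k} (h : a ≠ b) :
    tripleProd W p a b * tripleProd W p a b = 1 := by
  have e (i l : Fin 3) (hil : i ≠ l) := sub_mul_sub_of_ne hanti hsq (p_ne_of_left hp h i i)
    (p_ne_of_right hp a a hil.symm) (p_ne_of_right hp a b hil.symm) (p_ne_of_right hp b a hil.symm)
    (p_ne_of_right hp b b hil.symm)
  have e02 := e 0 2 (by decide)
  have e01 := e 0 1 (by decide)
  have e12 := e 1 2 (by decide)
  have s0 := sub_mul_sub_self hanti hsum (p_ne_of_left hp h 0 0)
  have s1 := sub_mul_sub_self hanti hsum (p_ne_of_left hp h 1 1)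
  have s2 := sub_mul_sub_self hanti hsum (p_ne_of_left hp h 2 2)
  simp only [tripleProd]
  generalize W (p a 0) - W (p b 0) = x at *
  generalize W (p a 1) - W (p b 1) = y at *
  generalize W (p a 2) - W (p b 2) = z at *
  have f02 (w : A) : x * (z * w) = -(z * (x * w)) := by rw [← mul_assoc, e02, neg_mul, mul_assoc]
  have f01 (w : A) : x * (y * w) = -(y * (x * w)) := by rw [← mul_assoc, e01, neg_mul, mul_assoc]
  have f12 (w : A) : y * (z * w) = -(z * (y * w)) := by rw [← mul_assoc, e12, neg_mul, mul_assoc]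
  rw [mul_assoc, mul_assoc, f02, mul_neg, f12, neg_neg, f01, mul_neg, s0]
  simp only [mul_neg, mul_one, neg_neg, s1, s2]

theorem rotProd_cube (j : Fin k) : rotProd W p j * (rotProd W p j * rotProd W p j) = 1 := by
  have h10 : p j 1 ≠ p j 0 := p_ne_of_right hp j j (by decide)
  have h12 : p j 1 ≠ p j 2 := p_ne_of_right hp j j (by decide)
  have h02 : p j 0 ≠ p j 2 := p_ne_of_right hp j j (by decide)
  have e1 := sub_mul_sub hanti hsq h10 (p j 1) (p j 2)
  rw [Equiv.swap_apply_left, Equiv.swap_apply_of_ne_of_ne h12.symm h02.symm] at e1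
  have e2 := sub_mul_sub hanti hsq h12 (p j 1) (p j 0)
  rw [Equiv.swap_apply_left, Equiv.swap_apply_of_ne_of_ne h10.symm h02] at e2
  have s1 := sub_mul_sub_self hanti hsum h10
  have s2 := sub_mul_sub_self hanti hsum h12
  have s3 := sub_mul_sub_self hanti hsum h02
  have e1' : (W (p j 1) - W (p j 0)) * ((W (p j 1) - W (p j 2)) * (W (p j 1) - W (p j 0))) =
      W (p j 0) - W (p j 2) := by
    rw [← mul_assoc, e1, neg_mul, mul_assoc, s1, mul_neg, neg_neg, mul_one]
  have e2' : (W (p j 1) - W (p j 2)) * ((W (p j 1) - W (p j 0)) * (W (p j 1) - W (p j 2))) =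
      W (p j 2) - W (p j 0) := by
    rw [← mul_assoc, e2, neg_mul, mul_assoc, s2, mul_neg, neg_neg, mul_one]
  calc rotProd W p j * (rotProd W p j * rotProd W p j) =
      ((W (p j 1) - W (p j 2)) * ((W (p j 1) - W (p j 0)) * (W (p j 1) - W (p j 2)))) *
      ((W (p j 1) - W (p j 0)) * ((W (p j 1) - W (p j 2)) * (W (p j 1) - W (p j 0)))) := by
        simp only [rotProd, mul_assoc]
    _ = 1 := by rw [e1', e2', ← neg_sub, neg_mul, s3, neg_neg]

end Triple

/-! ### Relations between the operators of the exchanges and the saddle -/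

section QuadRelations

variable {R : Type} [CommRing R] {m n k : ℕ}

theorem renameRows_conj {r r' : Row n k} (h : r ≠ r') (t t' : Row n k) :
    (renameRows r r' * renameRows t t' : KEnd R n k) =
      renameRows (Equiv.swap r r' t) (Equiv.swap r r' t') * renameRows r r' := by
  have hr (x : KEnd R n k) (i) : renameRows r r' * (raise i * x) =
      raise (Equiv.swap r r' i) * (renameRows r r' * x) := by
    rw [← mul_assoc, renameRows_raise h, mul_assoc]
  rw [renameRows.eq_def t, renameRows.eq_def (Equiv.swap r r' t)]
  simp only [mul_sub, sub_mul, mul_one, one_mul, mul_assoc, hr, renameRows_lower h]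

theorem quadPsi_sq {a b : Fin k} (h : a ≠ b) :
    (ClosedWeb.quadPsi m n a b * ClosedWeb.quadPsi m n a b : KEnd (MarkRing m) n k) = 1 := by
  have h0 : (Sum.inr (a, 0) : Row n k) ≠ .inr (b, 0) := by simpa using h
  have h1 : (Sum.inr (a, 1) : Row n k) ≠ .inr (b, 1) := by simpa using h
  have e (i) : renameRows (Sum.inr (a, 0)) (Sum.inr (b, 0)) *
      cliff (rat m (1 / 2)) (.inr (i, 1) : Row n k) =
      cliff (rat m (1 / 2)) (.inr (i, 1)) * renameRows (Sum.inr (a, 0)) (Sum.inr (b, 0)) := by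
    rw [renameRows_cliff h0, Equiv.swap_apply_of_ne_of_ne (by simp) (by simp)]
  rw [quadPsi_eq h]
  nth_rw 1 [mul_sub]
  rw [e, e, ← sub_mul, mul_assoc, ← mul_assoc (renameRows _ _), renameRows_sq h0, one_mul,
    cliff_sub_sq (two_mul_rat_half m) h1]

theorem quadPsi_symm {a b : Fin k} (h : a ≠ b) :
    (ClosedWeb.quadPsi m n b a : KEnd (MarkRing m) n k) = -ClosedWeb.quadPsi m n a b := by
  rw [quadPsi_eq h, quadPsi_eq h.symm, renameRows_comm, ← mul_neg, neg_sub]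

theorem quadPsi_conj {a b c d : Fin k} (h : a ≠ b) (h' : c ≠ d) :
    (ClosedWeb.quadPsi m n a b * ClosedWeb.quadPsi m n c d : KEnd (MarkRing m) n k) =
      -(ClosedWeb.quadPsi m n (Equiv.swap a b c) (Equiv.swap a b d) * ClosedWeb.quadPsi m n a b) := by
  have inj (i : Fin 3) : Function.Injective fun j : Fin k => (Sum.inr (j, i) : Row n k) :=
    fun x y e => by simpa using e
  have sw (i : Fin 3) (c : Fin k) : Equiv.swap (Sum.inr (a, i) : Row n k) (Sum.inr (b, i))
      (Sum.inr (c, i)) = Sum.inr (Equiv.swap a b c, i) := by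
    have := (inj i).map_swap (x := a) (y := b) (z := c)
    exact this.symm
  have h0 : (Sum.inr (a, 0) : Row n k) ≠ .inr (b, 0) := by simpa using h
  have h1 : (Sum.inr (a, 1) : Row n k) ≠ .inr (b, 1) := by simpa using h
  have h0' : (Sum.inr (c, 0) : Row n k) ≠ .inr (d, 0) := by simpa using h'
  have comm {a b : Fin k} (h : (Sum.inr (a, 0) : Row n k) ≠ .inr (b, 0)) (x y : Fin k) :
      renameRows (Sum.inr (a, 0)) (Sum.inr (b, 0)) * (cliff (rat m (1 / 2)) (.inr (x, 1) : Row n k) -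
        cliff (rat m (1 / 2)) (.inr (y, 1))) = (cliff (rat m (1 / 2)) (.inr (x, 1)) -
        cliff (rat m (1 / 2)) (.inr (y, 1))) * renameRows (Sum.inr (a, 0)) (Sum.inr (b, 0)) := by
    rw [mul_sub, sub_mul, renameRows_cliff h, renameRows_cliff h,
      Equiv.swap_apply_of_ne_of_ne (by simp) (by simp), Equiv.swap_apply_of_ne_of_ne (by simp) (by simp)]
  have key := sub_mul_sub (W := cliff (R := MarkRing m) (n := n) (k := k) (rat m (1 / 2)))
    (fun x y => cliff_mul_cliff_of_ne _)
    (fun x y => by rw [cliff_sq, cliff_sq]) h1 (.inr (c, 1)) (.inr (d, 1))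
  rw [sw, sw] at key
  rw [quadPsi_eq h, quadPsi_eq h', quadPsi_eq ((Equiv.swap a b).injective.ne h')]
  have e1 := comm h0' a b
  have e2 := comm h0 (Equiv.swap a b c) (Equiv.swap a b d)
  have e3 := renameRows_conj (R := MarkRing m) h0 (.inr (c, 0)) (.inr (d, 0))
  rw [sw, sw] at e3
  generalize (renameRows (Sum.inr (a, 0)) (Sum.inr (b, 0)) : KEnd (MarkRing m) n k) = A at *
  generalize (renameRows (Sum.inr (c, 0)) (Sum.inr (d, 0)) : KEnd (MarkRing m) n k) = B at *
  rw [mul_assoc, ← mul_assoc _ B, ← e1, mul_assoc, key, ← mul_assoc A, e3, mul_neg, mul_assoc,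
    ← mul_assoc A, e2]
  simp only [mul_assoc]

theorem quadPsi_raise {a b : Fin k} (h : a ≠ b) (s : Fin n) :
    ClosedWeb.quadPsi m n a b * raise (.inl s) = -(raise (.inl s) * ClosedWeb.quadPsi m n a b) := by
  have h0 : (Sum.inr (a, 0) : Row n k) ≠ .inr (b, 0) := by simpa using h
  have e (i) : (cliff (rat m (1 / 2)) (.inr (i, 1)) * raise (.inl s) : KEnd (MarkRing m) n k) =
      -(raise (.inl s) * cliff (rat m (1 / 2)) (.inr (i, 1))) := by
    simp only [cliff, add_mul, mul_add, smul_mul_assoc, mul_smul_comm, raise_raise (.inr (i, 1)),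
      lower_raise (show (Sum.inr (i, 1) : Row n k) ≠ .inl s by simp)]
    module
  rw [quadPsi_eq h, mul_assoc, sub_mul, e, e, ← neg_sub', ← mul_sub, mul_neg, ← mul_assoc,
    renameRows_raise h0, Equiv.swap_apply_of_ne_of_ne (by simp) (by simp), mul_assoc]

theorem quadPsi_lower {a b : Fin k} (h : a ≠ b) (s : Fin n) :
    ClosedWeb.quadPsi m n a b * lower (.inl s) = -(lower (.inl s) * ClosedWeb.quadPsi m n a b) := by
  rw [lower_quadPsi h (by simp) (by simp), neg_neg]

theorem quadPsi_eta (W : ClosedWeb m n k) {s t : Fin n} (hst : s ≠ t) {a b : Fin k} (h : a ≠ b) :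
    ClosedWeb.quadPsi m n a b * W.eta s t = -(W.eta s t * ClosedWeb.quadPsi m n a b) := by
  have e (i) (x : KEnd (MarkRing m) n k) : ClosedWeb.quadPsi m n a b * (raise (.inl i) * x) =
      -(raise (.inl i) * (ClosedWeb.quadPsi m n a b * x)) := by
    rw [← mul_assoc, quadPsi_raise h, neg_mul, mul_assoc]
  rw [W.eta_eq hst]
  simp only [mul_add, mul_sub, add_mul, sub_mul, mul_smul_comm, smul_mul_assoc, e, quadPsi_raise h,
    quadPsi_lower h, mul_assoc, mul_neg, neg_neg]
  module

theorem lower_eta (W : ClosedWeb m n k) {s t : Fin n} (hst : s ≠ t) (q : Fin k × Fin 3) :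
    lower (.inr q) * W.eta s t = -(W.eta s t * lower (.inr q)) := by
  have e0 (i : Fin n) : (Sum.inr q : Row n k) ≠ .inl i := by simp
  have e (i) (x : KEnd (MarkRing m) n k) : lower (.inr q) * (raise (.inl i) * x) =
      -(raise (.inl i) * (lower (.inr q) * x)) := by
    rw [← mul_assoc, lower_raise (e0 i), neg_mul, mul_assoc]
  rw [W.eta_eq hst]
  simp only [mul_add, mul_sub, add_mul, sub_mul, mul_smul_comm, smul_mul_assoc, e,
    lower_raise (e0 _), lower_lower (.inr q), mul_assoc, mul_neg, neg_neg]
  module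

end QuadRelations

/-! ### Homomorphisms that vanish after excluding variables are null-homotopic -/

section Vanish

variable {R : Type} [CommRing R] {n k : ℕ}

/-- All matrix entries of the operator lie in the ideal `I`. -/
def VanishesMod (I : Ideal R) (D : KEnd R n k) : Prop := ∀ z S, D z S ∈ I

namespace VanishesMod

variable {I : Ideal R} {D D' : KEnd R n k}

theorem zero : VanishesMod I (0 : KEnd R n k) := fun _ _ => I.zero_mem

theorem add (h : VanishesMod I D) (h' : VanishesMod I D') : VanishesMod I (D + D') :=
  fun z S => I.add_mem (h z S) (h' z S)

theorem neg (h : VanishesMod I D) : VanishesMod I (-D) :=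
  fun z S => I.neg_mem (h z S)

theorem sub (h : VanishesMod I D) (h' : VanishesMod I D') : VanishesMod I (D - D') :=
  fun z S => I.sub_mem (h z S) (h' z S)

theorem smul (c : R) (h : VanishesMod I D) : VanishesMod I (c • D) :=
  fun z S => I.mul_mem_left c (h z S)

theorem smul_of_mem {c : R} (hc : c ∈ I) (D : KEnd R n k) : VanishesMod I (c • D) :=
  fun _ _ => I.mul_mem_right _ hc

theorem mul_right (h : VanishesMod I D) (X : KEnd R n k) : VanishesMod I (D * X) :=
  fun z S => h (X z) S

theorem mul_left (h : VanishesMod I D) (X : KEnd R n k) : VanishesMod I (X * D) := by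
  intro z S
  rw [Module.End.mul_apply, LinearMap.pi_apply_eq_sum_univ X, Finset.sum_apply]
  exact I.sum_mem fun T _ => I.mul_mem_right _ (h z T)

theorem mono {J : Ideal R} (hIJ : I ≤ J) (h : VanishesMod I D) : VanishesMod J D :=
  fun z S => hIJ (h z S)

/-- An operator with entries in `(γ) + I` is a multiple of `γ` modulo `I`. -/
theorem exists_div {γ : R} {s : Set R} (h : VanishesMod (Ideal.span (insert γ s)) D) :
    ∃ w : KEnd R n k, VanishesMod (Ideal.span s) (D - γ • w) := by
  have h' : ∀ S T, ∃ a, ∃ b ∈ Ideal.span s, D (fun j => if T = j then 1 else 0) S = a * γ + b :=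
    fun S T => Ideal.mem_span_insert.1 (h _ S)
  choose a b hb e using h'
  refine ⟨LinearMap.pi fun S => ∑ T, a S T • LinearMap.proj T, fun z S => ?_⟩
  have e1 : (D - γ • (LinearMap.pi fun S => ∑ T, a S T • LinearMap.proj T) : KEnd R n k) z S =
      ∑ T, z T * b S T := by
    rw [LinearMap.sub_apply, Pi.sub_apply, LinearMap.pi_apply_eq_sum_univ D, Finset.sum_apply]
    simp only [Pi.smul_apply, e, smul_eq_mul, LinearMap.smul_apply, LinearMap.pi_apply,
      LinearMap.sum_apply, LinearMap.proj_apply, Finset.mul_sum, ← Finset.sum_sub_distrib]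
    exact Finset.sum_congr rfl fun T _ => by ring
  rw [e1]
  exact Ideal.sum_mem _ fun T _ => Ideal.mul_mem_left _ _ (hb S T)

end VanishesMod

variable {κ : Type} (r : κ → Row n k)

/-- The coefficient of the odd generators of the rows `r j`, for `j` in a list. -/
def lowerProd (J : List κ) : KEnd R n k := (J.map fun j => lower (r j)).prod

theorem lowerProd_cons (j : κ) (J : List κ) :
    lowerProd r (j :: J) = (lower (r j) * lowerProd r J : KEnd R n k) := by
  simp [lowerProd]

theorem lower_mul_lowerProd_of_mem {j : κ} {J : List κ} (h : j ∈ J) :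
    lower (r j) * lowerProd r J = (0 : KEnd R n k) := by
  induction J with
  | nil => simp at h
  | cons i J ih =>
    rw [lowerProd_cons, ← mul_assoc]
    rcases List.mem_cons.1 h with rfl | h
    · rw [lower_sq, zero_mul]
    · rw [lower_lower, neg_mul, mul_assoc, ih h, mul_zero, neg_zero]

/-- A preimage under the coefficient map, for an operator with no component along the rows. -/
theorem exists_lowerProd_eq (hr : Function.Injective r) {I : Ideal R} {J : List κ} (hJ : J.Nodup)
    {w : KEnd R n k} (hw : ∀ j ∈ J, VanishesMod I (lower (r j) * w)) :
    ∃ h : KEnd R n k, VanishesMod I (lowerProd r J * h - w) := by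
  induction J generalizing w with
  | nil => exact ⟨w, by simpa [lowerProd] using VanishesMod.zero⟩
  | cons i J ih =>
    obtain ⟨hi, hJ⟩ := List.nodup_cons.1 hJ
    obtain ⟨h, hh⟩ := ih hJ (w := raise (r i) * w) fun j hj => by
      have hne : r j ≠ r i := fun e => hi (hr e ▸ hj)
      rw [← mul_assoc, lower_raise hne, neg_mul, mul_assoc]
      exact ((hw j (List.mem_cons_of_mem _ hj)).mul_left _).neg
    refine ⟨h, ?_⟩
    have e : lowerProd r (i :: J) * h - w =
        lower (r i) * (lowerProd r J * h - raise (r i) * w) - raise (r i) * (lower (r i) * w) := by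
      rw [lowerProd_cons, mul_sub, ← mul_assoc (lower _) (raise _), lower_raise_self, sub_mul, one_mul,
        mul_assoc, mul_assoc]
      abel
    rw [e]
    exact (hh.mul_left _).sub ((hw i List.mem_cons_self).mul_left _)

variable {r} {d d' : KEnd R n k} {γ : κ → R}

theorem lowerProd_mul_diff (hd' : ∀ j, d' * lower (r j) = (4 * γ j) • 1 - lower (r j) * d')
    (J : List κ) :
    VanishesMod (Ideal.span (γ '' {j | j ∈ J}))
      (lowerProd r J * d' - (-1 : R) ^ J.length • (d' * lowerProd r J)) := by
  induction J with
  | nil => simpa [lowerProd] using VanishesMod.zero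
  | cons j J ih =>
    have hle : Ideal.span (γ '' {i | i ∈ J}) ≤ Ideal.span (γ '' {i | i ∈ j :: J}) :=
      Ideal.span_mono (Set.image_mono fun i hi => List.mem_cons_of_mem _ hi)
    have hj : 4 * γ j ∈ Ideal.span (γ '' {i | i ∈ j :: J}) :=
      Ideal.mul_mem_left _ _ (Ideal.subset_span ⟨j, List.mem_cons_self, rfl⟩)
    have e : lowerProd r (j :: J) * d' - (-1 : R) ^ (j :: J).length • (d' * lowerProd r (j :: J)) =
        lower (r j) * (lowerProd r J * d' - (-1 : R) ^ J.length • (d' * lowerProd r J)) +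
          (4 * γ j) • ((-1 : R) ^ J.length • lowerProd r J) := by
      have h1 : lower (r j) * (d' * lowerProd r J) =
          (4 * γ j) • lowerProd r J - d' * (lower (r j) * lowerProd r J) := by
        rw [← mul_assoc, ← mul_assoc, hd', sub_mul, smul_mul_assoc, one_mul]
        abel
      rw [lowerProd_cons, List.length_cons, pow_succ, mul_sub, mul_smul_comm, h1, mul_assoc]
      module
    rw [e]
    exact ((ih.mono hle).mul_left _).add (VanishesMod.smul_of_mem hj _)

/-- Excluding variables is faithful up to homotopy: a homomorphism whose coefficient along the odd
generators of the rows `r j`, with regular first entries `4 γⱼ`, vanishes modulo the `γⱼ`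
is null-homotopic. -/
theorem exists_homotopy_of_vanishes (hr : Function.Injective r) (hdd : d * d = 0) (hdd' : d' * d' = 0)
    (hd' : ∀ j, d' * lower (r j) = (4 * γ j) • 1 - lower (r j) * d') {q : R} (hq : 4 * q = 1)
    (hreg : ∀ (J : List κ) (j : κ), j ∉ J → ∀ f, γ j * f ∈ Ideal.span (γ '' {i | i ∈ J}) →
      f ∈ Ideal.span (γ '' {i | i ∈ J})) {ε : R}
    (J : List κ) (hJ : J.Nodup) (D : KEnd R n k) (hD : d' * D = ε • (D * d))
    (hv : VanishesMod (Ideal.span (γ '' {i | i ∈ J})) (lowerProd r J * D)) :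
    ∃ h : KEnd R n k, D = d' * h + ε • (h * d) := by
  induction J generalizing D with
  | nil =>
    refine ⟨0, ?_⟩
    rw [mul_zero, zero_mul, smul_zero, add_zero]
    refine LinearMap.ext fun z => funext fun S => ?_
    have := hv z S
    simpa [lowerProd] using this
  | cons j J ih =>
    obtain ⟨hj, hJ⟩ := List.nodup_cons.1 hJ
    set I := Ideal.span (γ '' {i | i ∈ J}) with hI
    set L : KEnd R n k := lowerProd r J with hL
    set δ : R := (-1) ^ J.length with hδ
    have hδδ : δ * δ = 1 := by rw [hδ, ← mul_pow]; simp
    have hset : γ '' {i | i ∈ j :: J} = insert (γ j) (γ '' {i | i ∈ J}) := by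
      rw [← Set.image_insert_eq]
      congr 1
      ext i
      simp
    rw [hset, lowerProd_cons] at hv
    obtain ⟨w, hw⟩ := hv.exists_div
    rw [mul_assoc] at hw
    have cancel {X : KEnd R n k} (h : VanishesMod I (γ j • X)) : VanishesMod I X :=
      fun z S => hreg J j hj _ (h z S)
    have hwJ : ∀ i ∈ J, VanishesMod I (lower (r i) * w) := by
      intro i hi
      apply cancel
      have e : γ j • (lower (r i) * w) = -(lower (r i) * (lower (r j) * (L * D) - γ j • w)) := by
        rw [mul_sub, ← mul_assoc, lower_lower, neg_mul, mul_assoc, ← mul_assoc (lower (r i)) L,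
          lower_mul_lowerProd_of_mem r hi, zero_mul, mul_zero, mul_smul_comm]
        module
      rw [e]
      exact (hw.mul_left _).neg
    obtain ⟨h₀, hh₀⟩ := exists_lowerProd_eq r hr hJ hwJ
    have hLd := lowerProd_mul_diff hd' J
    rw [← hI, ← hL, ← hδ] at hLd
    -- The relation `δ d' w + ε w d = 4 δ L D` modulo `I`, multiplied by `γ j`.
    have key : VanishesMod I ((4 * δ) • (L * D) - δ • (d' * w) - ε • (w * d)) := by
      apply cancel
      have e : γ j • ((4 * δ) • (L * D) - δ • (d' * w) - ε • (w * d)) =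
          δ • (d' * (lower (r j) * (L * D) - γ j • w)) + ε • ((lower (r j) * (L * D) - γ j • w) * d)
          - lower (r j) * ((L * d' - δ • (d' * L)) * D) := by
        have h1 : d' * (lower (r j) * (L * D)) =
            (4 * γ j) • (L * D) - lower (r j) * (d' * (L * D)) := by
          rw [← mul_assoc, hd', sub_mul, smul_mul_assoc, one_mul, mul_assoc]
        simp only [mul_sub, sub_mul, mul_smul_comm, smul_mul_assoc, mul_assoc, h1, hD, smul_sub,
          smul_smul]
        module
      rw [e]
      exact (((hw.mul_left _).smul _).add ((hw.mul_right _).smul _)).sub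
        ((hLd.mul_right _).mul_left _)
    have hD' : d' * (D - (δ * q) • (d' * h₀ + ε • (h₀ * d))) =
        ε • ((D - (δ * q) • (d' * h₀ + ε • (h₀ * d))) * d) := by
      have h3 : d' * (d' * h₀) = 0 := by rw [← mul_assoc, hdd', zero_mul]
      simp only [mul_sub, sub_mul, mul_add, add_mul, mul_smul_comm, smul_mul_assoc, mul_assoc, hD, h3,
        hdd, mul_zero, smul_zero]
      module
    have hv' : VanishesMod I (L * (D - (δ * q) • (d' * h₀ + ε • (h₀ * d)))) := by
      have e : L * (D - (δ * q) • (d' * h₀ + ε • (h₀ * d))) =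
          (δ * q) • ((4 * δ) • (L * D) - δ • (d' * w) - ε • (w * d)) -
          (δ * q) • ((L * d' - δ • (d' * L)) * h₀ + δ • (d' * (L * h₀ - w)) +
            ε • ((L * h₀ - w) * d)) := by
        have h4 : δ * (q * (4 * δ)) = 1 := by linear_combination 4 * q * hδδ + hq
        simp only [mul_sub, sub_mul, mul_add, mul_smul_comm, smul_mul_assoc, mul_assoc, smul_sub,
          smul_add, smul_smul]
        rw [h4]
        module
      rw [e]
      exact (key.smul _).sub ((((hLd.mul_right _).add ((hh₀.mul_left _).smul _)).add
        ((hh₀.mul_right _).smul _)).smul _)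
    obtain ⟨h₁, hh₁⟩ := ih hJ _ hD' hv'
    refine ⟨h₁ + (δ * q) • h₀, ?_⟩
    rw [sub_eq_iff_eq_add] at hh₁
    rw [hh₁]
    simp only [mul_add, add_mul, mul_smul_comm, smul_mul_assoc]
    module

end Vanish

/-! ### Faithfulness of the exclusion of the variables at the sinks -/

section Exclusion

variable {m n k : ℕ}

/-- The linear polynomial `e₁(incoming) - a` at the `(-)`-vertex `j`; the third row of the pair has
the first entry `4` times this polynomial. -/
def ClosedWeb.linearForm (W : ClosedWeb m n k) (j : Fin k) : MarkRing m :=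
  elemSym (W.inVar j) 0 - pa m

theorem ClosedWeb.linearForm_eq (W : ClosedWeb m n k) (j : Fin k) :
    W.linearForm j = X (W.leave (.inr (j, 0))) + X (W.leave (.inr (j, 1))) +
      X (W.leave (.inr (j, 2))) - pa m := rfl

theorem ClosedWeb.linearForm_ne_zero (W : ClosedWeb m n k) (j : Fin k) : W.linearForm j ≠ 0 := by
  intro h
  have := congrArg (aeval fun _ => (0 : Ground)) h
  simp [W.linearForm_eq, pa] at this

open Classical in
/-- The substitution that excludes the first variable at each of the vertices in `J`. -/
def ClosedWeb.excludeHom (W : ClosedWeb m n k) (J : Set (Fin k)) : MarkRing m →ₐ[Ground] MarkRing m :=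
  aeval fun x => if h : ∃ j ∈ J, x = W.leave (.inr (j, 0)) then X x - W.linearForm h.choose else X x

theorem ClosedWeb.excludeHom_X_of_mem (W : ClosedWeb m n k) {J : Set (Fin k)} {j : Fin k} (hj : j ∈ J) :
    W.excludeHom J (X (W.leave (.inr (j, 0)))) =
      X (W.leave (.inr (j, 0))) - W.linearForm j := by
  have h : ∃ i ∈ J, W.leave (.inr (j, 0)) = W.leave (.inr (i, 0)) := ⟨j, hj, rfl⟩
  have e : h.choose = j := by
    have := W.leave.injective h.choose_spec.2
    simpa using this.symm
  rw [excludeHom, aeval_X, dif_pos h, e]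

theorem ClosedWeb.excludeHom_X_of_forall (W : ClosedWeb m n k) {J : Set (Fin k)} {x : Fin m}
    (hx : ∀ j ∈ J, x ≠ W.leave (.inr (j, 0))) : W.excludeHom J (X x) = X x := by
  rw [excludeHom, aeval_X, dif_neg]
  push Not
  exact hx

theorem ClosedWeb.excludeHom_linearForm (W : ClosedWeb m n k) (J : Set (Fin k)) [DecidablePred (· ∈ J)]
    (j : Fin k) : W.excludeHom J (W.linearForm j) = if j ∈ J then 0 else W.linearForm j := by
  have h1 : W.excludeHom J (X (W.leave (.inr (j, 1)))) = X (W.leave (.inr (j, 1))) :=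
    W.excludeHom_X_of_forall fun i _ => W.leave.injective.ne (by simp)
  have h2 : W.excludeHom J (X (W.leave (.inr (j, 2)))) = X (W.leave (.inr (j, 2))) :=
    W.excludeHom_X_of_forall fun i _ => W.leave.injective.ne (by simp)
  have ha : W.excludeHom J (pa m) = pa m := (W.excludeHom J).commutes _
  split_ifs with hj
  · rw [linearForm_eq, map_sub, map_add, map_add, h1, h2, ha, W.excludeHom_X_of_mem hj,
      linearForm_eq]
    ring
  · rw [linearForm_eq, map_sub, map_add, map_add, h1, h2, ha, W.excludeHom_X_of_forall]
    intro i hi e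
    have := W.leave.injective e
    simp only [Sum.inr.injEq, Prod.mk.injEq, and_true] at this
    exact hj (this ▸ hi)

theorem ClosedWeb.sub_excludeHom_mem (W : ClosedWeb m n k) (J : Set (Fin k)) (f : MarkRing m) :
    f - W.excludeHom J f ∈ Ideal.span (W.linearForm '' J) := by
  induction f using MvPolynomial.induction_on with
  | C c =>
    have : W.excludeHom J (C c) = C c := (W.excludeHom J).commutes c
    rw [this, sub_self]
    exact zero_mem _
  | add f g hf hg =>
    rw [map_add, add_sub_add_comm]
    exact add_mem hf hg
  | mul_X f x hf =>
    have hX : X x - W.excludeHom J (X x) ∈ Ideal.span (W.linearForm '' J) := by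
      by_cases h : ∃ j ∈ J, x = W.leave (.inr (j, 0))
      · obtain ⟨j, hj, rfl⟩ := h
        rw [W.excludeHom_X_of_mem hj, sub_sub_cancel]
        exact Ideal.subset_span ⟨j, hj, rfl⟩
      · push Not at h
        rw [W.excludeHom_X_of_forall h, sub_self]
        exact zero_mem _
    have e : f * X x - W.excludeHom J (f * X x) =
        (f - W.excludeHom J f) * X x + W.excludeHom J f * (X x - W.excludeHom J (X x)) := by
      rw [map_mul]; ring
    rw [e]
    exact add_mem (Ideal.mul_mem_right _ _ hf) (Ideal.mul_mem_left _ _ hX)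

/-- The linear forms at the `(-)`-vertices form a regular sequence, in any order. -/
theorem ClosedWeb.linearForm_regular (W : ClosedWeb m n k) {J : Set (Fin k)} {j : Fin k} (hj : j ∉ J)
    {f : MarkRing m} (hf : W.linearForm j * f ∈ Ideal.span (W.linearForm '' J)) :
    f ∈ Ideal.span (W.linearForm '' J) := by
  classical
  have kill : ∀ g ∈ Ideal.span (W.linearForm '' J), W.excludeHom J g = 0 := by
    intro g hg
    have hle : Ideal.span (W.linearForm '' J) ≤ RingHom.ker (W.excludeHom J) := by
      rw [Ideal.span_le]
      rintro _ ⟨i, hi, rfl⟩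
      simp only [SetLike.mem_coe, RingHom.mem_ker]
      rw [W.excludeHom_linearForm, if_pos hi]
    exact hle hg
  have h0 := kill _ hf
  rw [map_mul, W.excludeHom_linearForm, if_neg hj] at h0
  have h1 := (mul_eq_zero.1 h0).resolve_left (W.linearForm_ne_zero j)
  simpa [h1] using W.sub_excludeHom_mem J f

theorem parityOp_koszulDiff {R : Type} [CommRing R] (α β : Row n k → R) :
    parityOp R n k * koszulDiff α β = -(koszulDiff α β * parityOp R n k) := by
  rw [koszulDiff, Finset.mul_sum, Finset.sum_mul, ← Finset.sum_neg_distrib]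
  refine Finset.sum_congr rfl fun i _ => ?_
  rw [mul_add, add_mul, mul_smul_comm, mul_smul_comm, parityOp_raise, parityOp_lower]
  simp only [smul_mul_assoc]
  module

theorem neg_one_pow_zsmul {R : Type} [CommRing R] (p : ℕ) (F : KEnd R n k) :
    ((-1 : ℤ) ^ p) • F = ((-1 : R) ^ p) • F := by
  rw [← Int.cast_smul_eq_zsmul R, Int.cast_pow, Int.cast_neg, Int.cast_one]

theorem neg_one_pow_mul_self {R : Type} [CommRing R] (p : ℕ) : (-1 : R) ^ p * (-1) ^ p = 1 := by
  rw [← mul_pow, neg_mul_neg, one_mul, one_pow]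

/-- A homotopy can be replaced by its component of the right parity. -/
theorem homotopic_of_eq {R : Type} [CommRing R] {d d' F G h : KEnd R n k} {p : ℕ} {q : R}
    (hq : 2 * q = 1)
    (hd : parityOp R n k * d = -(d * parityOp R n k))
    (hd' : parityOp R n k * d' = -(d' * parityOp R n k)) (hF : IsHom d d' p F) (hG : IsHom d d' p G)
    (e : F - G = d' * h + ((-1 : R) ^ p) • (h * d)) : Homotopic d d' p F G := by
  have hFG : (F - G) * parityOp R n k = ((-1 : R) ^ p) • (parityOp R n k * (F - G)) := by
    rw [sub_mul, hF.parity, hG.parity, neg_one_pow_zsmul, neg_one_pow_zsmul, mul_sub, smul_sub]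
  have hε : ((-1 : R) ^ p) * ((-1 : R) ^ p) = 1 := neg_one_pow_mul_self p
  generalize hδ : (-1 : R) ^ p = ε at *
  have hε' : (-1 : R) ^ (p + 1) = -ε := by rw [pow_succ, hδ]; ring
  set P := parityOp R n k with hP
  have hPP : P * P = 1 := parityOp_sq
  -- Conjugation by the grading operator gives a second homotopy, of the opposite odd part.
  have e2 : F - G = d' * (-ε • (P * (h * P))) + ε • ((-ε • (P * (h * P))) * d) := by
    have h1 : F - G = ε • (P * ((F - G) * P)) := by
      rw [hFG, mul_smul_comm, ← mul_assoc, hPP, one_mul, smul_smul, hε, one_smul]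
    have h2 : P * (d' * (h * P)) = -(d' * (P * (h * P))) := by
      rw [← mul_assoc, hd', neg_mul, mul_assoc]
    have h3 : d * P = -(P * d) := by rw [hd, neg_neg]
    rw [h1, e]
    simp only [add_mul, mul_add, mul_assoc, smul_mul_assoc, mul_smul_comm, h2, h3, mul_neg, smul_neg]
    module
  refine ⟨q • (h + -ε • (P * (h * P))), ?_, ?_⟩
  · rw [neg_one_pow_zsmul, hε', ← hP, smul_mul_assoc, add_mul, smul_mul_assoc, mul_assoc, mul_assoc,
      hPP, mul_one, mul_smul_comm, mul_add, mul_smul_comm, ← mul_assoc P P, hPP, one_mul]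
    linear_combination (norm := module) (-q * hε) • (h * P)
  · have : F - G = (2 * q) • (F - G) := by rw [hq, one_smul]
    rw [this, two_mul, add_smul]
    nth_rw 1 [e]
    rw [e2, neg_one_pow_zsmul, hδ]
    simp only [mul_add, add_mul, smul_mul_assoc, mul_smul_comm]
    module

/-- The coefficient of the odd generators of the third rows of all pairs. -/
def sinkProd (m n k : ℕ) : KEnd (MarkRing m) n k :=
  lowerProd (fun j : Fin k => Sum.inr (j, 2)) (List.finRange k)

/-- The ideal generated by the linear forms at the `(-)`-vertices. -/
def ClosedWeb.sinkIdeal (W : ClosedWeb m n k) : Ideal (MarkRing m) :=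
  Ideal.span (Set.range W.linearForm)

/-- Homomorphisms that agree after one variable at each `(-)`-vertex is excluded are homotopic. -/
theorem ClosedWeb.homotopic_of_vanishesMod (W W' : ClosedWeb m n k) (hW : W'.leave = W.leave)
    (σ τ : Equiv.Perm (Fin k)) {p : ℕ} {F G : KEnd (MarkRing m) n k}
    (hF : IsHom (W.d σ) (W'.d τ) p F) (hG : IsHom (W.d σ) (W'.d τ) p G)
    (h : VanishesMod W.sinkIdeal (sinkProd m n k * (F - G))) :
    Homotopic (W.d σ) (W'.d τ) p F G := by
  have hset : W.linearForm '' {i | i ∈ List.finRange k} = Set.range W.linearForm := by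
    simp
  have hcol (j : Fin k) : W'.colA τ (.inr (j, 2)) = 4 * W.linearForm j := by
    have : W'.inVar j = W.inVar j := funext fun i => by simp only [inVar, hW]
    rw [linearForm, ← this]
    rfl
  have hd' (j : Fin k) : W'.d τ * lower (.inr (j, 2)) =
      (4 * W.linearForm j) • 1 - lower (.inr (j, 2)) * W'.d τ := by
    rw [← hcol]
    exact koszulDiff_mul_lower _ _ _
  have hp : parityOp (MarkRing m) n k * W.d σ = -(W.d σ * parityOp (MarkRing m) n k) :=
    parityOp_koszulDiff _ _
  have hp' : parityOp (MarkRing m) n k * W'.d τ = -(W'.d τ * parityOp (MarkRing m) n k) :=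
    parityOp_koszulDiff _ _
  have hD : W'.d τ * (F - G) = ((-1 : MarkRing m) ^ p) • ((F - G) * W.d σ) := by
    rw [mul_sub, hF.comm, hG.comm, neg_one_pow_zsmul, neg_one_pow_zsmul, sub_mul, smul_sub]
  rw [sinkIdeal, ← hset] at h
  obtain ⟨h, e⟩ := exists_homotopy_of_vanishes (γ := W.linearForm)
    (r := fun j : Fin k => Sum.inr (j, 2)) (fun i j e => by simpa using e) (W.d_sq σ)
    (W'.d_sq τ) hd' (four_mul_rat_quarter m)
    (fun J j hj f hf => W.linearForm_regular (J := {i | i ∈ J}) hj hf)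
    (List.finRange k) (List.nodup_finRange k) (F - G) hD h
  exact homotopic_of_eq (two_mul_rat_half m) hp hp' hF hG e

end Exclusion

/-! ### The exchange isomorphisms and the saddle after the exclusion of variables -/

section SinkProd

variable {m n k : ℕ}

theorem neg_one_pow_add_two {R : Type} [CommRing R] (l : ℕ) : (-1 : R) ^ (l + 2) = (-1) ^ l := by
  rw [pow_add, neg_one_sq, mul_one]

theorem lowerProd_mul_of_anticomm {R : Type} [CommRing R] {κ : Type} (r : κ → Row n k)
    {x : KEnd R n k} (hx : ∀ j, lower (r j) * x = -(x * lower (r j))) (J : List κ) :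
    lowerProd r J * x = (-1 : R) ^ J.length • (x * lowerProd r J) := by
  induction J with
  | nil => simp [lowerProd]
  | cons j J ih =>
    rw [lowerProd_cons, mul_assoc, ih, mul_smul_comm, ← mul_assoc, hx, neg_mul, mul_assoc,
      List.length_cons, pow_succ]
    module

theorem lowerProd_perm {R : Type} [CommRing R] {κ : Type} (r : κ → Row n k)
    {J J' : List κ} (h : J.Perm J') : ∃ c : R, lowerProd r J = c • (lowerProd r J' : KEnd R n k) := by
  induction h with
  | nil => exact ⟨1, by rw [one_smul]⟩
  | cons j _ ih =>
    obtain ⟨c, hc⟩ := ih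
    exact ⟨c, by rw [lowerProd_cons, lowerProd_cons, hc, mul_smul_comm]⟩
  | swap i j J =>
    refine ⟨-1, ?_⟩
    simp only [lowerProd_cons]
    rw [← mul_assoc, lower_lower, neg_mul, mul_assoc]
    module
  | trans _ _ ih₁ ih₂ =>
    obtain ⟨c, hc⟩ := ih₁
    obtain ⟨c', hc'⟩ := ih₂
    exact ⟨c * c', by rw [hc, hc', smul_smul]⟩

theorem sinkProd_mul_eta (W : ClosedWeb m n k) {s t : Fin n} (hst : s ≠ t) :
    sinkProd m n k * W.eta s t = (-1 : MarkRing m) ^ k • (W.eta s t * sinkProd m n k) := by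
  have := lowerProd_mul_of_anticomm (fun j : Fin k => Sum.inr (j, 2))
    (fun j => lower_eta W hst (j, 2)) (List.finRange k)
  rwa [List.length_finRange] at this

theorem ClosedWeb.IsExchangeIso.sinkProd_mul {W : ClosedWeb m n k} {σ : Equiv.Perm (Fin k)}
    {j j' : Fin k} {F : KEnd (MarkRing m) n k} (hF : W.IsExchangeIso σ j j' F) (h : j ≠ j') :
    VanishesMod W.sinkIdeal (sinkProd m n k * F -
      ((-1 : MarkRing m) ^ k • quadPsi m n j j') * sinkProd m n k) := by
  set r : Fin k → Row n k := fun j => Sum.inr (j, 2) with hr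
  have hmem : j' ∈ (List.finRange k).erase j :=
    (List.mem_erase_of_ne h.symm).2 (List.mem_finRange _)
  have hperm : (List.finRange k).Perm (((List.finRange k).erase j).erase j' ++ [j', j]) :=
    ((List.perm_cons_erase (List.mem_finRange j)).trans
      ((List.perm_cons_erase hmem).cons j)).trans
      ((List.Perm.swap _ _ _).trans (List.perm_append_comm (l₁ := [j', j])))
  generalize ((List.finRange k).erase j).erase j' = J at hperm
  obtain ⟨c, hc⟩ := lowerProd_perm (R := MarkRing m) r hperm
  have hlen : k = J.length + 2 := by simpa using hperm.length_eq
  have happ : (lowerProd r (J ++ [j', j]) : KEnd (MarkRing m) n k) =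
      lowerProd r J * thirdRows m n j j' := by
    simp [lowerProd, thirdRows, hr]
  rw [happ] at hc
  have hanti := lowerProd_mul_of_anticomm r
    (fun i => lower_quadPsi (m := m) h (r := r i) (by simp [hr]) (by simp [hr])) J
  have hk : (-1 : MarkRing m) ^ k = (-1) ^ J.length := by
    have := congrArg (fun l => (-1 : MarkRing m) ^ l) hlen
    exact this.trans (neg_one_pow_add_two _)
  have hF' : VanishesMod W.sinkIdeal
      (thirdRows m n j j' * F - quadPsi m n j j' * thirdRows m n j j') := by
    intro z S
    refine Ideal.span_mono ?_ (hF.induces z S)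
    rintro _ (rfl | rfl)
    · exact ⟨j, rfl⟩
    · exact ⟨j', rfl⟩
  have e : sinkProd m n k * F - ((-1 : MarkRing m) ^ k • quadPsi m n j j') * sinkProd m n k =
      c • (lowerProd r J * (thirdRows m n j j' * F - quadPsi m n j j' * thirdRows m n j j')) := by
    rw [sinkProd, hc, hk, mul_sub, ← mul_assoc (lowerProd r J) (quadPsi m n j j'), hanti]
    simp only [smul_mul_assoc, mul_smul_comm, mul_assoc]
    module
  rw [e]
  exact (hF'.mul_left _).smul _

end SinkProd

/-! ### Clifford vectors which compute the signs of surgeries -/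

section States

variable {m : ℕ}

/-- The operator whose differences are the operators of the surgeries. -/
def surgVec (x : Fin m) : KEnd ℚ m 0 :=
  ((-1 : ℚ) ^ m) • (cliff (1 / 2) (.inl x) * parityOp ℚ m 0)

/-- `f` is a state for `π` if `θ_{π x} - ½ ∂_{π x}` and `θ_x + ½ ∂_x` agree on `f` for all marks
`x`. The states of `π` form a line, and the surgery along `(x, y)` takes it to the line of
`π * swap x y`. -/
def IsState (π : Equiv.Perm (Fin m)) (f : KMod ℚ m 0) : Prop :=
  ∀ x, cliff (-(1 / 2)) (.inl (π x)) f = cliff (1 / 2) (.inl x) f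

/-- The components of `f` have degree at most `e`. -/
def DegLE (e : ℤ) (f : KMod ℚ m 0) : Prop := ∀ S, f S ≠ 0 → (S.card : ℤ) ≤ e

/-- The state `f` has the degree and the parity which match the number of circles in `l`. -/
structure Matches (l : List (Fin m)) (f : KMod ℚ m 0) : Prop where
  deg : DegLE (m - l.length) f
  parity : parityOp ℚ m 0 f = ((-1 : ℚ) ^ (m + l.length)) • f

/-- Exterior multiplication by the generators of the marks in a list. -/
def raiseProd (l : List (Fin m)) : KEnd ℚ m 0 := (l.map fun x => raise (.inl x)).prod

/-- The top coefficient of the product of a list of circles with a state. It changes sign if two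
circles in the list are transposed, and does not depend on the marks which represent the circles. -/
def topCoeff (l : List (Fin m)) (f : KMod ℚ m 0) : ℚ := raiseProd l f Finset.univ

/-- The permutation after a sequence of surgeries. -/
def wordPerm (π : Equiv.Perm (Fin m)) : List (Fin m × Fin m) → Equiv.Perm (Fin m)
  | [] => π
  | p :: w => wordPerm (π * Equiv.swap p.1 p.2) w

/-- The product of the operators of a sequence of surgeries. -/
def wordOp : List (Fin m × Fin m) → KEnd ℚ m 0
  | [] => 1
  | p :: w => wordOp w * (surgVec p.1 - surgVec p.2)

theorem raiseProd_cons (x : Fin m) (l : List (Fin m)) :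
    raiseProd (x :: l) = raise (.inl x) * raiseProd l := by
  simp [raiseProd]

theorem raise_mul_raiseProd (x : Fin m) (l : List (Fin m)) :
    raise (.inl x) * raiseProd l = (-1 : ℚ) ^ l.length • (raiseProd l * raise (.inl x)) := by
  induction l with
  | nil => simp [raiseProd]
  | cons y l ih =>
    rw [raiseProd_cons, ← mul_assoc, raise_raise, neg_mul, mul_assoc, ih, mul_smul_comm, mul_assoc,
      List.length_cons, pow_succ]
    module

namespace DegLE

variable {e : ℤ} {f g : KMod ℚ m 0}

theorem zero : DegLE e (0 : KMod ℚ m 0) := fun _ h => absurd rfl h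

theorem add (hf : DegLE e f) (hg : DegLE e g) : DegLE e (f + g) := by
  intro S h
  by_cases h' : f S = 0
  · exact hg S fun h'' => h (by simp [h', h''])
  · exact hf S h'

theorem smul (c : ℚ) (hf : DegLE e f) : DegLE e (c • f) :=
  fun S h => hf S fun h' => h (by simp [h'])

theorem neg (hf : DegLE e f) : DegLE e (-f) := fun S h => hf S fun h' => h (by simp [h'])

theorem sub (hf : DegLE e f) (hg : DegLE e g) : DegLE e (f - g) := by
  rw [sub_eq_add_neg]; exact hf.add hg.neg

theorem mono {e' : ℤ} (hf : DegLE e f) (h : e ≤ e') : DegLE e' f := fun S hS => (hf S hS).trans h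

theorem raise (hf : DegLE e f) (i : Row m 0) : DegLE (e + 1) (raise i f) := by
  intro S h
  rw [raise_apply] at h
  split_ifs at h with hi
  · have := hf (S.erase i) fun h' => h (by simp [h'])
    have hc := Finset.card_erase_add_one hi
    omega
  · exact absurd rfl h

theorem lower (hf : DegLE e f) (i : Row m 0) : DegLE (e - 1) (lower i f) := by
  intro S h
  rw [lower_apply] at h
  split_ifs at h with hi
  · exact absurd rfl h
  · have := hf (insert i S) fun h' => h (by simp [h'])
    have hc := Finset.card_insert_of_notMem hi
    omega

theorem raiseProd (hf : DegLE e f) (l : List (Fin m)) : DegLE (e + l.length) (raiseProd l f) := by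
  induction l with
  | nil => simpa [Sl3.raiseProd] using hf
  | cons x l ih =>
    rw [raiseProd_cons]
    exact (ih.raise _).mono (by simp only [List.length_cons]; push_cast; omega)

theorem topCoeff_eq_zero (hf : DegLE e f) (l : List (Fin m)) (h : e + l.length < m) :
    topCoeff l f = 0 := by
  by_contra hc
  have := hf.raiseProd l _ hc
  rw [Finset.card_univ] at this
  simp at this
  omega

end DegLE

theorem IsState.raise_sub_eq {π : Equiv.Perm (Fin m)} {f : KMod ℚ m 0} (hf : IsState π f) (x : Fin m) :
    raise (.inl (π x)) f - raise (.inl x) f =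
      (1 / 2 : ℚ) • (lower (.inl (π x)) f + lower (.inl x) f) := by
  have := hf x
  simp only [cliff, LinearMap.add_apply, LinearMap.smul_apply] at this
  linear_combination (norm := module) this

/-- On a state, the generators of marks on the same circle agree up to terms of lower degree. -/
theorem IsState.degLE_sub {π : Equiv.Perm (Fin m)} {f : KMod ℚ m 0} (hf : IsState π f) {e : ℤ}
    (he : DegLE e f) {x y : Fin m} (h : π.SameCycle x y) :
    DegLE (e - 1) (raise (.inl x) f - raise (.inl y) f) := by
  obtain ⟨i, -, rfl⟩ := h.exists_pow_eq'
  induction i with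
  | zero => simpa using DegLE.zero
  | succ i ih =>
    have h1 := (((he.lower (.inl (π ((π ^ i) x)))).add (he.lower (.inl ((π ^ i) x)))).smul (1 / 2))
    rw [← hf.raise_sub_eq] at h1
    rw [pow_succ', Equiv.Perm.mul_apply]
    have := (ih ⟨i, by simp⟩).sub h1
    convert this using 1
    abel

theorem parityOp_surgVec (x : Fin m) :
    parityOp ℚ m 0 * surgVec x = -(surgVec x * parityOp ℚ m 0) := by
  rw [surgVec, mul_smul_comm, ← mul_assoc, parityOp_cliff, smul_mul_assoc, neg_mul, smul_neg]

theorem surgVec_anti (x y : Fin m) (h : x ≠ y) : surgVec x * surgVec y = -(surgVec y * surgVec x) := by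
  have e (x y : Fin m) : surgVec x * surgVec y =
      -(((-1 : ℚ) ^ m * (-1) ^ m) • (cliff (1 / 2) (.inl x) * cliff (1 / 2) (.inl y))) := by
    rw [surgVec, surgVec, smul_mul_assoc, mul_smul_comm, mul_assoc, ← mul_assoc (parityOp _ _ _),
      parityOp_cliff, neg_mul, mul_assoc, parityOp_sq, mul_one, mul_neg]
    module
  rw [e, e, cliff_mul_cliff_of_ne _ (by simpa using h), smul_neg]

theorem surgVec_sq (x : Fin m) : surgVec x * surgVec x = -((1 / 2 : ℚ) • (1 : KEnd ℚ m 0)) := by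
  rw [surgVec, smul_mul_assoc, mul_smul_comm, smul_smul, neg_one_pow_mul_self, one_smul, mul_assoc,
    ← mul_assoc (parityOp _ _ _), parityOp_cliff, neg_mul, mul_assoc, parityOp_sq, mul_one, mul_neg,
    cliff_sq]

theorem surgVec_sq_add_sq (x y : Fin m) : surgVec x * surgVec x + surgVec y * surgVec y = -1 := by
  rw [surgVec_sq, surgVec_sq]
  module

theorem cliff_neg_mul_cliff (i j : Row m 0) : (cliff (-(1 / 2)) i * cliff (1 / 2) j : KEnd ℚ m 0) =
    -(cliff (1 / 2) j * cliff (-(1 / 2)) i) := by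
  by_cases h : i = j
  · subst h
    simp only [cliff, add_mul, mul_add, smul_mul_assoc, mul_smul_comm, lower_raise_self, raise_sq,
      lower_sq]
    module
  · simp only [cliff, add_mul, mul_add, smul_mul_assoc, mul_smul_comm, lower_raise h, raise_raise i j,
      lower_lower i j, lower_raise (Ne.symm h)]
    module

/-- The operator of a surgery takes states to states. -/
theorem IsState.surgery {π : Equiv.Perm (Fin m)} {f : KMod ℚ m 0} (hf : IsState π f) {x y : Fin m}
    (hxy : x ≠ y) : IsState (π * Equiv.swap x y) ((surgVec x - surgVec y) f) := by
  intro z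
  have hP := parityOp_cliff (R := ℚ) (n := m) (k := 0)
  have h1 (w : Fin m) : cliff (-(1 / 2)) (.inl w) * (surgVec x - surgVec y) =
      (surgVec x - surgVec y) * cliff (-(1 / 2)) (.inl w) := by
    have e (x : Fin m) : cliff (-(1 / 2)) (.inl w) * surgVec x =
        surgVec x * cliff (-(1 / 2)) (.inl w) := by
      rw [surgVec, mul_smul_comm, ← mul_assoc, cliff_neg_mul_cliff, smul_mul_assoc, mul_assoc, hP,
        neg_mul, mul_assoc, mul_neg]
    rw [mul_sub, sub_mul, e, e]
  have h2 : (surgVec x - surgVec y) * cliff (1 / 2) (.inl (Equiv.swap x y z)) =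
      cliff (1 / 2) (.inl z) * (surgVec x - surgVec y) := by
    have hs := sub_mul_vector (W := fun w : Fin m => (cliff (1 / 2) (.inl w) : KEnd ℚ m 0))
      (fun a b h => cliff_mul_cliff_of_ne _ (by simpa using h))
      (fun a b => by rw [cliff_sq, cliff_sq]) hxy (Equiv.swap x y z)
    rw [Equiv.swap_apply_self] at hs
    rw [surgVec, surgVec, ← smul_sub, ← sub_mul, smul_mul_assoc, mul_assoc, hP, mul_neg, ← mul_assoc,
      hs, neg_mul, neg_neg, mul_smul_comm, mul_assoc]
  have e1 := congrArg (fun F : KEnd ℚ m 0 => F f) (h1 (π (Equiv.swap x y z)))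
  have e2 := congrArg (fun F : KEnd ℚ m 0 => F f) h2
  simp only [Module.End.mul_apply] at e1 e2
  rw [Equiv.Perm.mul_apply, e1, hf, e2]

theorem Matches.surgery_apply {l : List (Fin m)} {f : KMod ℚ m 0} (hf : Matches l f) (x y : Fin m) :
    (surgVec x - surgVec y) f = ((-1 : ℚ) ^ l.length) • ((raise (.inl x) f - raise (.inl y) f) +
      (1 / 2 : ℚ) • (lower (.inl x) f - lower (.inl y) f)) := by
  have e : (-1 : ℚ) ^ m * (-1) ^ (m + l.length) = (-1) ^ l.length := by
    rw [pow_add, ← mul_assoc, neg_one_pow_mul_self, one_mul]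
  rw [← e]
  simp only [surgVec, LinearMap.sub_apply, LinearMap.smul_apply, Module.End.mul_apply, hf.parity, cliff,
    LinearMap.add_apply, map_smul]
  module

theorem Matches.parity_surgery {l l' : List (Fin m)} {f : KMod ℚ m 0} (hf : Matches l f) (x y : Fin m)
    (h : (-1 : ℚ) ^ l'.length = -(-1) ^ l.length) :
    parityOp ℚ m 0 ((surgVec x - surgVec y) f) =
      ((-1 : ℚ) ^ (m + l'.length)) • (surgVec x - surgVec y) f := by
  have e : parityOp ℚ m 0 * (surgVec x - surgVec y) =
      -((surgVec x - surgVec y) * parityOp ℚ m 0) := by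
    rw [mul_sub, sub_mul, parityOp_surgVec, parityOp_surgVec, ← neg_sub']
  have e1 := congrArg (fun F : KEnd ℚ m 0 => F f) e
  simp only [Module.End.mul_apply, LinearMap.neg_apply, hf.parity, map_smul] at e1
  rw [e1, pow_add, pow_add, h]
  module

/-- The top coefficient does not depend on the marks which represent the circles. -/
theorem topCoeff_eq_of_forall₂ {π : Equiv.Perm (Fin m)} {f : KMod ℚ m 0} (hf : IsState π f) {e : ℤ}
    (he : DegLE e f) {l l₁ : List (Fin m)} (h : List.Forall₂ π.SameCycle l l₁)
    (hl : e + l.length ≤ m) : topCoeff l f = topCoeff l₁ f := by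
  have key : DegLE (e + l.length - 2) (raiseProd l f - raiseProd l₁ f) := by
    clear hl
    induction h with
    | nil => simpa using DegLE.zero
    | @cons x y l l₁ hxy h ih =>
      have h1 := (ih.raise (.inl x))
      have h2 := ((hf.degLE_sub he hxy).raiseProd l₁).smul ((-1) ^ l₁.length)
      have hx := congrArg (fun F : KEnd ℚ m 0 => F f) (raise_mul_raiseProd x l₁)
      have hy := congrArg (fun F : KEnd ℚ m 0 => F f) (raise_mul_raiseProd y l₁)
      simp only [Module.End.mul_apply, LinearMap.smul_apply] at hx hy
      have e3 : raiseProd (x :: l) f - raiseProd (y :: l₁) f =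
          raise (.inl x) (raiseProd l f - raiseProd l₁ f) +
            ((-1 : ℚ) ^ l₁.length) • raiseProd l₁ (raise (.inl x) f - raise (.inl y) f) := by
        rw [raiseProd_cons, raiseProd_cons, Module.End.mul_apply, Module.End.mul_apply, map_sub, map_sub,
          smul_sub, ← hx, ← hy]
        abel
      rw [e3]
      have hlen := h.length_eq
      exact (h1.mono (by simp only [List.length_cons]; push_cast; omega)).add
        (h2.mono (by simp only [List.length_cons]; push_cast; omega))
  by_contra hc
  have := key Finset.univ (sub_ne_zero.2 hc)
  rw [Finset.card_univ] at this
  simp at this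
  omega

theorem topCoeff_add (l : List (Fin m)) (f g : KMod ℚ m 0) :
    topCoeff l (f + g) = topCoeff l f + topCoeff l g := by
  simp [topCoeff]

theorem topCoeff_sub (l : List (Fin m)) (f g : KMod ℚ m 0) :
    topCoeff l (f - g) = topCoeff l f - topCoeff l g := by
  simp [topCoeff]

theorem topCoeff_smul (l : List (Fin m)) (c : ℚ) (f : KMod ℚ m 0) :
    topCoeff l (c • f) = c * topCoeff l f := by
  simp [topCoeff]

theorem topCoeff_raise (l : List (Fin m)) (x : Fin m) (f : KMod ℚ m 0) :
    topCoeff l (raise (.inl x) f) = (-1) ^ l.length * topCoeff (x :: l) f := by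
  have h := congrArg (fun F : KEnd ℚ m 0 => F f Finset.univ) (raise_mul_raiseProd x l)
  simp only [Module.End.mul_apply, LinearMap.smul_apply, Pi.smul_apply, smul_eq_mul] at h
  rw [topCoeff, topCoeff, raiseProd_cons, Module.End.mul_apply, h, ← mul_assoc, neg_one_pow_mul_self,
    one_mul]

theorem topCoeff_swap (u v : List (Fin m)) (x y : Fin m) (f : KMod ℚ m 0) :
    topCoeff (u ++ x :: y :: v) f = -topCoeff (u ++ y :: x :: v) f := by
  have h : raiseProd (u ++ x :: y :: v) = -raiseProd (u ++ y :: x :: v) := by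
    have e (u v : List (Fin m)) : raiseProd (u ++ v) = raiseProd u * raiseProd v := by
      simp [raiseProd]
    rw [e, e, raiseProd_cons, raiseProd_cons, raiseProd_cons, raiseProd_cons, ← mul_assoc (raise _),
      raise_raise, neg_mul, mul_assoc, mul_neg]
  rw [topCoeff, topCoeff, h, LinearMap.neg_apply, Pi.neg_apply]

theorem topCoeff_same (l : List (Fin m)) (x : Fin m) (f : KMod ℚ m 0) :
    topCoeff (x :: x :: l) f = 0 := by
  have := topCoeff_swap [] l x x f
  simp only [List.nil_append] at this
  linarith

theorem topCoeff_merge {f : KMod ℚ m 0} {x y : Fin m} {r : List (Fin m)}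
    (h : Matches (y :: x :: r) f) :
    topCoeff (x :: r) ((surgVec x - surgVec y) f) = topCoeff (y :: x :: r) f := by
  have hd (z : Fin m) : topCoeff (x :: r) (lower (.inl z) f) = 0 :=
    (h.deg.lower (.inl z)).topCoeff_eq_zero _ (by simp only [List.length_cons]; push_cast; omega)
  have hs : (-1 : ℚ) ^ r.length * (-1) ^ r.length = 1 := neg_one_pow_mul_self _
  rw [h.surgery_apply]
  simp only [topCoeff_add, topCoeff_sub, topCoeff_smul, topCoeff_raise, hd, topCoeff_same,
    List.length_cons, pow_succ]
  linear_combination topCoeff (y :: x :: r) f * hs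

theorem topCoeff_split {π : Equiv.Perm (Fin m)} {f : KMod ℚ m 0} {x y : Fin m} {r : List (Fin m)}
    (h : Matches (x :: r) f) (hf : IsState π f) (hxy : x ≠ y) (hc : π.SameCycle x y) :
    topCoeff (x :: y :: r) ((surgVec x - surgVec y) f) = topCoeff (x :: r) f := by
  have hs : (-1 : ℚ) ^ r.length * (-1) ^ r.length = 1 := neg_one_pow_mul_self _
  have contract {a b : Fin m} (hab : a ≠ b) (hcab : π.SameCycle a b) :
      topCoeff (a :: b :: r) (lower (.inl a) f) = -(-1) ^ r.length * topCoeff (b :: r) f := by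
    have e1 := topCoeff_raise (b :: r) a (lower (.inl a) f)
    have e2 : raise (.inl a) (lower (.inl a) f) = f - lower (.inl a) (raise (.inl a) f) := by
      have := congrArg (fun F : KEnd ℚ m 0 => F f) (lower_raise_self (R := ℚ) (.inl a : Row m 0))
      simp only [Module.End.mul_apply, LinearMap.sub_apply, Module.End.one_apply] at this
      rw [this]; abel
    -- Modulo terms of low degree, `θ_a f` may be replaced by `θ_b f`, and `θ_b² = 0`.
    have e3 : topCoeff (b :: r) (lower (.inl a) (raise (.inl a) f)) = 0 := by
      have h1 : topCoeff (b :: r) (lower (.inl a) (raise (.inl a) f - raise (.inl b) f)) = 0 :=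
        ((hf.degLE_sub h.deg hcab).lower _).topCoeff_eq_zero _
          (by simp only [List.length_cons]; push_cast; omega)
      have h2 : lower (.inl a) (raise (.inl b) f) = -raise (.inl b) (lower (.inl a) f) := by
        have := congrArg (fun F : KEnd ℚ m 0 => F f)
          (lower_raise (R := ℚ) (show (.inl a : Row m 0) ≠ .inl b by simpa using hab))
        simpa only [Module.End.mul_apply, LinearMap.neg_apply] using this
      rw [map_sub, topCoeff_sub, h2, ← neg_one_smul ℚ, topCoeff_smul, topCoeff_raise,
        topCoeff_same] at h1
      linarith
    rw [e2, topCoeff_sub, e3, List.length_cons, pow_succ] at e1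
    linear_combination (-topCoeff (a :: b :: r) (lower (.inl a) f)) * hs + (-1) ^ r.length * e1
  have c1 := contract hxy hc
  have c2 := contract hxy.symm hc.symm
  have c3 := topCoeff_swap [] r x y (lower (.inl y) f)
  have c4 : topCoeff (y :: r) f = topCoeff (x :: r) f :=
    (topCoeff_eq_of_forall₂ hf h.deg (.cons hc (List.forall₂_same.2 fun z _ => .refl _ _))
      (by simp only [List.length_cons]; push_cast; omega)).symm
  have c5 : topCoeff (y :: x :: y :: r) f = 0 := by
    have := topCoeff_swap [] (y :: r) y x f
    have h' := topCoeff_swap [x] r y y f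
    simp only [List.nil_append, List.cons_append] at this h'
    linarith
  simp only [List.nil_append] at c3
  rw [h.surgery_apply]
  simp only [topCoeff_add, topCoeff_sub, topCoeff_smul, topCoeff_raise, c1, c2, c3, c4, c5, topCoeff_same,
    List.length_cons, pow_succ]
  linear_combination topCoeff (x :: r) f * hs

/-- The sign of a sequence of surgeries is read off from the top coefficients of states. -/
theorem Turn.transport {π : Equiv.Perm (Fin m)} {l l' : List (Fin m)} {w : List (Fin m × Fin m)} {ε : ℤ}
    (h : Turn π l w l' ε) {f : KMod ℚ m 0} (hf : IsState π f) (hl : Matches l f) :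
    IsState (wordPerm π w) (wordOp w f) ∧ Matches l' (wordOp w f) ∧
      topCoeff l' (wordOp w f) = ε * topCoeff l f := by
  induction h generalizing f with
  | nil => exact ⟨hf, hl, by simp [wordOp]⟩
  | rep h _ ih =>
    have e := h.length_eq
    obtain ⟨h1, h2, h3⟩ := ih hf ⟨e ▸ hl.deg, e ▸ hl.parity⟩
    refine ⟨h1, h2, ?_⟩
    rw [h3, topCoeff_eq_of_forall₂ hf hl.deg h (by omega)]
  | @exch π u x y v w l' ε _ ih =>
    have e : (u ++ x :: y :: v).length = (u ++ y :: x :: v).length := by simp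
    obtain ⟨h1, h2, h3⟩ := ih hf ⟨e ▸ hl.deg, e ▸ hl.parity⟩
    refine ⟨h1, h2, ?_⟩
    rw [h3, topCoeff_swap]
    push_cast
    ring
  | @merge π x y r w l' ε hc _ ih =>
    have hxy : x ≠ y := fun h => hc (h ▸ .refl _ _)
    have hm : Matches (x :: r) ((surgVec x - surgVec y) f) := by
      refine ⟨?_, hl.parity_surgery x y (by simp only [List.length_cons, pow_succ]; ring)⟩
      rw [hl.surgery_apply]
      refine (((hl.deg.raise _).sub (hl.deg.raise _)).add
        (((hl.deg.lower _).sub (hl.deg.lower _)).mono (by omega) |>.smul _)).smul _ |>.mono ?_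
      simp only [List.length_cons]; push_cast; omega
    obtain ⟨h1, h2, h3⟩ := ih (hf.surgery hxy) hm
    exact ⟨h1, h2, by rw [wordOp, Module.End.mul_apply, h3, topCoeff_merge hl]⟩
  | @split π x y r w l' ε hxy hc _ ih =>
    have hm : Matches (x :: y :: r) ((surgVec x - surgVec y) f) := by
      refine ⟨?_, hl.parity_surgery x y (by simp only [List.length_cons, pow_succ]; ring)⟩
      rw [hl.surgery_apply]
      refine ((hf.degLE_sub hl.deg hc).add (((hl.deg.lower _).sub (hl.deg.lower _)).smul _)).smul _
        |>.mono ?_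
      simp only [List.length_cons]; push_cast; omega
    obtain ⟨h1, h2, h3⟩ := ih (hf.surgery hxy) hm
    exact ⟨h1, h2, by rw [wordOp, Module.End.mul_apply, h3, topCoeff_split hl hf hxy hc]⟩

end States

/-! ### Cycles after a surgery, and existence of signs -/

section Cycles

variable {α : Type*} [DecidableEq α] {π : Equiv.Perm α} {x y : α}

theorem mul_swap_apply_of_ne {z : α} (hx : z ≠ x) (hy : z ≠ y) : (π * Equiv.swap x y) z = π z := by
  rw [Equiv.Perm.mul_apply, Equiv.swap_apply_of_ne_of_ne hx hy]

variable [Finite α]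

/-- A surgery does not affect the other cycles. -/
theorem sameCycle_mul_swap_iff {a b : α} (hx : ¬ π.SameCycle a x) (hy : ¬ π.SameCycle a y) :
    (π * Equiv.swap x y).SameCycle a b ↔ π.SameCycle a b := by
  have e (n : ℕ) : ((π * Equiv.swap x y) ^ n) a = (π ^ n) a := by
    induction n with
    | zero => rfl
    | succ n ih =>
      have h1 : (π ^ n) a ≠ x := fun h => hx ⟨n, by rw [zpow_natCast, h]⟩
      have h2 : (π ^ n) a ≠ y := fun h => hy ⟨n, by rw [zpow_natCast, h]⟩
      rw [pow_succ', Equiv.Perm.mul_apply, ih, mul_swap_apply_of_ne h1 h2, pow_succ' π,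
        Equiv.Perm.mul_apply]
  constructor <;> intro h <;> obtain ⟨n, -, hn⟩ := h.exists_pow_eq'
  · exact ⟨n, by rw [zpow_natCast, ← e, hn]⟩
  · exact ⟨n, by rw [zpow_natCast, e, hn]⟩

/-- A point of a cycle in which a surgery takes place stays with one of the two marks. -/
theorem sameCycle_mul_swap_or {a : α} (h : π.SameCycle a x) :
    (π * Equiv.swap x y).SameCycle a x ∨ (π * Equiv.swap x y).SameCycle a y := by
  obtain ⟨n, -, hn⟩ := h.exists_pow_eq'
  clear h
  induction n generalizing a with
  | zero => exact .inl (by rw [← hn]; exact .refl _ _)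
  | succ n ih =>
    by_cases hx : a = x
    · exact .inl (hx ▸ .refl _ _)
    by_cases hy : a = y
    · exact .inr (hy ▸ .refl _ _)
    rw [pow_succ, Equiv.Perm.mul_apply] at hn
    rw [← mul_swap_apply_of_ne hx hy] at hn
    exact (ih hn).imp Equiv.Perm.sameCycle_apply_left.1 Equiv.Perm.sameCycle_apply_left.1

/-- A surgery between different cycles merges them. -/
theorem sameCycle_mul_swap_of_not (h : ¬ π.SameCycle x y) : (π * Equiv.swap x y).SameCycle x y := by
  have key : ∀ (n : ℕ) (a : α), (π ^ n) a = y → (π * Equiv.swap x y).SameCycle a y := by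
    intro n
    induction n with
    | zero => rintro a rfl; exact .refl _ _
    | succ n ih =>
      intro a ha
      by_cases hy : a = y
      · exact hy ▸ .refl _ _
      by_cases hx : a = x
      · exact absurd ⟨(n + 1 : ℕ), by rw [zpow_natCast, ← hx, ha]⟩ h
      rw [pow_succ, Equiv.Perm.mul_apply] at ha
      have := ih _ ha
      rw [← mul_swap_apply_of_ne hx hy] at this
      exact Equiv.Perm.sameCycle_apply_left.1 this
  have h1 : π.SameCycle (π y) y := Equiv.Perm.sameCycle_apply_left.2 (.refl _ _)
  obtain ⟨n, -, hn⟩ := h1.exists_pow_eq'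
  have h2 := key n _ hn
  have h3 : (π * Equiv.swap x y) x = π y := by simp
  rw [← h3] at h2
  exact Equiv.Perm.sameCycle_apply_left.1 h2

/-- A surgery within a cycle splits it. -/
theorem not_sameCycle_mul_swap (hxy : x ≠ y) (h : π.SameCycle x y) :
    ¬ (π * Equiv.swap x y).SameCycle x y := by
  classical
  obtain ⟨n, -, hn⟩ := h.symm.exists_pow_eq'
  have hex : ∃ n, (π ^ n) y = x := ⟨n, hn⟩
  -- The cycle of `x` after the surgery is the part of the old cycle from `π y` to `x`.
  let N := Nat.find hex
  have hN : (π ^ N) y = x := Nat.find_spec hex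
  have hmin (j : ℕ) (hj : j < N) : (π ^ j) y ≠ x := Nat.find_min hex hj
  have hN0 : N ≠ 0 := fun h0 => hxy (by rw [← hN, h0]; rfl)
  have hne (j : ℕ) (h1 : 1 ≤ j) (h2 : j < N) : (π ^ j) y ≠ y := by
    intro e
    apply hmin (N - j) (by omega)
    have : N = (N - j) + j := by omega
    rw [this, pow_add, Equiv.Perm.mul_apply, e] at hN
    exact hN
  have closed (n : ℕ) : ∃ j, 1 ≤ j ∧ j ≤ N ∧ ((π * Equiv.swap x y) ^ n) x = (π ^ j) y := by
    induction n with
    | zero => exact ⟨N, by omega, le_rfl, hN.symm⟩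
    | succ n ih =>
      obtain ⟨j, h1, h2, e⟩ := ih
      rw [pow_succ', Equiv.Perm.mul_apply, e]
      rcases h2.lt_or_eq with h2 | rfl
      · exact ⟨j + 1, by omega, by omega, by
          rw [mul_swap_apply_of_ne (hmin j h2) (hne j h1 h2), pow_succ', Equiv.Perm.mul_apply]⟩
      · exact ⟨1, le_rfl, by omega, by rw [hN]; simp⟩
  intro hc
  obtain ⟨n, -, hn⟩ := hc.exists_pow_eq'
  obtain ⟨j, h1, h2, e⟩ := closed n
  rw [hn] at e
  rcases h2.lt_or_eq with h2 | rfl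
  · exact hne j h1 h2 e.symm
  · exact hxy (hN.symm.trans e.symm)

end Cycles

section Lists

variable {m : ℕ}

/-- The list contains exactly one mark of each cycle. -/
structure ListsCycles (π : Equiv.Perm (Fin m)) (l : List (Fin m)) : Prop where
  distinct : l.Pairwise fun x y => ¬ π.SameCycle x y
  complete : ∀ x, ∃ y ∈ l, π.SameCycle x y

theorem ListsCycles.perm {π : Equiv.Perm (Fin m)} {l l' : List (Fin m)} (h : ListsCycles π l)
    (hl : l.Perm l') : ListsCycles π l' where
  distinct := h.distinct.perm hl fun h h' => h h'.symm
  complete x := let ⟨y, hy, e⟩ := h.complete x; ⟨y, hl.subset hy, e⟩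

theorem ListsCycles.replace {π : Equiv.Perm (Fin m)} {x y : Fin m} {u v : List (Fin m)}
    (h : ListsCycles π (u ++ x :: v)) (hxy : π.SameCycle x y) : ListsCycles π (u ++ y :: v) where
  distinct := by
    have := h.distinct
    simp only [List.pairwise_append, List.pairwise_cons, List.mem_cons, forall_eq_or_imp] at this ⊢
    refine ⟨this.1, ⟨fun a ha h' => this.2.1.1 a ha (hxy.trans h'), this.2.1.2⟩,
      fun a ha => ⟨fun h' => ?_, ?_⟩⟩
    · exact (this.2.2 a ha).1 (h'.trans hxy.symm)
    · exact (this.2.2 a ha).2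
  complete z := by
    obtain ⟨c, hc, e⟩ := h.complete z
    simp only [List.mem_append, List.mem_cons] at hc
    rcases hc with hc | rfl | hc
    · exact ⟨c, by simp [hc], e⟩
    · exact ⟨y, by simp, e.trans hxy⟩
    · exact ⟨c, by simp [hc], e⟩

theorem Turn.of_perm {π : Equiv.Perm (Fin m)} {l l₁ l' : List (Fin m)} {w : List (Fin m × Fin m)}
    (h : l.Perm l₁) {ε : ℤ} (ht : Turn π l₁ w l' ε) : ∃ ε', Turn π l w l' ε' := by
  suffices ∀ u, (∃ ε, Turn π (u ++ l₁) w l' ε) → ∃ ε, Turn π (u ++ l) w l' ε from this [] ⟨ε, ht⟩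
  clear ht
  induction h with
  | nil => exact fun _ h => h
  | cons x _ ih =>
    intro u h
    have := ih (u ++ [x])
    simp only [List.append_assoc, List.singleton_append] at this
    exact this h
  | swap x y l =>
    rintro u ⟨ε, h⟩
    exact ⟨_, h.exch⟩
  | trans _ _ ih₁ ih₂ => exact fun u h => ih₁ u (ih₂ u h)

theorem Turn.sign_ne_zero {π : Equiv.Perm (Fin m)} {l l' : List (Fin m)} {w : List (Fin m × Fin m)}
    {ε : ℤ} (h : Turn π l w l' ε) : ε ≠ 0 := by
  induction h with
  | nil => exact one_ne_zero
  | exch _ ih => exact neg_ne_zero.2 ih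
  | rep _ _ ih | merge _ _ ih | split _ _ _ ih => exact ih

theorem ListsCycles.exists_cons {π : Equiv.Perm (Fin m)} {l : List (Fin m)} (h : ListsCycles π l)
    (x : Fin m) : ∃ x' r, l.Perm (x' :: r) ∧ π.SameCycle x' x ∧ ListsCycles π (x :: r) := by
  obtain ⟨x', hx', e⟩ := h.complete x
  have hp := List.perm_cons_erase hx'
  exact ⟨x', l.erase x', hp, e.symm, (h.perm hp).replace (u := []) e.symm⟩

theorem ListsCycles.merge {π : Equiv.Perm (Fin m)} {x y : Fin m} {r : List (Fin m)}
    (h : ListsCycles π (y :: x :: r)) : ListsCycles (π * Equiv.swap x y) (x :: r) := by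
  have hd := h.distinct
  simp only [List.pairwise_cons, List.mem_cons, forall_eq_or_imp] at hd
  obtain ⟨⟨hyx, hy⟩, hx, hr⟩ := hd
  have far {a b} (ha : a ∈ r) : (π * Equiv.swap x y).SameCycle a b ↔ π.SameCycle a b :=
    sameCycle_mul_swap_iff (fun h => hx a ha h.symm) fun h => hy a ha h.symm
  have hm := sameCycle_mul_swap_of_not (π := π) (x := x) (y := y) fun h => hyx h.symm
  refine ⟨List.pairwise_cons.2 ⟨fun a ha h' => hx a ha ((far ha).1 h'.symm).symm, ?_⟩, fun z => ?_⟩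
  · exact hr.imp_of_mem fun ha _ hab h' => hab ((far ha).1 h')
  · obtain ⟨c, hc, e⟩ := h.complete z
    simp only [List.mem_cons] at hc
    rcases hc with rfl | rfl | hc
    · rw [Equiv.swap_comm] at hm ⊢
      exact ⟨x, by simp, (sameCycle_mul_swap_or e).elim (fun h => h.trans hm.symm) id⟩
    · exact ⟨c, by simp, (sameCycle_mul_swap_or e).elim id fun h => h.trans hm.symm⟩
    · exact ⟨c, by simp [hc], ((far hc).2 e.symm).symm⟩

theorem ListsCycles.split {π : Equiv.Perm (Fin m)} {x y : Fin m} {r : List (Fin m)} (hxy : x ≠ y)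
    (hc : π.SameCycle x y) (h : ListsCycles π (x :: r)) :
    ListsCycles (π * Equiv.swap x y) (x :: y :: r) := by
  have hd := h.distinct
  simp only [List.pairwise_cons] at hd
  obtain ⟨hx, hr⟩ := hd
  have far {a b} (ha : a ∈ r) : (π * Equiv.swap x y).SameCycle a b ↔ π.SameCycle a b :=
    sameCycle_mul_swap_iff (fun h => hx a ha h.symm) fun h => hx a ha (hc.trans h.symm)
  have hm := not_sameCycle_mul_swap hxy hc
  refine ⟨?_, fun z => ?_⟩
  · simp only [List.pairwise_cons, List.mem_cons, forall_eq_or_imp]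
    refine ⟨⟨hm, fun a ha h' => hx a ha ((far ha).1 h'.symm).symm⟩,
      fun a ha h' => hx a ha (hc.trans ((far ha).1 h'.symm).symm),
      hr.imp_of_mem fun ha _ hab h' => hab ((far ha).1 h')⟩
  · obtain ⟨c, hc', e⟩ := h.complete z
    simp only [List.mem_cons] at hc'
    rcases hc' with rfl | hc'
    · exact (sameCycle_mul_swap_or e).elim (fun h => ⟨c, by simp, h⟩) fun h => ⟨y, by simp, h⟩
    · exact ⟨c, by simp [hc'], ((far hc').2 e.symm).symm⟩

/-- Every sequence of surgeries takes a list of the circles to some list of the new circles. -/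
theorem ListsCycles.exists_turn {w : List (Fin m × Fin m)} (hw : ∀ p ∈ w, p.1 ≠ p.2)
    {π : Equiv.Perm (Fin m)} {l : List (Fin m)} (h : ListsCycles π l) :
    ∃ l' ε, Turn π l w l' ε ∧ ListsCycles (wordPerm π w) l' := by
  induction w generalizing π l with
  | nil => exact ⟨l, 1, .nil π l, h⟩
  | cons p w ih =>
    obtain ⟨x, y⟩ := p
    have hxy : x ≠ y := hw (x, y) (by simp)
    have hw' : ∀ p ∈ w, p.1 ≠ p.2 := fun p hp => hw p (by simp [hp])
    have refl (r : List (Fin m)) : List.Forall₂ π.SameCycle r r :=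
      List.forall₂_same.2 fun z _ => .refl _ _
    obtain ⟨x', r, hp, hx', hr⟩ := h.exists_cons x
    by_cases hc : π.SameCycle x y
    · obtain ⟨l', ε, ht, hl'⟩ := ih hw' (hr.split hxy hc)
      obtain ⟨ε', ht'⟩ := Turn.of_perm hp (.rep (.cons hx' (refl r)) (.split hxy hc ht))
      exact ⟨l', ε', ht', hl'⟩
    · obtain ⟨y', hy', e⟩ := hr.complete y
      have hy'r : y' ∈ r := by
        rcases List.mem_cons.1 hy' with rfl | h'
        · exact absurd e.symm hc
        · exact h'
      have hp' := List.perm_cons_erase hy'r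
      have hr' := hr.perm ((hp'.cons x).trans (List.Perm.swap _ _ _))
      have hr'' := hr'.replace (u := []) e.symm
      obtain ⟨l', ε, ht, hl'⟩ := ih hw' hr''.merge
      have ht' : Turn π (y' :: x' :: r.erase y') ((x, y) :: w) l' ε :=
        .rep (.cons e.symm (.cons hx' (refl _))) (.merge hc ht)
      obtain ⟨ε', ht''⟩ := Turn.of_perm (hp.trans ((hp'.cons x').trans (List.Perm.swap _ _ _))) ht'
      exact ⟨l', ε', ht'', hl'⟩

/-- Any two lists of the same circles are related by a sign. -/
theorem ListsCycles.exists_relist {π : Equiv.Perm (Fin m)} {l l₁ : List (Fin m)} (h : ListsCycles π l)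
    (h₁ : ListsCycles π l₁) : ∃ ε, Turn π l [] l₁ ε := by
  have key : ∀ l₁ l : List (Fin m), (l.Pairwise fun x y => ¬ π.SameCycle x y) →
      (l₁.Pairwise fun x y => ¬ π.SameCycle x y) → (∀ x ∈ l, ∃ y ∈ l₁, π.SameCycle x y) →
      (∀ y ∈ l₁, ∃ x ∈ l, π.SameCycle y x) → ∃ l₂, l.Perm l₂ ∧ List.Forall₂ π.SameCycle l₂ l₁ := by
    intro l₁
    induction l₁ with
    | nil =>
      intro l _ _ h _
      rcases l with - | ⟨x, l⟩
      · exact ⟨[], .refl _, .nil⟩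
      · obtain ⟨y, hy, -⟩ := h x (by simp)
        simp at hy
    | cons c l₁ ih =>
      intro l hl hl₁ h h'
      obtain ⟨c', hc', e⟩ := h' c (by simp)
      have hp := List.perm_cons_erase hc'
      have hd := List.pairwise_cons.1 (hl.perm hp fun h h' => h h'.symm)
      have hd₁ := List.pairwise_cons.1 hl₁
      obtain ⟨l₂, hp₂, hf⟩ := ih (l.erase c') hd.2 hd₁.2
        (fun x hx => by
          obtain ⟨y, hy, hxy⟩ := h x (List.mem_of_mem_erase hx)
          rcases List.mem_cons.1 hy with rfl | hy
          · exact absurd (hxy.trans e).symm (hd.1 x hx)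
          · exact ⟨y, hy, hxy⟩)
        (fun y hy => by
          obtain ⟨x, hx, hyx⟩ := h' y (by simp [hy])
          rcases List.mem_cons.1 (hp.subset hx) with rfl | hx
          · exact absurd (e.trans hyx.symm) (hd₁.1 y hy)
          · exact ⟨x, hx, hyx⟩)
      exact ⟨c' :: l₂, hp.trans (hp₂.cons c'), .cons e.symm hf⟩
  obtain ⟨l₂, hp, hf⟩ := key l₁ l h.distinct h₁.distinct (fun x _ => h₁.complete x)
    fun y _ => h.complete y
  exact Turn.of_perm hp (.rep hf (.nil π l₁))

/-- Every list of circles is seen by a state. -/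
theorem ListsCycles.exists_state {π : Equiv.Perm (Fin m)} {l : List (Fin m)} (h : ListsCycles π l) :
    ∃ f, IsState π f ∧ Matches l f ∧ topCoeff l f ≠ 0 := by
  -- It suffices to find a state for one list.
  suffices H : ∃ l f, ListsCycles π l ∧ IsState π f ∧ Matches l f ∧ topCoeff l f ≠ 0 by
    obtain ⟨l₀, f, h₀, hf, hm, hc⟩ := H
    obtain ⟨ε, ht⟩ := h₀.exists_relist h
    obtain ⟨h1, h2, h3⟩ := ht.transport hf hm
    exact ⟨f, h1, h2, by
      rw [show wordOp [] f = f from rfl] at h3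
      rw [h3]
      exact mul_ne_zero (Int.cast_ne_zero.2 ht.sign_ne_zero) hc⟩
  clear h l
  induction π using Equiv.Perm.swap_induction_on' with
  | one =>
    refine ⟨List.finRange m, Pi.single ∅ 1, ⟨?_, fun x => ⟨x, List.mem_finRange x, .refl _ _⟩⟩, ?_,
      ⟨?_, ?_⟩, ?_⟩
    · exact (List.nodup_finRange m).imp fun h => by simpa using h
    · have hl (x : Fin m) : lower (.inl x) (Pi.single ∅ 1 : KMod ℚ m 0) = 0 := by
        funext S
        rw [lower_apply]
        simp
      intro x
      simp only [cliff, LinearMap.add_apply, LinearMap.smul_apply, hl, smul_zero, Equiv.Perm.one_apply]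
    · intro S hS
      obtain rfl : S = ∅ := by
        by_contra h
        exact hS (by simp [h])
      simp
    · funext S
      rw [parityOp_apply]
      by_cases h : S = ∅ <;> simp [h]
    · have key (l : List (Fin m)) (hl : l.Nodup) :
          raiseProd l (Pi.single ∅ 1 : KMod ℚ m 0) (l.map Sum.inl).toFinset ≠ 0 := by
        induction l with
        | nil => simp [raiseProd]
        | cons x l ih =>
          obtain ⟨hx, hl⟩ := List.nodup_cons.1 hl
          have hx' : (Sum.inl x : Row m 0) ∉ (l.map Sum.inl).toFinset := by simpa using hx
          rw [raiseProd_cons, Module.End.mul_apply, raise_apply, List.map_cons, List.toFinset_cons,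
            if_pos (Finset.mem_insert_self _ _), Finset.erase_insert hx']
          have hk : ksign (.inl x : Row m 0) (insert (.inl x) (l.map Sum.inl).toFinset) ≠ 0 := by
            simp [ksign]
          exact smul_ne_zero hk (ih hl)
      have := key _ (List.nodup_finRange m)
      have hu : ((List.finRange m).map Sum.inl).toFinset = (Finset.univ : Finset (Row m 0)) := by
        ext i
        rcases i with i | ⟨i, -⟩
        · simp
        · exact i.elim0
      rwa [hu] at this
  | mul_swap π x y hxy ih =>
    obtain ⟨l, f, hl, hf, hm, hc⟩ := ih
    obtain ⟨l', ε, ht, hl'⟩ := hl.exists_turn (w := [(x, y)]) (by simpa using hxy)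
    obtain ⟨h1, h2, h3⟩ := ht.transport hf hm
    refine ⟨l', _, hl', h1, h2, ?_⟩
    rw [h3]
    exact mul_ne_zero (Int.cast_ne_zero.2 ht.sign_ne_zero) hc

end Lists

/-! ### Composition of homomorphisms, and the circles after a move -/

section Homs

variable {R : Type} [CommRing R] {n k : ℕ} {d d' d'' F G : KEnd R n k} {p q : ℕ}

theorem IsHom.comp (hG : IsHom d' d'' q G) (hF : IsHom d d' p F) : IsHom d d'' (q + p) (G * F) where
  parity := by
    rw [mul_assoc, hF.parity, mul_smul_comm, ← mul_assoc, hG.parity, smul_mul_assoc, smul_smul, pow_add,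
      mul_comm ((-1 : ℤ) ^ q), mul_assoc]
  comm := by
    rw [← mul_assoc, hG.comm, smul_mul_assoc, mul_assoc, hF.comm, mul_smul_comm, smul_smul, pow_add,
      mul_assoc]

theorem IsHom.zsmul (hF : IsHom d d' p F) (ε : ℤ) : IsHom d d' p (ε • F) where
  parity := by rw [smul_mul_assoc, hF.parity, mul_smul_comm, smul_comm]
  comm := by rw [smul_mul_assoc, mul_smul_comm, hF.comm, smul_comm]

theorem IsHom.id (d : KEnd R n k) : IsHom d d 0 1 where
  parity := by rw [one_mul, mul_one, pow_zero, one_smul]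
  comm := by rw [one_mul, mul_one, pow_zero, one_smul]

theorem IsHom.of_pow_eq (hF : IsHom d d' p F) (h : (-1 : ℤ) ^ p = (-1) ^ q) : IsHom d d' q F where
  parity := by rw [hF.parity, h]
  comm := by rw [hF.comm, h]

end Homs

section Circles

variable {m n k : ℕ} (W : ClosedWeb m n k)

theorem ClosedWeb.circ_leave (σ : Equiv.Perm (Fin k)) (ρ : Fin k → Fin 3) (r : Row n k) :
    W.circ σ ρ (W.leave r) = W.enter (glue σ ρ r) := by
  simp [circ]

theorem ClosedWeb.swap_leave (r r' t : Row n k) :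
    Equiv.swap (W.leave r) (W.leave r') (W.leave t) = W.leave (Equiv.swap r r' t) :=
  (W.leave.injective.map_swap _ _ _).symm

theorem ClosedWeb.circ_saddle (s t : Fin n) (σ : Equiv.Perm (Fin k)) (ρ : Fin k → Fin 3) :
    (W.saddle s t).circ σ ρ =
      W.circ σ ρ * Equiv.swap (W.leave (.inl s)) (W.leave (.inl t)) := by
  ext x : 1
  obtain ⟨r, rfl⟩ := W.leave.surjective x
  rw [Equiv.Perm.mul_apply, swap_leave, circ_leave]
  have := (W.saddle s t).circ_leave σ ρ r
  rw [show (W.saddle s t).leave = W.leave from rfl] at this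
  rw [this]
  rcases r with e | q
  · by_cases h1 : e = s
    · subst h1; simp [saddle, glue]
    by_cases h2 : e = t
    · subst h2; simp [saddle, glue]
    have h1' : (Sum.inl e : Row n k) ≠ .inl s := by simpa using h1
    have h2' : (Sum.inl e : Row n k) ≠ .inl t := by simpa using h2
    rw [Equiv.swap_apply_of_ne_of_ne h1' h2']
    simp [saddle, glue, Equiv.swap_apply_of_ne_of_ne h1' h2']
  · rw [Equiv.swap_apply_of_ne_of_ne (by simp) (by simp)]
    simp [saddle, glue, Equiv.swap_apply_of_ne_of_ne]

theorem ClosedWeb.circ_rotate (σ : Equiv.Perm (Fin k)) (ρ : Fin k → Fin 3) (j : Fin k) :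
    W.circ σ (Function.update ρ j (ρ j + 1)) = wordPerm (W.circ σ ρ)
      [(W.leave (.inr (j, 1)), W.leave (.inr (j, 0))),
        (W.leave (.inr (j, 1)), W.leave (.inr (j, 2)))] := by
  ext x : 1
  obtain ⟨r, rfl⟩ := W.leave.surjective x
  simp only [wordPerm, Equiv.Perm.mul_apply, swap_leave, circ_leave]
  congr 1
  rcases r with e | ⟨a, i⟩
  · simp [glue, Equiv.swap_apply_of_ne_of_ne]
  · by_cases h : a = j
    · subst h
      have e0 : Equiv.swap (Sum.inr (a, 1) : Row n k) (.inr (a, 2)) (.inr (a, 0)) = .inr (a, 0) :=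
        Equiv.swap_apply_of_ne_of_ne (by simp) (by simp)
      have e2 : Equiv.swap (Sum.inr (a, 1) : Row n k) (.inr (a, 0)) (.inr (a, 2)) = .inr (a, 2) :=
        Equiv.swap_apply_of_ne_of_ne (by simp) (by simp)
      have e (ρ : Fin k → Fin 3) (i : Fin 3) : (glue σ ρ (.inr (a, i)) : Row n k) =
          .inr (σ a, i + ρ a) := rfl
      have step (i l : Fin 3) (hl : l = i + 1) (c : Fin 3) : i + (c + 1) = l + c := by
        rw [hl, add_comm c, add_assoc]
      fin_cases i
      · simp only [Fin.zero_eta, e0, Equiv.swap_apply_right, e, Function.update_self]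
        rw [step 0 1 rfl]
      · simp only [Fin.mk_one, e2, Equiv.swap_apply_left, e, Function.update_self]
        rw [step 1 2 rfl]
      · simp only [Fin.reduceFinMk, Equiv.swap_apply_right, Equiv.swap_apply_left, e,
          Function.update_self]
        rw [step 2 0 rfl]
    · have hne (l : Fin 3) : (Sum.inr (a, i) : Row n k) ≠ .inr (j, l) := by simp [h]
      rw [Equiv.swap_apply_of_ne_of_ne (hne 1) (hne 2), Equiv.swap_apply_of_ne_of_ne (hne 1) (hne 0)]
      simp [glue, Function.update_of_ne h]

theorem ClosedWeb.circ_exchange (σ : Equiv.Perm (Fin k)) (ρ : Fin k → Fin 3) (j j' : Fin k) :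
    W.circ (exchange σ j j') (ρ ∘ Equiv.swap j j') = wordPerm (W.circ σ ρ)
      [(W.leave (.inr (j, 0)), W.leave (.inr (j', 0))), (W.leave (.inr (j, 1)), W.leave (.inr (j', 1))),
       (W.leave (.inr (j, 2)), W.leave (.inr (j', 2)))] := by
  ext x : 1
  obtain ⟨r, rfl⟩ := W.leave.surjective x
  simp only [wordPerm, Equiv.Perm.mul_apply, swap_leave, circ_leave]
  congr 1
  rcases r with e | ⟨a, i⟩
  · simp [glue, Equiv.swap_apply_of_ne_of_ne]
  · have sw (l : Fin 3) (a : Fin k) (i : Fin 3) : Equiv.swap (Sum.inr (j, l) : Row n k) (.inr (j', l))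
        (.inr (a, i)) = .inr (if l = i then Equiv.swap j j' a else a, i) := by
      split_ifs with hl
      · subst hl
        exact ((show Function.Injective fun j : Fin k => (Sum.inr (j, l) : Row n k) from
          fun x y e => by simpa using e).map_swap j j' a).symm
      · exact Equiv.swap_apply_of_ne_of_ne (by simpa using fun _ e => hl e.symm)
          (by simpa using fun _ e => hl e.symm)
    fin_cases i <;> simp [sw, glue, exchange]

theorem ClosedWeb.Rep.listsCycles {W : ClosedWeb m n k} (P : W.Rep) :
    ListsCycles (W.circ P.σ P.ρ) P.circles := ⟨P.distinct, P.complete⟩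

end Circles

/-! ### The invariants of canonical identifications -/

section Invariants

variable {m n k : ℕ}

/-- Pairs of an operator on states, which records a sequence of surgeries, and a map of Koszul
factorizations after the exclusion of variables. -/
abbrev LiftRing (m n k : ℕ) := KEnd ℚ m 0 × KEnd (MarkRing m) n k

/-- The lift of the interchange of the pairs `a` and `b`. -/
def ClosedWeb.exchangeLift (W : ClosedWeb m n k) (a b : Fin k) : LiftRing m n k :=
  (tripleProd surgVec (fun j i => W.leave (.inr (j, i))) a b, (-1 : MarkRing m) ^ k • quadPsi m n a b)

/-- The lift of moving the strands of the pair `j` by one step. -/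
def ClosedWeb.rotateLift (W : ClosedWeb m n k) (j : Fin k) : LiftRing m n k :=
  (rotProd surgVec (fun j i => W.leave (.inr (j, i))) j, 1)

/-- The lift of the saddle. -/
def ClosedWeb.saddleLift (W : ClosedWeb m n k) (s t : Fin n) : LiftRing m n k :=
  (surgVec (W.leave (.inl s)) - surgVec (W.leave (.inl t)), W.eta s t)

theorem ClosedWeb.leave_inr_inj (W : ClosedWeb m n k) (a : Fin k) (i : Fin 3) (b : Fin k) (j : Fin 3)
    (h : W.leave (.inr (a, i)) = W.leave (.inr (b, j))) : a = b ∧ i = j := by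
  simpa using W.leave.injective h

theorem surgVec_sq_eq (x y : Fin m) : surgVec x * surgVec x = surgVec y * surgVec y := by
  rw [surgVec_sq, surgVec_sq]

theorem smul_mul_smul_of_sq {R : Type} [CommRing R] {c : R} (hc : c * c = 1) (x y : KEnd R n k) :
    (c • x) * (c • y) = x * y := by
  rw [smul_mul_assoc, mul_smul_comm, smul_smul, hc, one_smul]

/-- The lifts of two chains of moves with the same endpoints agree up to a common sign. -/
theorem ClosedWeb.moveLift_unique (W : ClosedWeb m n k) {σ σ' : Equiv.Perm (Fin k)}
    {ρ ρ' : Fin k → Fin 3} {h h' : LiftRing m n k}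
    (H : MoveLift W.exchangeLift W.rotateLift σ ρ σ' ρ' h)
    (H' : MoveLift W.exchangeLift W.rotateLift σ ρ σ' ρ' h') : h = h' ∨ h = -h' := by
  have hp := W.leave_inr_inj
  have hk : ((-1 : MarkRing m) ^ k) * (-1) ^ k = 1 := neg_one_pow_mul_self k
  refine MoveLift.unique (fun a b j hab => ?_) (fun a b hab => ?_) (fun a b hab => ?_)
    (fun a b c d hab hcd => ?_) (fun i j => ?_) (fun j => ?_) H H'
  · exact Prod.ext (tripleProd_mul_rotProd hp surgVec_anti surgVec_sq_eq hab j)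
      ((mul_one _).trans (one_mul _).symm)
  · exact Prod.ext (tripleProd_sq hp surgVec_anti surgVec_sq_eq surgVec_sq_add_sq hab)
      ((smul_mul_smul_of_sq hk _ _).trans (quadPsi_sq hab))
  · refine Prod.ext ?_ ?_
    · simp only [exchangeLift, Prod.fst_neg]
      rw [tripleProd_symm]
    · simp only [exchangeLift, Prod.snd_neg]
      rw [quadPsi_symm hab, smul_neg]
  · refine Prod.ext (tripleProd_conj hp surgVec_anti surgVec_sq_eq hab) ?_
    simp only [exchangeLift, Prod.snd_neg, Prod.snd_mul]
    rw [smul_mul_smul_of_sq hk, smul_mul_smul_of_sq hk, quadPsi_conj hab hcd]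
  · exact Prod.ext (rotProd_comm hp surgVec_anti surgVec_sq_eq i j) rfl
  · exact Prod.ext (rotProd_cube hp surgVec_anti surgVec_sq_eq surgVec_sq_add_sq j)
      (by simp [rotateLift])

theorem ClosedWeb.sign_exchange (σ : Equiv.Perm (Fin k)) {a b : Fin k} (h : a ≠ b) :
    Equiv.Perm.sign (exchange σ a b) = -Equiv.Perm.sign σ := by
  rw [exchange, Equiv.Perm.sign_trans, Equiv.Perm.sign_swap h, mul_neg, mul_one]

/-- The lift of the saddle commutes with lifts of moves, up to the sign of the permutation. -/
theorem MoveLift.mul_saddleLift {W : ClosedWeb m n k} {σ σ' : Equiv.Perm (Fin k)}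
    {ρ ρ' : Fin k → Fin 3} {h : LiftRing m n k}
    (H : MoveLift W.exchangeLift W.rotateLift σ ρ σ' ρ' h) {s t : Fin n} (hst : s ≠ t) :
    h * W.saddleLift s t = (((Equiv.Perm.sign σ' : ℤ) * (Equiv.Perm.sign σ : ℤ))) •
      (W.saddleLift s t * h) := by
  have hp := W.leave_inr_inj
  have hx (s : Fin n) (c : Fin k) (i : Fin 3) : W.leave (.inl s) ≠ W.leave (.inr (c, i)) :=
    W.leave.injective.ne (by simp)
  induction H with
  | refl => rw [← Units.val_mul, Int.units_mul_self, Units.val_one, one_smul, one_mul, mul_one]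
  | rotate j _ ih =>
    have e : W.rotateLift j * W.saddleLift s t = W.saddleLift s t * W.rotateLift j :=
      Prod.ext (rotProd_mul_sub_other hp surgVec_anti surgVec_sq_eq j (hx s) (hx t))
        ((one_mul _).trans (mul_one _).symm)
    rw [mul_assoc, ih, mul_smul_comm, ← mul_assoc, e, mul_assoc]
  | exchange a b hab _ ih =>
    have e : W.exchangeLift a b * W.saddleLift s t = -(W.saddleLift s t * W.exchangeLift a b) := by
      refine Prod.ext (tripleProd_mul_sub_other hp surgVec_anti surgVec_sq_eq hab (hx s) (hx t)) ?_
      simp only [ClosedWeb.exchangeLift, ClosedWeb.saddleLift, Prod.snd_neg, Prod.snd_mul]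
      rw [smul_mul_assoc, quadPsi_eta W hst hab, mul_smul_comm, smul_neg]
    rw [mul_assoc, ih, mul_smul_comm, ← mul_assoc, e, ClosedWeb.sign_exchange _ hab, neg_mul, mul_assoc,
      Units.val_neg, neg_mul, neg_smul, smul_neg]

/-- The operator `T` takes the states seen by the representative `P` to those seen by `Q`, with
the sign `ε`. -/
def Transports {W W' : ClosedWeb m n k} (P : W.Rep) (Q : W'.Rep) (T : KEnd ℚ m 0) (ε : ℤ) : Prop :=
  ∀ f, IsState (W.circ P.σ P.ρ) f → Matches P.circles f →
    IsState (W'.circ Q.σ Q.ρ) (T f) ∧ Matches Q.circles (T f) ∧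
      topCoeff Q.circles (T f) = ε * topCoeff P.circles f

theorem Transports.comp {W W' W'' : ClosedWeb m n k} {P : W.Rep} {Q : W'.Rep} {Q' : W''.Rep}
    {T T' : KEnd ℚ m 0} {ε ε' : ℤ} (h' : Transports Q Q' T' ε') (h : Transports P Q T ε) :
    Transports P Q' (T' * T) (ε' * ε) := by
  intro f hf hm
  obtain ⟨h1, h2, h3⟩ := h f hf hm
  obtain ⟨h4, h5, h6⟩ := h' _ h1 h2
  exact ⟨h4, h5, by rw [Module.End.mul_apply, h6, h3]; push_cast; ring⟩

theorem Turn.transports {W W' : ClosedWeb m n k} {P : W.Rep} {Q : W'.Rep} {w : List (Fin m × Fin m)}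
    {ε : ℤ} (h : Turn (W.circ P.σ P.ρ) P.circles w Q.circles ε)
    (hQ : W'.circ Q.σ Q.ρ = wordPerm (W.circ P.σ P.ρ) w) : Transports P Q (wordOp w) ε := by
  intro f hf hm
  rw [hQ]
  exact h.transport hf hm

/-- The sign with which an operator transports states is determined. -/
theorem Transports.unique {W W' : ClosedWeb m n k} {P : W.Rep} {Q : W'.Rep} {T : KEnd ℚ m 0}
    {ε ε' c : ℤ} (h : Transports P Q (c • T) ε) (h' : Transports P Q T ε') : ε = c * ε' := by
  obtain ⟨f, hf, hm, h0⟩ := P.listsCycles.exists_state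
  have e := (h f hf hm).2.2
  have e' := (h' f hf hm).2.2
  rw [LinearMap.smul_apply, ← Int.cast_smul_eq_zsmul ℚ, topCoeff_smul, e', ← mul_assoc] at e
  exact_mod_cast (mul_right_cancel₀ h0 e).symm

/-- What is preserved by compositions of canonical identifications: the map `A` is, after the
exclusion of variables, the second component of a lift of a chain of moves, with the same sign with
which the first component transports the list of circles. -/
theorem ClosedWeb.Ident.exists_lift {W : ClosedWeb m n k} {P Q : W.Rep} {A : KEnd (MarkRing m) n k}
    (hA : W.Ident P Q A) : ∃ (p : ℕ) (h : LiftRing m n k) (ε : ℤ),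
      IsHom (W.d P.σ) (W.d Q.σ) p A ∧
      (Equiv.Perm.sign Q.σ : ℤ) = (-1) ^ p * (Equiv.Perm.sign P.σ : ℤ) ∧
      MoveLift W.exchangeLift W.rotateLift P.σ P.ρ Q.σ Q.ρ h ∧ Transports P Q h.1 ε ∧
      VanishesMod W.sinkIdeal (sinkProd m n k * A - ε • (h.2 * sinkProd m n k)) := by
  induction hA with
  | @relist P Q ε hσ hρ ht =>
    refine ⟨0, 1, ε, ?_, by rw [hσ, pow_zero, one_mul], by rw [hσ, hρ]; exact .refl,
      ht.transports (by rw [hσ, hρ]; rfl), ?_⟩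
    · rw [hσ]; exact (IsHom.id _).zsmul ε
    · rw [Prod.snd_one, one_mul, mul_smul_comm, mul_one, sub_self]
      exact .zero
  | @rotate P Q ε j hσ hρ ht =>
    refine ⟨0, W.rotateLift j * 1, ε, ?_, by rw [hσ, pow_zero, one_mul], ?_, ?_, ?_⟩
    · rw [hσ]; exact (IsHom.id _).zsmul ε
    · rw [hσ, hρ]; exact .rotate j .refl
    · have e : (W.rotateLift j * 1).1 = wordOp [(W.leave (.inr (j, 1)), W.leave (.inr (j, 0))),
         (W.leave (.inr (j, 1)), W.leave (.inr (j, 2)))] := by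
        rw [mul_one, wordOp, wordOp, wordOp, one_mul]; rfl
      rw [e]
      exact ht.transports (by rw [hσ, hρ, W.circ_rotate])
    · rw [mul_one, show (W.rotateLift j).2 = 1 from rfl, one_mul, mul_smul_comm, mul_one, sub_self]
      exact .zero
  | @exchange P Q ε F j j' hne hF hσ hρ ht =>
    refine ⟨1, W.exchangeLift j j' * 1, ε, ?_, ?_, ?_, ?_, ?_⟩
    · rw [hσ]; exact hF.isHom.zsmul ε
    · rw [hσ, ClosedWeb.sign_exchange _ hne, Units.val_neg, pow_one, neg_one_mul]
    · rw [hσ, hρ]; exact .exchange j j' hne .refl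
    · have e : (W.exchangeLift j j' * 1).1 = wordOp
          [(W.leave (.inr (j, 0)), W.leave (.inr (j', 0))),
           (W.leave (.inr (j, 1)), W.leave (.inr (j', 1))),
           (W.leave (.inr (j, 2)), W.leave (.inr (j', 2)))] := by
        rw [mul_one, wordOp, wordOp, wordOp, wordOp, one_mul, mul_assoc]; rfl
      rw [e]
      exact ht.transports (by rw [hσ, hρ, W.circ_exchange])
    · have := (hF.sinkProd_mul hne).smul (ε : MarkRing m)
      rw [mul_one, mul_smul_comm, ← Int.cast_smul_eq_zsmul (MarkRing m),
        ← Int.cast_smul_eq_zsmul (MarkRing m), ← smul_sub]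
      exact this
  | @comp P Q T F G _ _ ihF ihG =>
    obtain ⟨p, h, ε, h1, h2, h3, h4, h5⟩ := ihF
    obtain ⟨q, h', ε', h1', h2', h3', h4', h5'⟩ := ihG
    refine ⟨q + p, h' * h, ε' * ε, h1'.comp h1, by rw [h2', h2, pow_add, mul_assoc], h3.trans h3',
      h4'.comp h4, ?_⟩
    have e : sinkProd m n k * (G * F) - (ε' * ε) • ((h' * h).2 * sinkProd m n k) =
        (sinkProd m n k * G - ε' • (h'.2 * sinkProd m n k)) * F +
          (ε' : MarkRing m) • (h'.2 * (sinkProd m n k * F - ε • (h.2 * sinkProd m n k))) := by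
      rw [Prod.snd_mul, Int.cast_smul_eq_zsmul, sub_mul, mul_sub, smul_sub, smul_mul_assoc,
        mul_smul_comm, mul_assoc, mul_assoc, mul_assoc, smul_smul]
      abel
    rw [e]
    exact (h5'.mul_right F).add ((h5.mul_left _).smul _)

end Invariants

/-! ### Coherence of the saddle maps -/

section SaddleCoherence

variable {m n k : ℕ}

theorem Transports.neg {W W' : ClosedWeb m n k} {P : W.Rep} {Q : W'.Rep} {T : KEnd ℚ m 0} {ε : ℤ}
    (h : Transports P Q T ε) : Transports P Q (-T) (-ε) := by
  intro f hf hm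
  obtain ⟨h1, h2, h3⟩ := h f hf hm
  rw [LinearMap.neg_apply]
  refine ⟨fun x => ?_, ⟨h2.deg.neg, ?_⟩, ?_⟩
  · rw [map_neg, map_neg, h1]
  · rw [map_neg, h2.parity, smul_neg]
  · rw [← neg_one_smul ℚ, topCoeff_smul, h3]
    push_cast
    ring

theorem ClosedWeb.isHom_eta_symm (W : ClosedWeb m n k) {s t : Fin n} (hst : s ≠ t)
    (σ : Equiv.Perm (Fin k)) : IsHom (W.d σ) ((W.saddle s t).d σ) 1 (W.eta t s) := by
  have := (W.isHom_eta hst σ).zsmul (-1)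
  rwa [neg_one_zsmul, ← W.eta_swap hst] at this

/-- Up to the same sign, the saddle map of either labelling is the map of the first labelling, and
its surgery is that of the first labelling. -/
theorem ClosedWeb.exists_saddle_lift {W : ClosedWeb m n k} {s t : Fin n} (hst : s ≠ t) {P : W.Rep}
    {P' : (W.saddle s t).Rep} {F : KEnd (MarkRing m) n k}
    (hF : W.IsSaddleMap (W.saddle s t) s t P P' F ∨ W.IsSaddleMap (W.saddle s t) t s P P' F) :
    P'.σ = P.σ ∧ P'.ρ = P.ρ ∧ ∃ ε : ℤ, F = ε • (W.saddleLift s t).2 ∧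
      Transports P P' (W.saddleLift s t).1 ε := by
  rcases hF with ⟨hσ, hρ, ε, ht, hF⟩ | ⟨hσ, hρ, ε, ht, hF⟩
  · refine ⟨hσ, hρ, ε, hF, ?_⟩
    have := ht.transports (P := P) (Q := P') (by rw [hσ, hρ, W.circ_saddle]; rfl)
    rwa [wordOp, wordOp, one_mul] at this
  · refine ⟨hσ, hρ, -ε, ?_, ?_⟩
    · rw [hF, W.eta_swap hst, neg_smul, smul_neg]
      rfl
    · have := (ht.transports (P := P) (Q := P')
        (by rw [hσ, hρ, W.circ_saddle, Equiv.swap_comm]; rfl)).neg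
      rwa [wordOp, wordOp, one_mul, neg_sub] at this

/-- Canonical identifications carry saddle maps to saddle maps, up to homotopy. -/
theorem ClosedWeb.saddle_coherence (W : ClosedWeb m n k) {s t : Fin n} (hst : s ≠ t) {P Q : W.Rep}
    {P' Q' : (W.saddle s t).Rep} {A B F G : KEnd (MarkRing m) n k} (hA : W.Ident P Q A)
    (hB : (W.saddle s t).Ident P' Q' B)
    (hF : W.IsSaddleMap (W.saddle s t) s t P P' F ∨ W.IsSaddleMap (W.saddle s t) t s P P' F)
    (hG : W.IsSaddleMap (W.saddle s t) s t Q Q' G ∨ W.IsSaddleMap (W.saddle s t) t s Q Q' G) :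
    ∃ p : ℕ, IsHom (W.d P.σ) ((W.saddle s t).d Q'.σ) p (B * F) ∧
      IsHom (W.d P.σ) ((W.saddle s t).d Q'.σ) p (G * A) ∧
      Homotopic (W.d P.σ) ((W.saddle s t).d Q'.σ) p (B * F) (G * A) := by
  obtain ⟨p, a, εA, hA1, hA2, hA3, hA4, hA5⟩ := hA.exists_lift
  obtain ⟨q, b, εB, hB1, hB2, hB3, hB4, hB5⟩ := hB.exists_lift
  obtain ⟨hFσ, hFρ, εF, hF1, hF2⟩ := W.exists_saddle_lift hst hF
  obtain ⟨hGσ, hGρ, εG, hG1, hG2⟩ := W.exists_saddle_lift hst hG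
  have hpq : (-1 : ℤ) ^ p = (-1) ^ q := by
    rw [hGσ, hFσ, hA2] at hB2
    exact mul_right_cancel₀ (Units.ne_zero _) hB2
  have hB3' : MoveLift W.exchangeLift W.rotateLift P.σ P.ρ Q.σ Q.ρ b := by
    rw [hFσ, hFρ, hGσ, hGρ] at hB3
    exact hB3
  -- The two chains of moves have lifts which agree up to a common sign `δ`.
  obtain ⟨δ, hδ⟩ : ∃ δ : ℤˣ, b = (δ : ℤ) • a := by
    rcases W.moveLift_unique hB3' hA3 with h | h
    · exact ⟨1, by rw [h, Units.val_one, one_smul]⟩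
    · exact ⟨-1, by rw [h, Units.val_neg, Units.val_one, neg_one_smul]⟩
  set e := W.saddleLift s t with he
  obtain ⟨c, hcc, hc⟩ : ∃ c : ℤ, c * c = 1 ∧ b * e = c • (e * a) := by
    refine ⟨(δ * (Equiv.Perm.sign Q.σ * Equiv.Perm.sign P.σ) : ℤˣ), ?_, ?_⟩
    · rw [← Units.val_mul, Int.units_mul_self, Units.val_one]
    · rw [hδ, smul_mul_assoc, hA3.mul_saddleLift hst, smul_smul, Units.val_mul, Units.val_mul]
  -- The signs agree, since both composites transport the same states.
  have hsign : εB * εF = c * (εG * εA) := by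
    refine Transports.unique (P := P) (Q := Q') (T := e.1 * a.1) ?_ (hG2.comp hA4)
    have := hB4.comp hF2
    rwa [← Prod.fst_mul, hc, Prod.smul_fst, Prod.fst_mul] at this
  have hF' : IsHom (W.d P.σ) ((W.saddle s t).d P'.σ) 1 F := by
    rw [hF1, hFσ]; exact (W.isHom_eta hst _).zsmul _
  have hG' : IsHom (W.d Q.σ) ((W.saddle s t).d Q'.σ) 1 G := by
    rw [hG1, hGσ]; exact (W.isHom_eta hst _).zsmul _
  have hBF := hB1.comp hF'
  have hGA : IsHom (W.d P.σ) ((W.saddle s t).d Q'.σ) (q + 1) (G * A) :=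
    (hG'.comp hA1).of_pow_eq (by rw [pow_add, pow_add, hpq, mul_comm])
  refine ⟨q + 1, hBF, hGA, W.homotopic_of_vanishesMod (W.saddle s t) rfl _ _ hBF hGA ?_⟩
  set L := sinkProd m n k
  set κ : MarkRing m := (-1) ^ k
  have hL : L * e.2 = κ • (e.2 * L) := sinkProd_mul_eta W hst
  have hc2 : b.2 * e.2 = c • (e.2 * a.2) := by
    rw [← Prod.snd_mul, hc, Prod.smul_snd, Prod.snd_mul]
  have key : L * (B * F - G * A) = (L * B - εB • (b.2 * L)) * F -
      κ • (εG : MarkRing m) • (e.2 * (L * A - εA • (a.2 * L))) := by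
    have e1 : εB • (b.2 * L) * F = κ • ((εB * εF) • (b.2 * e.2 * L)) := by
      rw [hF1, smul_mul_assoc, mul_assoc, mul_smul_comm, hL, mul_smul_comm, mul_smul_comm, smul_smul,
        smul_comm κ, mul_assoc]
    have e2 : L * G = κ • (εG • (e.2 * L)) := by
      rw [hG1, mul_smul_comm, hL, smul_comm]
    rw [Int.cast_smul_eq_zsmul, mul_sub, sub_mul, e1, hsign, hc2, mul_sub, ← mul_assoc L G, e2,
      ← mul_assoc L B, smul_mul_assoc, smul_mul_assoc, mul_assoc, mul_assoc e.2 L A, smul_mul_assoc,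
      mul_smul_comm, smul_sub, smul_sub, smul_smul εG, mul_assoc e.2 a.2,
      smul_smul _ c, show c * (εG * εA) * c = εG * εA by rw [mul_comm c, mul_assoc, hcc, mul_one]]
    abel
  rw [key]
  exact (hB5.mul_right F).sub (((hA5.mul_left _).smul _).smul _)

end SaddleCoherence

/-! ### Existence of saddle maps and of canonical identifications -/

section Existence

variable {m n k : ℕ}

theorem ClosedWeb.exists_isSaddleMap (W : ClosedWeb m n k) {s t : Fin n} (hst : s ≠ t) (P : W.Rep) :
    (∃ P' F, W.IsSaddleMap (W.saddle s t) s t P P' F) ∧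
    (∃ P' F, W.IsSaddleMap (W.saddle s t) t s P P' F) := by
  have hne : W.leave (.inl s) ≠ W.leave (.inl t) := W.leave.injective.ne (by simpa using hst)
  have key (p : Fin m × Fin m) (hp : p.1 ≠ p.2)
      (hc : (W.saddle s t).circ P.σ P.ρ = W.circ P.σ P.ρ * Equiv.swap p.1 p.2) :
      ∃ (P' : (W.saddle s t).Rep) (ε : ℤ), P'.σ = P.σ ∧ P'.ρ = P.ρ ∧
        Turn (W.circ P.σ P.ρ) P.circles [p] P'.circles ε := by
    obtain ⟨l', ε, ht, hl'⟩ := P.listsCycles.exists_turn (w := [p]) (by simpa using hp)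
    rw [wordPerm, wordPerm, ← hc] at hl'
    exact ⟨⟨P.σ, P.ρ, l', hl'.distinct, hl'.complete⟩, ε, rfl, rfl, ht⟩
  constructor
  · obtain ⟨P', ε, h1, h2, ht⟩ := key (W.leave (.inl s), W.leave (.inl t)) hne (W.circ_saddle s t _ _)
    exact ⟨P', _, h1, h2, ε, ht, rfl⟩
  · obtain ⟨P', ε, h1, h2, ht⟩ := key (W.leave (.inl t), W.leave (.inl s)) hne.symm
      (by rw [W.circ_saddle, Equiv.swap_comm])
    exact ⟨P', _, h1, h2, ε, ht, rfl⟩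

/-- Some representative with the identification `σ` and the positions `ρ` is canonically identified
with `P`. -/
def ClosedWeb.Reaches {W : ClosedWeb m n k} (P : W.Rep) (σ : Equiv.Perm (Fin k)) (ρ : Fin k → Fin 3) :
    Prop :=
  ∃ (Q : W.Rep) (A : KEnd (MarkRing m) n k), Q.σ = σ ∧ Q.ρ = ρ ∧ W.Ident P Q A

namespace ClosedWeb.Reaches

variable {W : ClosedWeb m n k} {P : W.Rep} {σ : Equiv.Perm (Fin k)} {ρ : Fin k → Fin 3}

theorem refl (P : W.Rep) : Reaches P P.σ P.ρ := ⟨P, _, rfl, rfl, .relist rfl rfl (.nil _ _)⟩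

theorem rotate (h : Reaches P σ ρ) (j : Fin k) :
    Reaches P σ (Function.update ρ j (ρ j + 1)) := by
  obtain ⟨Q, A, rfl, rfl, hA⟩ := h
  obtain ⟨l', ε, ht, hl'⟩ := Q.listsCycles.exists_turn
    (w := [(W.leave (.inr (j, 1)), W.leave (.inr (j, 0))),
      (W.leave (.inr (j, 1)), W.leave (.inr (j, 2)))])
    (by simp)
  rw [← W.circ_rotate] at hl'
  exact ⟨⟨Q.σ, _, l', hl'.distinct, hl'.complete⟩, _, rfl, rfl, hA.comp (.rotate j rfl rfl ht)⟩

theorem exchange (h : Reaches P σ ρ) {j j' : Fin k} (hj : j ≠ j') :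
    Reaches P (exchange σ j j') (ρ ∘ Equiv.swap j j') := by
  obtain ⟨Q, A, rfl, rfl, hA⟩ := h
  obtain ⟨l', ε, ht, hl'⟩ := Q.listsCycles.exists_turn
    (w := [(W.leave (.inr (j, 0)), W.leave (.inr (j', 0))),
      (W.leave (.inr (j, 1)), W.leave (.inr (j', 1))),
      (W.leave (.inr (j, 2)), W.leave (.inr (j', 2)))])
    (by simp [hj])
  rw [← W.circ_exchange] at hl'
  exact ⟨⟨ClosedWeb.exchange Q.σ j j', _, l', hl'.distinct, hl'.complete⟩, _, rfl, rfl,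
    hA.comp (.exchange j j' hj (W.isExchangeIso_exchangeMap Q.σ hj) rfl rfl ht)⟩

theorem update (h : Reaches P σ ρ) (j : Fin k) (c : Fin 3) : Reaches P σ (Function.update ρ j c) := by
  have key (i : ℕ) : Reaches P σ (Function.update ρ j (ρ j + Fin.ofNat 3 i)) := by
    induction i with
    | zero => simpa using h
    | succ i ih =>
      have := ih.rotate j
      rw [Function.update_idem, Function.update_self, add_assoc] at this
      convert this using 3
      ext
      simp [Fin.val_add]
  have := key (c - ρ j).val
  simpa using this

theorem all (P : W.Rep) (σ : Equiv.Perm (Fin k)) (ρ : Fin k → Fin 3) : Reaches P σ ρ := by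
  have h1 (g : Equiv.Perm (Fin k)) : Reaches P (P.σ * g) (P.ρ ∘ g) := by
    induction g using Equiv.Perm.swap_induction_on' with
    | one => exact .refl P
    | mul_swap g a b hab ih => exact ih.exchange hab
  have h2 (s : Finset (Fin k)) : Reaches P σ fun i => if i ∈ s then ρ i else P.ρ ((P.σ⁻¹ * σ) i) := by
    induction s using Finset.induction_on with
    | empty =>
      have := h1 (P.σ⁻¹ * σ)
      rw [mul_inv_cancel_left] at this
      simp only [Finset.notMem_empty, if_false]
      exact this
    | insert j s hj ih =>
      have := ih.update j (ρ j)
      convert this using 1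
      funext i
      by_cases hi : i = j
      · subst hi; simp
      · simp [hi]
  simpa using h2 Finset.univ

end ClosedWeb.Reaches

/-- Any two representatives are canonically identified. -/
theorem ClosedWeb.exists_ident {W : ClosedWeb m n k} (P Q : W.Rep) : ∃ A, W.Ident P Q A := by
  obtain ⟨P₁, A, hσ, hρ, hA⟩ := Reaches.all P Q.σ Q.ρ
  have h₁ := P₁.listsCycles
  have h₂ := Q.listsCycles
  rw [← hσ, ← hρ] at h₂
  obtain ⟨ε, ht⟩ := h₁.exists_relist h₂
  exact ⟨_, hA.comp (.relist hσ.symm hρ.symm ht)⟩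

end Existence

/-! ### Removing a mark -/

section Contraction

variable {m n k : ℕ}

/-- The permutation `π₀` arises from `π` by contracting the step from `p` to `π p`; the map of marks
is `f`. -/
structure Contracts {m : ℕ} (p : Fin (m + 1)) (f : Fin (m + 1) → Fin m) (π : Equiv.Perm (Fin (m + 1)))
    (π₀ : Equiv.Perm (Fin m)) : Prop where
  ne : π p ≠ p
  glue : f (π p) = f p
  inj : ∀ x y, x ≠ p → y ≠ p → f x = f y → x = y
  step : ∀ x, x ≠ p → f (π x) = π₀ (f x)

namespace Contracts

variable {p : Fin (m + 1)} {f : Fin (m + 1) → Fin m} {π : Equiv.Perm (Fin (m + 1))}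
  {π₀ : Equiv.Perm (Fin m)} (h : Contracts p f π π₀)
include h

theorem sameCycle_of_eq {x y : Fin (m + 1)} (e : f x = f y) : π.SameCycle x y := by
  -- A representative other than `p` of the fibre.
  have key (x : Fin (m + 1)) : ∃ x', x' ≠ p ∧ f x' = f x ∧ π.SameCycle x x' := by
    by_cases hx : x = p
    · subst hx
      exact ⟨π x, h.ne, h.glue, Equiv.Perm.sameCycle_apply_right.2 (.refl _ _)⟩
    · exact ⟨x, hx, rfl, .refl _ _⟩
  obtain ⟨x', hx, ex, cx⟩ := key x
  obtain ⟨y', hy, ey, cy⟩ := key y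
  obtain rfl := h.inj x' y' hx hy (by rw [ex, ey, e])
  exact cx.trans cy.symm

theorem sameCycle_iff {x y : Fin (m + 1)} : π₀.SameCycle (f x) (f y) ↔ π.SameCycle x y := by
  constructor
  · intro hc
    obtain ⟨i, -, hi⟩ := hc.exists_pow_eq'
    have key (i : ℕ) : ∃ x', π.SameCycle x x' ∧ f x' = (π₀ ^ i) (f x) := by
      induction i with
      | zero => exact ⟨x, .refl _ _, rfl⟩
      | succ i ih =>
        obtain ⟨x', h1, h2⟩ := ih
        rw [pow_succ', Equiv.Perm.mul_apply, ← h2]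
        by_cases hx : x' = p
        · subst hx
          refine ⟨π (π x'), ?_, by rw [h.step _ h.ne, h.glue]⟩
          rwa [Equiv.Perm.sameCycle_apply_right, Equiv.Perm.sameCycle_apply_right]
        · exact ⟨π x', Equiv.Perm.sameCycle_apply_right.2 h1, h.step _ hx⟩
    obtain ⟨x', h1, h2⟩ := key i
    exact h1.trans (h.sameCycle_of_eq (h2.trans hi))
  · intro hc
    obtain ⟨i, -, rfl⟩ := hc.exists_pow_eq'
    clear hc
    induction i with
    | zero => exact .refl _ _
    | succ i ih =>
      rw [pow_succ', Equiv.Perm.mul_apply]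
      by_cases hx : (π ^ i) x = p
      · rw [hx, h.glue, ← hx]
        exact ih
      · rw [h.step _ hx]
        exact Equiv.Perm.sameCycle_apply_right.2 ih

theorem surgery {x y : Fin (m + 1)} (hx : x ≠ p) (hy : y ≠ p) :
    Contracts p f (π * Equiv.swap x y) (π₀ * Equiv.swap (f x) (f y)) := by
  have hp : (π * Equiv.swap x y) p = π p := mul_swap_apply_of_ne hx.symm hy.symm
  refine ⟨by rw [hp]; exact h.ne, by rw [hp]; exact h.glue, h.inj, fun z hz => ?_⟩
  rw [Equiv.Perm.mul_apply, Equiv.Perm.mul_apply]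
  by_cases h1 : z = x
  · subst h1
    rw [Equiv.swap_apply_left, Equiv.swap_apply_left, h.step _ hy]
  by_cases h2 : z = y
  · subst h2
    rw [Equiv.swap_apply_right, Equiv.swap_apply_right, h.step _ hx]
  rw [Equiv.swap_apply_of_ne_of_ne h1 h2, Equiv.swap_apply_of_ne_of_ne
    (fun e => h1 (h.inj _ _ hz hx e)) (fun e => h2 (h.inj _ _ hz hy e)), h.step _ hz]

end Contracts

/-- Signs of surgeries do not change when a mark is removed. -/
theorem Turn.contract {p : Fin (m + 1)} {f : Fin (m + 1) → Fin m} {π : Equiv.Perm (Fin (m + 1))}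
    {π₀ : Equiv.Perm (Fin m)} (h : Contracts p f π π₀) {l l' : List (Fin (m + 1))}
    {w : List (Fin (m + 1) × Fin (m + 1))} {ε : ℤ} (ht : Turn π l w l' ε)
    (hw : ∀ z ∈ w, z.1 ≠ p ∧ z.2 ≠ p) :
    Turn π₀ (l.map f) (w.map (Prod.map f f)) (l'.map f) ε := by
  induction ht generalizing π₀ with
  | nil => exact .nil _ _
  | @rep π l l₁ w l' ε hl _ ih =>
    refine .rep ?_ (ih h hw)
    rw [List.forall₂_map_left_iff, List.forall₂_map_right_iff]
    exact hl.imp fun x y hxy => h.sameCycle_iff.2 hxy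
  | exch _ ih =>
    have := ih h hw
    simp only [List.map_append, List.map_cons] at this ⊢
    exact this.exch
  | @merge π x y r w l' ε hc _ ih =>
    obtain ⟨hx, hy⟩ := hw (x, y) (by simp)
    have := ih (h.surgery hx hy) fun z hz => hw z (by simp [hz])
    exact .merge (fun h' => hc (h.sameCycle_iff.1 h')) this
  | @split π x y r w l' ε hxy hc _ ih =>
    obtain ⟨hx, hy⟩ := hw (x, y) (by simp)
    have := ih (h.surgery hx hy) fun z hz => hw z (by simp [hz])
    exact .split (fun e => hxy (h.inj _ _ hx hy e)) (h.sameCycle_iff.2 hc) this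

theorem keepRow_injective (u : Fin (n + 1)) : Function.Injective (keepRow u : Row n k → Row (n + 1) k) :=
  Sum.map_injective.2 ⟨Fin.succAbove_right_injective, Function.injective_id⟩

theorem exists_keepRow {u : Fin (n + 1)} {r : Row (n + 1) k} (h : r ≠ .inl u) :
    ∃ r₀ : Row n k, keepRow u r₀ = r := by
  rcases r with e | q
  · obtain ⟨e₀, he⟩ := Fin.exists_succAbove_eq (x := e) (y := u) (by simpa using h)
    exact ⟨.inl e₀, by simp [keepRow, he]⟩
  · exact ⟨.inr q, rfl⟩

theorem rowRank_keepRow (u : Fin (n + 1)) (r r' : Row n k) :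
    rowRank (keepRow u r) < rowRank (keepRow u r') ↔ rowRank r < rowRank r' := by
  rcases r with e | ⟨j, i⟩ <;> rcases r' with e' | ⟨j', i'⟩ <;>
    simp only [keepRow, Sum.map_inl, Sum.map_inr, id_eq, rowRank]
  · exact (Fin.strictMono_succAbove u).lt_iff_lt
  · have := (u.succAbove e).isLt
    have := e.isLt
    omega
  · have := (u.succAbove e').isLt
    have := e'.isLt
    omega
  · omega

section

variable {W : ClosedWeb (m + 1) (n + 1) k} {u : Fin (n + 1)} {f : Fin (m + 1) → Fin m}
  {W₀ : ClosedWeb m n k} (h : RemovesMark W u f W₀)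
include h

theorem RemovesMark.contracts (σ : Equiv.Perm (Fin k)) (ρ : Fin k → Fin 3) :
    Contracts (W.leave (.inl u)) f (W.circ σ ρ) (W₀.circ σ ρ) := by
  have hu : W.circ σ ρ (W.leave (.inl u)) = W.enter (.inl u) := by
    rw [W.circ_leave]; rfl
  refine ⟨by rw [hu]; exact h.ne.symm, by rw [hu, h.glue], fun x y hx hy e => ?_, fun x hx => ?_⟩
  · rcases h.inj x y e with e | ⟨h1, h2⟩
    · exact e
    · rw [h1.resolve_left hx, h2.resolve_left hy]
  · obtain ⟨r, rfl⟩ := W.leave.surjective x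
    obtain ⟨r₀, rfl⟩ := exists_keepRow (u := u) (r := r) fun e => hx (by rw [e])
    rw [W.circ_leave, ← h.leave, W₀.circ_leave, h.enter]
    congr 2
    rcases r₀ with e | q <;> rfl

theorem RemovesMark.listsCycles {σ : Equiv.Perm (Fin k)} {ρ : Fin k → Fin 3} {l : List (Fin (m + 1))}
    (hl : ListsCycles (W.circ σ ρ) l) : ListsCycles (W₀.circ σ ρ) (l.map f) where
  distinct := by
    rw [List.pairwise_map]
    exact hl.distinct.imp fun hxy h' => hxy ((h.contracts σ ρ).sameCycle_iff.1 h')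
  complete x := by
    obtain ⟨r, rfl⟩ := W₀.leave.surjective x
    obtain ⟨y, hy, e⟩ := hl.complete (W.leave (keepRow u r))
    rw [h.leave]
    exact ⟨f y, List.mem_map_of_mem hy, (h.contracts σ ρ).sameCycle_iff.2 e⟩

theorem RemovesMark.saddle (s t : Fin n) :
    RemovesMark (W.saddle (u.succAbove s) (u.succAbove t)) u f (W₀.saddle s t) := by
  have hu : (W.saddle (u.succAbove s) (u.succAbove t)).enter (.inl u) = W.enter (.inl u) := by
    have : Equiv.swap (Sum.inl (u.succAbove s) : Row (n + 1) k) (.inl (u.succAbove t)) (.inl u) =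
        .inl u :=
      Equiv.swap_apply_of_ne_of_ne (by simp) (by simp)
    simp only [ClosedWeb.saddle, Equiv.trans_apply, this]
  refine ⟨by rw [hu]; exact h.ne, by rw [hu]; exact h.glue, by rw [hu]; exact h.inj, h.leave,
    fun r => ?_⟩
  have := (keepRow_injective (k := k) u).map_swap (.inl s) (.inl t) r
  simp only [ClosedWeb.saddle, Equiv.trans_apply]
  rw [h.enter, this]
  rfl

end

section

variable (u : Fin (n + 1)) (f : Fin (m + 1) → Fin m) (z z' : KMod (MarkRing (m + 1)) (n + 1) k)

theorem excludeVar_add : excludeVar u f (z + z') = excludeVar u f z + excludeVar u f z' :=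
  funext fun _ => map_add (rename f) _ _

theorem excludeVar_sub : excludeVar u f (z - z') = excludeVar u f z - excludeVar u f z' :=
  funext fun _ => map_sub (rename f) _ _

theorem excludeVar_smul (c : MarkRing (m + 1)) :
    excludeVar u f (c • z) = rename f c • excludeVar u f z :=
  funext fun _ => map_mul (rename f) _ _

theorem excludeVar_zsmul (c : ℤ) : excludeVar u f (c • z) = c • excludeVar u f z :=
  funext fun _ => map_zsmul (rename f) _ _

theorem ksign_keepRow (i : Row n k) (S : Finset (Row n k)) :
    ksign (keepRow u i) (S.image (keepRow u)) = ksign i S := by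
  rw [ksign, ksign, Finset.filter_image, Finset.card_image_of_injective _ (keepRow_injective u)]
  simp only [rowRank_keepRow]

theorem excludeVar_raise (i : Row n k) :
    excludeVar u f (raise (keepRow u i) z) = raise i (excludeVar u f z) := by
  funext S
  have hm := (keepRow_injective (k := k) u).mem_finset_image (s := S) (a := i)
  rw [excludeVar, raise_apply, raise_apply, ksign_keepRow]
  by_cases hi : i ∈ S
  · rw [if_pos hi, if_pos (hm.2 hi), map_mul, map_intCast, ← Finset.image_erase (keepRow_injective u)]
    rfl
  · rw [if_neg hi, if_neg (mt hm.1 hi), map_zero]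

theorem excludeVar_lower (i : Row n k) :
    excludeVar u f (lower (keepRow u i) z) = lower i (excludeVar u f z) := by
  funext S
  have hm := (keepRow_injective (k := k) u).mem_finset_image (s := S) (a := i)
  rw [excludeVar, lower_apply, lower_apply, ksign_keepRow]
  by_cases hi : i ∈ S
  · rw [if_pos hi, if_pos (hm.2 hi), map_zero]
  · rw [if_neg hi, if_neg (mt hm.1 hi), map_mul, map_intCast, ← Finset.image_insert]
    rfl

theorem rename_ePoly (x y w : MarkRing (m + 1)) :
    rename f (ePoly x y w) = ePoly (rename f x) (rename f y) (rename f w) := by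
  have hr (q : ℚ) : rename f (rat (m + 1) q) = rat m q := rename_C f _
  have ha : rename f (pa (m + 1)) = pa m := rename_C f _
  have hb : rename f (pb (m + 1)) = pb m := rename_C f _
  simp only [ePoly, map_sub, map_add, map_mul, map_pow, hr, ha, hb]

end

/-- The saddle homomorphism commutes with the exclusion of a variable along another arc. -/
theorem RemovesMark.excludeVar_eta {W : ClosedWeb (m + 1) (n + 1) k} {u : Fin (n + 1)}
    {f : Fin (m + 1) → Fin m} {W₀ : ClosedWeb m n k} (h : RemovesMark W u f W₀) {s t : Fin n}
    (hst : s ≠ t)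
    (z : KMod (MarkRing (m + 1)) (n + 1) k) :
    excludeVar u f (W.eta (u.succAbove s) (u.succAbove t) z) = W₀.eta s t (excludeVar u f z) := by
  have hst' : u.succAbove s ≠ u.succAbove t := fun e => hst (Fin.succAbove_right_injective e)
  have hk (e : Fin n) : (Sum.inl (u.succAbove e) : Row (n + 1) k) = keepRow u (.inl e) := rfl
  rw [W.eta_eq hst', W₀.eta_eq hst, h.leave, h.leave, h.enter, h.enter]
  simp only [hk, LinearMap.add_apply, LinearMap.sub_apply, LinearMap.smul_apply, Module.End.mul_apply,
    excludeVar_add, excludeVar_sub, excludeVar_smul, excludeVar_raise, excludeVar_lower, map_add, map_sub,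
    map_neg, rename_ePoly, rename_X]

/-- Removing a mark takes saddle maps to saddle maps. -/
theorem RemovesMark.exists_isSaddleMap {W : ClosedWeb (m + 1) (n + 1) k} {u : Fin (n + 1)}
    {f : Fin (m + 1) → Fin m} {W₀ : ClosedWeb m n k} (h : RemovesMark W u f W₀) {s t : Fin n}
    (hst : s ≠ t)
    (P : W.Rep) (P' : (W.saddle (u.succAbove s) (u.succAbove t)).Rep)
    (F : KEnd (MarkRing (m + 1)) (n + 1) k)
    (hF : W.IsSaddleMap (W.saddle (u.succAbove s) (u.succAbove t))
      (u.succAbove s) (u.succAbove t) P P' F) :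
    ∃ (P₀ : W₀.Rep) (P₀' : (W₀.saddle s t).Rep) (F₀ : KEnd (MarkRing m) n k),
      P₀.σ = P.σ ∧ P₀.ρ = P.ρ ∧ P₀.circles = P.circles.map f ∧ P₀'.circles = P'.circles.map f ∧
      W₀.IsSaddleMap (W₀.saddle s t) s t P₀ P₀' F₀ ∧
      ∀ z, excludeVar u f (F z) = F₀ (excludeVar u f z) := by
  obtain ⟨hσ, hρ, ε, ht, rfl⟩ := hF
  have h₀ := h.listsCycles P.listsCycles
  have h₀' := (h.saddle s t).listsCycles P'.listsCycles
  have hne (e : Fin n) : W.leave (.inl (u.succAbove e)) ≠ W.leave (.inl u) :=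
    W.leave.injective.ne (by simp)
  have ht₀ := ht.contract (h.contracts P.σ P.ρ) (by simp [Fin.succAbove_ne])
  rw [List.map_cons, List.map_nil] at ht₀
  have hl (e : Fin n) : f (W.leave (.inl (u.succAbove e))) = W₀.leave (.inl e) := (h.leave (.inl e)).symm
  rw [Prod.map_apply, hl, hl] at ht₀
  refine ⟨⟨P.σ, P.ρ, P.circles.map f, h₀.distinct, h₀.complete⟩,
    ⟨P'.σ, P'.ρ, P'.circles.map f, h₀'.distinct, h₀'.complete⟩, ε • W₀.eta s t, rfl, rfl, rfl, rfl,
    ⟨hσ, hρ, ε, ht₀, rfl⟩, fun z => ?_⟩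
  rw [LinearMap.smul_apply, LinearMap.smul_apply, excludeVar_zsmul, h.excludeVar_eta hst]

end Contraction

end Sl3

end

theorem mainTheorem10 :
    -- existence and independence of all choices, for every saddle between closed webs
    (∀ (m n k : ℕ) (W : Sl3.ClosedWeb m n k) (s t : Fin n), s ≠ t →
      -- for both labellings, `η` is a homomorphism to the shift by `⟨1⟩` of the target
      (∀ σ : Equiv.Perm (Fin k),
        Sl3.IsHom (W.d σ) ((W.saddle s t).d σ) 1 (W.eta s t) ∧
        Sl3.IsHom (W.d σ) ((W.saddle s t).d σ) 1 (W.eta t s)) ∧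
      -- every representative of the source, and either labelling, gives a saddle map
      (∀ P : W.Rep,
        (∃ P' F, W.IsSaddleMap (W.saddle s t) s t P P' F) ∧
        (∃ P' F, W.IsSaddleMap (W.saddle s t) t s P P' F)) ∧
      -- any two representatives are canonically identified
      (∀ P Q : W.Rep, ∃ A, W.Ident P Q A) ∧
      (∀ P' Q' : (W.saddle s t).Rep, ∃ B, (W.saddle s t).Ident P' Q' B) ∧
      -- the canonical identifications carry any saddle map to any other, up to homotopy
      (∀ (P Q : W.Rep) (P' Q' : (W.saddle s t).Rep) (A B F G : Sl3.KEnd (Sl3.MarkRing m) n k),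
        W.Ident P Q A → (W.saddle s t).Ident P' Q' B →
        (W.IsSaddleMap (W.saddle s t) s t P P' F ∨ W.IsSaddleMap (W.saddle s t) t s P P' F) →
        (W.IsSaddleMap (W.saddle s t) s t Q Q' G ∨ W.IsSaddleMap (W.saddle s t) t s Q Q' G) →
        ∃ p : ℕ, Sl3.IsHom (W.d P.σ) ((W.saddle s t).d Q'.σ) p (B * F) ∧
          Sl3.IsHom (W.d P.σ) ((W.saddle s t).d Q'.σ) p (G * A) ∧
          Sl3.Homotopic (W.d P.σ) ((W.saddle s t).d Q'.σ) p (B * F) (G * A))) ∧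
    -- independence of the marks
    (∀ (m n k : ℕ) (W : Sl3.ClosedWeb (m + 1) (n + 1) k) (W₀ : Sl3.ClosedWeb m n k)
      (u : Fin (n + 1)) (f : Fin (m + 1) → Fin m), Sl3.RemovesMark W u f W₀ →
      ∀ (s t : Fin n), s ≠ t →
      ∀ (P : W.Rep) (P' : (W.saddle (u.succAbove s) (u.succAbove t)).Rep)
        (F : Sl3.KEnd (Sl3.MarkRing (m + 1)) (n + 1) k),
        W.IsSaddleMap (W.saddle (u.succAbove s) (u.succAbove t))
          (u.succAbove s) (u.succAbove t) P P' F →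
        ∃ (P₀ : W₀.Rep) (P₀' : (W₀.saddle s t).Rep) (F₀ : Sl3.KEnd (Sl3.MarkRing m) n k),
          P₀.σ = P.σ ∧ P₀.ρ = P.ρ ∧ P₀.circles = P.circles.map f ∧
          P₀'.circles = P'.circles.map f ∧
          W₀.IsSaddleMap (W₀.saddle s t) s t P₀ P₀' F₀ ∧
          ∀ z, Sl3.excludeVar u f (F z) = F₀ (Sl3.excludeVar u f z)) := by
  refine ⟨fun m n k W s t hst => ⟨fun σ => ⟨W.isHom_eta hst σ, W.isHom_eta_symm hst σ⟩,
    W.exists_isSaddleMap hst, Sl3.ClosedWeb.exists_ident, Sl3.ClosedWeb.exists_ident,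
    fun P Q P' Q' A B F G hA hB hF hG => W.saddle_coherence hst hA hB hF hG⟩,
    fun m n k W W₀ u f h s t hst P P' F hF => h.exists_isSaddleMap hst P P' F hF⟩
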